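/- Let $k$ be an algebraically closed field and let $A=\bigoplus_{i\ge 0}A_i$ be a graded $k$-algebra with every $A_i$ finite-dimensional over $k$. Modules are left modules. A graded $A$-module is an $A$-module $M=\bigoplus_{i\in\mathbb Z}M_i$ with $A_iM_j\subseteq M_{i+j}$; it is locally finite if every $M_i$ is finite-dimensional over $k$, and generated in degree $s$ if $M=A\cdot M_s$. A Koszul $A$-module is a locally finite graded $A$-module $M$, generated in degree $0$, that has a resolution $\cdots\to P^1\to P^0\to M\to 0$ by locally finite graded projective modules and degree-preserving maps with $P^i$ generated in degree $i$ for all $i\ge 0$. The Koszul $A$-modules form a category whose morphisms are the degree-preserving $A$-linear maps. The same definitions are used for every non-negatively graded $k$-algebra. Suppose that $A_0$ is self-injective (every projective $A_0$-module is injective) and that $A$ is Koszul, that is, $A_0$, viewed as the graded $A$-module $A/\bigoplus_{i\ge 1}A_i$ concentrated in degree $0$, is a Koszul $A$-module. Let $\Gamma=\bigoplus_{i\ge 0}\operatorname{Ext}^i_A(A_0,A_0)$, graded by $i$, with the Yoneda product in which $xy$ is "$y$ followed by $x$". For a graded $A$-module $M$ let $E(M)=\bigoplus_{i\ge0}\operatorname{Ext}^i_A(M,A_0)$,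 a graded left $\Gamma$-module via the Yoneda product; here $\operatorname{Ext}_A$ is taken in the category of all (ungraded) $A$-modules. Similarly let $E_\Gamma(N)=\bigoplus_{i\ge 0}\operatorname{Ext}^i_\Gamma(N,\Gamma_0)$, a graded left module over $\bigoplus_{i\ge 0}\operatorname{Ext}^i_\Gamma(\Gamma_0,\Gamma_0)$, where $\Gamma_0$ is viewed as the $\Gamma$-module $\Gamma/\bigoplus_{i\ge1}\Gamma_i$. Theorem (generalized Koszul duality). 1. If $M$ is a Koszul $A$-module, then $E(M)$ is a Koszul $\Gamma$-module. 2. The resulting contravariant functor $E$ from the category of Koszul $A$-modules to the category of Koszul $\Gamma$-modules is a duality, i.e. a contravariant equivalence of categories. 3. There is an isomorphism of graded $k$-algebras $A\cong\bigoplus_{i\ge 0}\operatorname{Ext}^i_\Gamma(\Gamma_0,\Gamma_0)$ such that, when $E_\Gamma(E(M))$ is regarded as a graded $A$-module through it, $E_\Gamma(E(M))\cong M$ as graded $A$-modules, naturally in the Koszul $A$-module $M$. -/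

import Mathlib

open CategoryTheory CategoryTheory.Abelian Opposite DirectSum

universe v u

noncomputable section

namespace GrKoszul

/-! ## Homogeneous pieces of an external direct sum -/

section Pieces

variable {k : Type v} [Field k] {ι : Type}
  {X : ℕ → Type u} [∀ i, AddCommGroup (X i)] [∀ i, Module k (X i)]

variable (k X) in
/-- The degree `n` piece of `⨁ i, X i`, the summand `X i` being placed in degree `e i`. -/
def pieces (e : ℕ → ι) (n : ι) : Submodule k (⨁ i, X i) where
  carrier := {x | ∀ i, e i ≠ n → x i = 0}
  zero_mem' := fun _ _ => rfl
  add_mem' := fun {x y} hx hy i hi => by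
    rw [DirectSum.add_apply, hx i hi, hy i hi, add_zero]
  smul_mem' := fun c x hx i hi => by
    rw [DirectSum.smul_apply, hx i hi, smul_zero]

theorem of_mem_pieces (e : ℕ → ι) (i : ℕ) (x : X i) :
    DirectSum.of X i x ∈ pieces k X e (e i) := by
  intro j hj
  exact DirectSum.of_eq_of_ne _ _ _ (fun h => hj (by rw [h]))

theorem pieces_induction {e : ℕ → ι} (he : Function.Injective e) {n : ι}
    {p : (⨁ i, X i) → Prop} (h0 : p 0) (h1 : ∀ i (x : X i), e i = n → p (DirectSum.of X i x))
    {x : ⨁ i, X i} (hx : x ∈ pieces k X e n) : p x := by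
  by_cases h : ∃ i, e i = n
  · obtain ⟨i, hi⟩ := h
    have : x = DirectSum.of X i (x i) := by
      refine DFinsupp.ext fun j => ?_
      by_cases hj : i = j
      · subst hj
        exact (DirectSum.of_eq_same i (x i)).symm
      · rw [hx j (fun h => hj (he (hi.trans h.symm)))]
        exact (DirectSum.of_eq_of_ne i j (x i) (Ne.symm hj)).symm
    rw [this]
    exact h1 i _ hi
  · have : x = 0 := DFinsupp.ext fun j => hx j (fun hj => h ⟨j, hj⟩)
    rw [this]
    exact h0

variable (k X) in
/-- Auxiliary map: the decomposition of an element of `⨁ i, X i` into homogeneous pieces. -/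
def piecesDecompose [DecidableEq ι] (e : ℕ → ι) : (⨁ i, X i) →+ ⨁ n, pieces k X e n :=
  DirectSum.toAddMonoid fun i =>
    (DirectSum.of (fun n => pieces k X e n) (e i)).comp
      (AddMonoidHom.codRestrict (DirectSum.of X i) (pieces k X e (e i)) (of_mem_pieces e i))

theorem piecesDecompose_of [DecidableEq ι] (e : ℕ → ι) (i : ℕ) (x : X i) :
    piecesDecompose k X e (DirectSum.of X i x) =
      DirectSum.of (fun n => pieces k X e n) (e i) ⟨DirectSum.of X i x, of_mem_pieces e i x⟩ :=
  DirectSum.toAddMonoid_of _ _ _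

variable (k X) in
/-- The direct sum is the internal direct sum of its homogeneous pieces. -/
@[reducible]
def piecesDecomposition [DecidableEq ι] {e : ℕ → ι} (he : Function.Injective e) :
    DirectSum.Decomposition (pieces k X e) where
  decompose' := piecesDecompose k X e
  left_inv := fun x => by
    induction x using DirectSum.induction_on with
    | zero => simp
    | of i x => rw [piecesDecompose_of, DirectSum.coeAddMonoidHom_of]
    | add x y hx hy => rw [map_add, map_add, hx, hy]
  right_inv := fun x => by
    induction x using DirectSum.induction_on with
    | zero => simp
    | of n x =>
      rw [DirectSum.coeAddMonoidHom_of]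
      obtain ⟨x, hx⟩ := x
      suffices H : ∀ h : x ∈ pieces k X e n, piecesDecompose k X e x =
          DirectSum.of (fun n => pieces k X e n) n ⟨x, h⟩ from H hx
      refine pieces_induction (p := fun x => ∀ h : x ∈ pieces k X e n,
        piecesDecompose k X e x = DirectSum.of (fun n => pieces k X e n) n ⟨x, h⟩) he ?_ ?_ hx
      · intro h
        rw [map_zero]
        exact (map_zero (DirectSum.of (fun n => pieces k X e n) n)).symm
      · rintro i x rfl h
        exact piecesDecompose_of e i x
    | add x y hx hy => rw [map_add, map_add, hx, hy]

end Pieces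

/-! ## Yoneda algebras and Yoneda modules -/

section Yoneda

variable {A : Type u} [Ring A]

theorem ext_comp_mk_eq {X Y Z : ModuleCat.{u} A} {a b c c' : ℕ} (α : Ext X Y a) (β : Ext Y Z b)
    (h : a + b = c) (h' : a + b = c') :
    (⟨c, α.comp β h⟩ : Σ n, Ext X Z n) = ⟨c', α.comp β h'⟩ := by
  subst h
  subst h'
  rfl

/-- The Yoneda product on `Ext^*(X, X)`: the product `x * y` is the composition "first `y`,
then `x`", so that in degree `0` it is the composition `x ∘ y` of endomorphisms. -/
instance extGMul (X : ModuleCat.{u} A) : GradedMonoid.GMul (fun i : ℕ => Ext X X i) where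
  mul {i j} x y := y.comp x (add_comm j i)

/-- The unit of `Ext^*(X, X)` is the identity of `X`. -/
instance extGOne (X : ModuleCat.{u} A) : GradedMonoid.GOne (fun i : ℕ => Ext X X i) where
  one := Ext.mk₀ (𝟙 X)

/-- `Ext^*(X, X)` with the Yoneda product is a graded ring. -/
instance extGRing (X : ModuleCat.{u} A) : DirectSum.GRing (fun i : ℕ => Ext X X i) where
  mul_zero _ := Ext.zero_comp _ _ _ _ _
  zero_mul _ := Ext.comp_zero _ _ _ _ _
  mul_add _ _ _ := Ext.add_comp _ _ _ _
  add_mul _ _ _ := Ext.comp_add _ _ _ _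
  one_mul := fun ⟨n, x⟩ => by
    refine (ext_comp_mk_eq x (Ext.mk₀ (𝟙 X)) _ (add_zero n)).trans ?_
    rw [Ext.comp_mk₀_id]
  mul_one := fun ⟨n, x⟩ => by
    refine (ext_comp_mk_eq (Ext.mk₀ (𝟙 X)) x _ (zero_add n)).trans ?_
    rw [Ext.mk₀_id_comp]
  mul_assoc := fun ⟨a, x⟩ ⟨b, y⟩ ⟨c, z⟩ => by
    have h₁ : b + c + a = a + b + c := by omega
    have h₂ : c + b + a = a + b + c := by omega
    refine Eq.trans ?_ (ext_comp_mk_eq (z.comp y (add_comm c b)) x h₁ (add_comm (b + c) a))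
    exact congrArg (Sigma.mk (a + b + c))
      (Ext.comp_assoc z y x (add_comm c b) (add_comm b a) h₂).symm
  natCast n := n • Ext.mk₀ (𝟙 X)
  natCast_zero := zero_smul _ _
  natCast_succ n := succ_nsmul _ n
  intCast n := n • Ext.mk₀ (𝟙 X)
  intCast_ofNat n := by rw [natCast_zsmul]
  intCast_negSucc_ofNat n := by rw [negSucc_zsmul]

/-- The Yoneda action of `Ext^*(X, X)` on `Ext^*(M, X)`: the product `x • m` is the composition
"first `m`, then `x`". -/
instance extGmodule (X M : ModuleCat.{u} A) :
    DirectSum.Gmodule (fun i : ℕ => Ext X X i) (fun i : ℕ => Ext M X i) where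
  smul {i j} x m := m.comp x (add_comm j i)
  smul_zero _ := Ext.zero_comp _ _ _ _ _
  zero_smul _ := Ext.comp_zero _ _ _ _ _
  smul_add _ _ _ := Ext.add_comp _ _ _ _
  add_smul _ _ _ := Ext.comp_add _ _ _ _
  one_smul := fun ⟨n, x⟩ => by
    refine (ext_comp_mk_eq x (Ext.mk₀ (𝟙 X)) _ (add_zero n)).trans ?_
    rw [Ext.comp_mk₀_id]
  mul_smul := fun ⟨a, x⟩ ⟨b, y⟩ ⟨c, z⟩ => by
    have h₁ : b + c + a = a + b + c := by omega
    have h₂ : c + b + a = a + b + c := by omega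
    refine Eq.trans ?_ (ext_comp_mk_eq (z.comp y (add_comm c b)) x h₁ (add_comm (b + c) a))
    exact congrArg (Sigma.mk (a + b + c))
      (Ext.comp_assoc z y x (add_comm c b) (add_comm b a) h₂).symm

/-- The Yoneda algebra `Ext^*(X, X) = ⨁ i, Ext^i(X, X)`. -/
def YonedaAlg (X : ModuleCat.{u} A) : Type u := ⨁ i : ℕ, Ext X X i

/-- The left module `Ext^*(M, X) = ⨁ i, Ext^i(M, X)` over the Yoneda algebra of `X`. -/
def YonedaMod (X M : ModuleCat.{u} A) : Type u := ⨁ i : ℕ, Ext M X i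

instance (X : ModuleCat.{u} A) : Ring (YonedaAlg X) :=
  inferInstanceAs (Ring (⨁ i : ℕ, Ext X X i))

instance (X M : ModuleCat.{u} A) : AddCommGroup (YonedaMod X M) :=
  inferInstanceAs (AddCommGroup (⨁ i : ℕ, Ext M X i))

instance (X M : ModuleCat.{u} A) : Module (YonedaAlg X) (YonedaMod X M) :=
  inferInstanceAs (Module (⨁ i : ℕ, Ext X X i) (⨁ i : ℕ, Ext M X i))

/-- The inclusion of `Ext^i(X, X)` into the Yoneda algebra. -/
def YonedaAlg.of (X : ModuleCat.{u} A) (i : ℕ) : Ext X X i →+ YonedaAlg X :=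
  DirectSum.of (fun i : ℕ => Ext X X i) i

/-- The inclusion of `Ext^i(M, X)` into `Ext^*(M, X)`. -/
def YonedaMod.of (X M : ModuleCat.{u} A) (i : ℕ) : Ext M X i →+ YonedaMod X M :=
  DirectSum.of (fun i : ℕ => Ext M X i) i

theorem YonedaMod.of_smul_of (X M : ModuleCat.{u} A) {i j : ℕ} (x : Ext X X i) (m : Ext M X j) :
    YonedaAlg.of X i x • YonedaMod.of X M j m =
      YonedaMod.of X M (i + j) (m.comp x (add_comm j i)) :=
  DirectSum.Gmodule.of_smul_of (fun i : ℕ => Ext X X i) (fun i : ℕ => Ext M X i) x m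

theorem YonedaAlg.of_mul_of (X : ModuleCat.{u} A) {i j : ℕ} (x : Ext X X i) (y : Ext X X j) :
    YonedaAlg.of X i x * YonedaAlg.of X j y =
      YonedaAlg.of X (i + j) (y.comp x (add_comm j i)) :=
  DirectSum.of_mul_of (A := fun i : ℕ => Ext X X i) x y

variable {k : Type v} [Field k] [Algebra k A]

variable (k) in
instance extGAlgebra (X : ModuleCat.{u} A) : DirectSum.GAlgebra k (fun i : ℕ => Ext X X i) where
  toFun := AddMonoidHom.mk' (fun r : k => r • Ext.mk₀ (𝟙 X)) (fun r s => add_smul r s _)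
  map_one := one_smul _ _
  map_mul r s := by
    refine Eq.trans ?_ (ext_comp_mk_eq (s • Ext.mk₀ (𝟙 X)) (r • Ext.mk₀ (𝟙 X))
      (add_zero 0) (add_comm 0 0))
    refine congrArg (Sigma.mk 0) ?_
    rw [Ext.smul_comp, Ext.comp_smul, Ext.comp_mk₀_id, smul_smul, mul_comm]
    rfl
  commutes := fun r ⟨n, x⟩ => by
    refine (ext_comp_mk_eq x (r • Ext.mk₀ (𝟙 X)) _ (add_zero n)).trans
      (Eq.trans ?_ (ext_comp_mk_eq (r • Ext.mk₀ (𝟙 X)) x (zero_add n) _))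
    rw [Ext.comp_smul, Ext.smul_comp, Ext.comp_mk₀_id, Ext.mk₀_id_comp]
  smul_def := fun r ⟨n, x⟩ => by
    refine Eq.trans ?_ (ext_comp_mk_eq x (r • Ext.mk₀ (𝟙 X)) (add_zero n) _)
    rw [Ext.comp_smul, Ext.comp_mk₀_id]
    rfl

instance (X : ModuleCat.{u} A) : Algebra k (YonedaAlg X) :=
  inferInstanceAs (Algebra k (⨁ i : ℕ, Ext X X i))

instance (X M : ModuleCat.{u} A) : Module k (YonedaMod X M) :=
  inferInstanceAs (Module k (⨁ i : ℕ, Ext M X i))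

theorem YonedaAlg.smul_of (X : ModuleCat.{u} A) (c : k) {i : ℕ} (x : Ext X X i) :
    c • YonedaAlg.of X i x =
      YonedaAlg.of X i (c • x) :=
  (DirectSum.lof k ℕ (fun i : ℕ => Ext X X i) i).map_smul c x |>.symm

theorem YonedaMod.smul_of (X M : ModuleCat.{u} A) (c : k) {i : ℕ} (x : Ext M X i) :
    c • YonedaMod.of X M i x =
      YonedaMod.of X M i (c • x) :=
  (DirectSum.lof k ℕ (fun i : ℕ => Ext M X i) i).map_smul c x |>.symm

theorem YonedaAlg.induction {X : ModuleCat.{u} A} {p : YonedaAlg X → Prop} (x : YonedaAlg X)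
    (h0 : p 0)
    (h1 : ∀ (i : ℕ) (x : Ext X X i), p (YonedaAlg.of X i x))
    (h2 : ∀ x y, p x → p y → p (x + y)) : p x :=
  DirectSum.induction_on (motive := p) x h0 h1 h2

theorem YonedaMod.induction {X M : ModuleCat.{u} A} {p : YonedaMod X M → Prop}
    (x : YonedaMod X M) (h0 : p 0)
    (h1 : ∀ (i : ℕ) (x : Ext M X i), p (YonedaMod.of X M i x))
    (h2 : ∀ x y, p x → p y → p (x + y)) : p x :=
  DirectSum.induction_on (motive := p) x h0 h1 h2

instance (X M : ModuleCat.{u} A) : IsScalarTower k (YonedaAlg X) (YonedaMod X M) where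
  smul_assoc c x m := by
    induction x using YonedaAlg.induction with
    | h0 => rw [smul_zero, zero_smul, smul_zero]
    | h2 x y hx hy => rw [smul_add, add_smul, add_smul, smul_add, hx, hy]
    | h1 i x =>
      induction m using YonedaMod.induction with
      | h0 => rw [smul_zero, smul_zero, smul_zero]
      | h2 m n hm hn => rw [smul_add, smul_add, smul_add, hm, hn]
      | h1 j m =>
        rw [YonedaAlg.smul_of, YonedaMod.of_smul_of, YonedaMod.of_smul_of, YonedaMod.smul_of,
          Ext.comp_smul]

variable (k) in
/-- The grading of the Yoneda algebra: degree `n` is `Ext^n(X, X)`. -/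
def yonedaGr (X : ModuleCat.{u} A) (n : ℕ) : Submodule k (YonedaAlg X) :=
  pieces k (fun i : ℕ => Ext X X i) id n

variable (k) in
/-- The `ℤ`-grading of `Ext^*(M, X)`: degree `n` is `Ext^n(M, X)` for `n ≥ 0` and zero
otherwise. -/
def yonedaModGr (X M : ModuleCat.{u} A) (n : ℤ) : Submodule k (YonedaMod X M) :=
  pieces k (fun i : ℕ => Ext M X i) (fun i : ℕ => (i : ℤ)) n

instance yonedaGradedAlgebra (X : ModuleCat.{u} A) : GradedAlgebra (yonedaGr k X) where
  one_mem := of_mem_pieces (k := k) (X := fun i : ℕ => Ext X X i) id 0 (Ext.mk₀ (𝟙 X))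
  mul_mem := fun m n x y hx hy => by
    refine pieces_induction (p := fun x : YonedaAlg X => x * y ∈ yonedaGr k X (m + n))
      (fun _ _ h => h) ?_ ?_ hx
    · show (0 : YonedaAlg X) * y ∈ _
      rw [zero_mul]
      exact zero_mem _
    · rintro i x rfl
      refine pieces_induction (p := fun y : YonedaAlg X =>
        YonedaAlg.of X i x * y ∈ yonedaGr k X (i + n))
        (fun _ _ h => h) ?_ ?_ hy
      · show _ * (0 : YonedaAlg X) ∈ _
        rw [mul_zero]
        exact zero_mem _
      · rintro j y rfl
        change YonedaAlg.of X i x * YonedaAlg.of X j y ∈ _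
        rw [YonedaAlg.of_mul_of]
        exact of_mem_pieces (k := k) (X := fun i : ℕ => Ext X X i) id (i + j) _
  toDecomposition := piecesDecomposition k (fun i : ℕ => Ext X X i) (fun _ _ h => h)

theorem yonedaModGr_isInternal (X M : ModuleCat.{u} A) :
    DirectSum.IsInternal (yonedaModGr k X M) :=
  letI : DirectSum.Decomposition (yonedaModGr k X M) :=
    piecesDecomposition k (fun i : ℕ => Ext M X i) Nat.cast_injective
  DirectSum.Decomposition.isInternal _

theorem yonedaModGr_smul_mem (X M : ModuleCat.{u} A) {i : ℕ} {j : ℤ} {a : YonedaAlg X}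
    {m : YonedaMod X M} (ha : a ∈ yonedaGr k X i) (hm : m ∈ yonedaModGr k X M j) :
    a • m ∈ yonedaModGr k X M (i + j) := by
  refine pieces_induction (p := fun a : YonedaAlg X => a • m ∈ yonedaModGr k X M (i + j))
    (fun _ _ h => h) ?_ ?_ ha
  · show (0 : YonedaAlg X) • m ∈ _
    rw [zero_smul]
    exact zero_mem _
  · rintro i x rfl
    refine pieces_induction (p := fun m : YonedaMod X M =>
      YonedaAlg.of X i x • m ∈
        yonedaModGr k X M ((i : ℤ) + j)) Nat.cast_injective ?_ ?_ hm
    · show _ • (0 : YonedaMod X M) ∈ _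
      rw [smul_zero]
      exact zero_mem _
    · rintro j y rfl
      change YonedaAlg.of X i x • YonedaMod.of X M j y ∈ _
      rw [YonedaMod.of_smul_of, ← Nat.cast_add]
      exact of_mem_pieces (k := k) (X := fun i : ℕ => Ext M X i) (fun i : ℕ => (i : ℤ)) (i + j) _

/-- Auxiliary additive version of the following definition. -/
def yonedaModMapAdd (X : ModuleCat.{u} A) {M N : ModuleCat.{u} A} (f : M ⟶ N) :
    YonedaMod X N →+ YonedaMod X M :=
  DirectSum.map fun i : ℕ => Ext.precomp (Ext.mk₀ f) X (zero_add i)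

theorem yonedaModMapAdd_of (X : ModuleCat.{u} A) {M N : ModuleCat.{u} A} (f : M ⟶ N) (i : ℕ)
    (x : Ext N X i) : yonedaModMapAdd X f (YonedaMod.of X N i x) =
      YonedaMod.of X M i ((Ext.mk₀ f).comp x (zero_add i)) :=
  DirectSum.map_of _ _ _

/-- The map `Ext^*(N, X) → Ext^*(M, X)` induced by `f : M ⟶ N`, linear over the Yoneda algebra
of `X`. -/
def yonedaModMap (X : ModuleCat.{u} A) {M N : ModuleCat.{u} A} (f : M ⟶ N) :
    YonedaMod X N →ₗ[YonedaAlg X] YonedaMod X M where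
  toFun := yonedaModMapAdd X f
  map_add' := map_add _
  map_smul' a m := by
    rw [RingHom.id_apply]
    induction a using YonedaAlg.induction with
    | h0 => rw [zero_smul, zero_smul, map_zero]
    | h2 a b ha hb => rw [add_smul, add_smul, map_add, ha, hb]
    | h1 i a =>
      induction m using YonedaMod.induction with
      | h0 => rw [smul_zero, map_zero, smul_zero]
      | h2 m n hm hn => rw [smul_add, map_add, map_add, hm, hn, smul_add]
      | h1 j m =>
        rw [YonedaMod.of_smul_of, yonedaModMapAdd_of, yonedaModMapAdd_of, YonedaMod.of_smul_of,
          Ext.comp_assoc (Ext.mk₀ f) m a (zero_add j) (add_comm j i) (by omega)]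

theorem yonedaModMap_apply (X : ModuleCat.{u} A) {M N : ModuleCat.{u} A} (f : M ⟶ N)
    (x : YonedaMod X N) (i : ℕ) :
    (show ⨁ i : ℕ, Ext M X i from yonedaModMap X f x) i =
      (Ext.mk₀ f).comp ((show ⨁ i : ℕ, Ext N X i from x) i) (zero_add i) :=
  DirectSum.map_apply _ _ _

theorem yonedaModMap_mem (X : ModuleCat.{u} A) {M N : ModuleCat.{u} A} (f : M ⟶ N) (n : ℤ)
    (x : YonedaMod X N) (hx : x ∈ yonedaModGr k X N n) :
    yonedaModMap X f x ∈ yonedaModGr k X M n := fun i hi => by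
  refine (yonedaModMap_apply X f x i).trans ?_
  rw [show (show ⨁ i : ℕ, Ext N X i from x) i = 0 from hx i hi]
  exact Ext.comp_zero _ _ _ _ _

theorem yonedaModMap_id (X M : ModuleCat.{u} A) : yonedaModMap X (𝟙 M) = LinearMap.id :=
  LinearMap.ext fun x => DFinsupp.ext fun i =>
    (yonedaModMap_apply X (𝟙 M) x i).trans (Ext.mk₀_id_comp _)

theorem yonedaModMap_comp (X : ModuleCat.{u} A) {L M N : ModuleCat.{u} A} (f : L ⟶ M)
    (g : M ⟶ N) : yonedaModMap X (f ≫ g) = yonedaModMap X f ∘ₗ yonedaModMap X g := by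
  refine LinearMap.ext fun x => DFinsupp.ext fun i => ?_
  refine (yonedaModMap_apply X (f ≫ g) x i).trans ?_
  refine Eq.symm ((yonedaModMap_apply X f (yonedaModMap X g x) i).trans ?_)
  refine (congrArg (fun y => Ext.comp _ y (zero_add i)) (yonedaModMap_apply X g x i)).trans ?_
  exact Ext.mk₀_comp_mk₀_assoc _ _ _

end Yoneda

/-! ## Graded modules -/

section Graded

variable {k : Type v} [Field k] {A : Type u} [Ring A] [Algebra k A]

/-- A `ℤ`-graded left module over the algebra `A = ⨁ i, 𝒜 i`. The `k`-structure is the one coming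
from `k → A`. -/
structure GrMod (𝒜 : ℕ → Submodule k A) : Type (max v (u + 1)) where
  /-- the underlying type -/
  carrier : Type u
  [addCommGroup : AddCommGroup carrier]
  [moduleBase : Module k carrier]
  [module : Module A carrier]
  [isScalarTower : IsScalarTower k A carrier]
  /-- the homogeneous components -/
  gr : ℤ → Submodule k carrier
  isInternal : DirectSum.IsInternal gr
  smul_mem : ∀ {i : ℕ} {j : ℤ} {a : A} {m : carrier}, a ∈ 𝒜 i → m ∈ gr j → a • m ∈ gr (i + j)

namespace GrMod

attribute [instance] addCommGroup moduleBase module isScalarTower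

variable {𝒜 : ℕ → Submodule k A}

/-- Homomorphisms of graded modules: `A`-linear maps preserving degrees. -/
@[ext]
structure Hom (M N : GrMod 𝒜) : Type u where
  /-- the underlying linear map -/
  lin : M.carrier →ₗ[A] N.carrier
  map_mem : ∀ (i : ℤ) (m : M.carrier), m ∈ M.gr i → lin m ∈ N.gr i

instance : Category (GrMod 𝒜) where
  Hom := Hom
  id M := ⟨LinearMap.id, fun _ _ h => h⟩
  comp f g := ⟨g.lin ∘ₗ f.lin, fun i m h => g.map_mem i _ (f.map_mem i m h)⟩

/-- The underlying ungraded module. -/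
abbrev toModuleCat (M : GrMod 𝒜) : ModuleCat.{u} A := ModuleCat.of A M.carrier

/-- `M` is generated in degree `s`: `M = A · M_s`. -/
def GeneratedIn (M : GrMod 𝒜) (s : ℤ) : Prop :=
  Submodule.span A (M.gr s : Set M.carrier) = ⊤

/-- `M` is locally finite: every homogeneous component is finite-dimensional. -/
def LocallyFinite (M : GrMod 𝒜) : Prop :=
  ∀ i, Module.Finite k (M.gr i)

/-- A Koszul module: a locally finite graded module generated in degree `0` that has a graded
projective resolution `⋯ → P 1 → P 0 → M → 0` with `P i` generated in degree `i` for all `i`. -/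
structure IsKoszul (M : GrMod 𝒜) : Prop where
  locallyFinite : M.LocallyFinite
  generatedIn : M.GeneratedIn 0
  resolution : ∃ (P : ℕ → GrMod 𝒜) (d : ∀ i, P (i + 1) ⟶ P i) (ε : P 0 ⟶ M),
    (∀ i, (P i).LocallyFinite) ∧
    (∀ i, Module.Projective A (P i).carrier) ∧
    (∀ i : ℕ, (P i).GeneratedIn i) ∧
    Function.Surjective (Hom.lin ε) ∧
    Function.Exact (Hom.lin (d 0)) (Hom.lin ε) ∧
    ∀ i, Function.Exact (Hom.lin (d (i + 1))) (Hom.lin (d i))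

/-- Restriction of graded modules along a homomorphism of graded algebras. -/
def restrict {B : Type u} [Ring B] [Algebra k B] {ℬ : ℕ → Submodule k B} (φ : A →ₐ[k] B)
    (hφ : ∀ i a, a ∈ 𝒜 i → φ a ∈ ℬ i) : GrMod ℬ ⥤ GrMod 𝒜 where
  obj M :=
    letI : Module A M.carrier := Module.compHom M.carrier φ.toRingHom
    { carrier := M.carrier
      isScalarTower := ⟨fun c a m => by
        show φ (c • a) • m = c • (φ a • m)
        rw [map_smul, smul_assoc]⟩
      gr := M.gr
      isInternal := M.isInternal
      smul_mem := fun ha hm => M.smul_mem (hφ _ _ ha) hm }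
  map {M N} f :=
    letI : Module A M.carrier := Module.compHom M.carrier φ.toRingHom
    letI : Module A N.carrier := Module.compHom N.carrier φ.toRingHom
    { lin :=
        { toFun := Hom.lin f
          map_add' := map_add _
          map_smul' := fun a m => map_smul (Hom.lin f) (φ a) m }
      map_mem := Hom.map_mem f }

end GrMod

/-- The graded module `Ext^*(M, X)` over the Yoneda algebra of `X`. -/
def yonedaObj {𝒜 : ℕ → Submodule k A} (X : ModuleCat.{u} A) (M : GrMod 𝒜) :
    GrMod (yonedaGr k X) where
  carrier := YonedaMod X M.toModuleCat
  gr := yonedaModGr k X M.toModuleCat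
  isInternal := yonedaModGr_isInternal X M.toModuleCat
  smul_mem := fun ha hm => yonedaModGr_smul_mem X M.toModuleCat ha hm

/-- The contravariant functor `Ext^*(-, X)` from graded modules to graded modules over the Yoneda
algebra of `X`. -/
def yonedaFunctor (𝒜 : ℕ → Submodule k A) (X : ModuleCat.{u} A) :
    (GrMod 𝒜)ᵒᵖ ⥤ GrMod (yonedaGr k X) where
  obj M := yonedaObj X M.unop
  map {M N} f :=
    (⟨yonedaModMap X (M := N.unop.toModuleCat) (N := M.unop.toModuleCat)
        (ModuleCat.ofHom (GrMod.Hom.lin f.unop)),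
      yonedaModMap_mem (k := k) X _⟩ : GrMod.Hom (yonedaObj X M.unop) (yonedaObj X N.unop))
  map_id M := GrMod.Hom.ext (yonedaModMap_id X M.unop.toModuleCat)
  map_comp f g := GrMod.Hom.ext (yonedaModMap_comp X (ModuleCat.ofHom (GrMod.Hom.lin g.unop))
    (ModuleCat.ofHom (GrMod.Hom.lin f.unop)))

/-- The property of being Koszul, on the category of graded modules and degree-preserving
homomorphisms. -/
def koszul (𝒜 : ℕ → Submodule k A) : ObjectProperty (GrMod 𝒜) := fun M => M.IsKoszul

/-- The category of Koszul modules, a full subcategory of the category of graded modules. -/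
abbrev KoszulMod (𝒜 : ℕ → Submodule k A) := (koszul 𝒜).FullSubcategory

/-- A ring is self-injective when every projective module over it is injective. -/
def IsSelfInjective (R : Type u) [Ring R] : Prop :=
  ∀ (P : Type u) [AddCommGroup P] [Module R P], Module.Projective R P → Module.Injective R P

variable (𝒜 : ℕ → Submodule k A) [GradedAlgebra 𝒜]

/-- The action of `A` on `A_0` through the projection `A → A_0`, i.e. `A_0` identified with the
quotient of `A` by the ideal of elements of positive degree. -/
@[reducible]
def zeroModule : Module A (𝒜 0) :=
  Module.compHom (𝒜 0) (GradedRing.projZeroRingHom' 𝒜)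

/-- `A_0` as a graded `A`-module concentrated in degree `0`. -/
def degreeZero : GrMod 𝒜 :=
  letI : Module A (𝒜 0) := zeroModule 𝒜
  { carrier := 𝒜 0
    isScalarTower := ⟨fun c a m => by
      refine Subtype.ext ?_
      show ((DirectSum.decompose 𝒜 (c • a) 0 : 𝒜 0) : A) * (m : A) =
        c • (((DirectSum.decompose 𝒜 a 0 : 𝒜 0) : A) * (m : A))
      rw [DirectSum.decompose_smul, DirectSum.smul_apply, Submodule.coe_smul, smul_mul_assoc]⟩
    gr := fun n => if n = 0 then ⊤ else ⊥
    isInternal := by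
      rw [DirectSum.isInternal_submodule_iff_iSupIndep_and_iSup_eq_top]
      constructor
      · intro i
        by_cases hi : i = 0
        · subst hi
          refine Disjoint.mono_right (iSup₂_le fun j hj => ?_) disjoint_bot_right
          exact le_of_eq (if_neg hj)
        · exact Disjoint.mono_left (le_of_eq (if_neg hi)) disjoint_bot_left
      · refine top_unique (le_trans ?_ (le_iSup _ (0 : ℤ)))
        rw [if_pos rfl]
    smul_mem := fun {i j a m} ha hm => by
      by_cases hj : j = 0
      · subst hj
        by_cases hi : i = 0
        · subst hi
          simp
        · have : a • m = 0 := by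
            refine Subtype.ext ?_
            show ((DirectSum.decompose 𝒜 a 0 : 𝒜 0) : A) * (m : A) = 0
            rw [DirectSum.decompose_of_mem_ne 𝒜 ha hi, zero_mul]
          rw [this]
          exact zero_mem _
      · rw [if_neg hj, Submodule.mem_bot] at hm
        rw [hm, smul_zero]
        exact zero_mem _ }

/-- The Ext algebra `Γ = Ext^*_A(A_0, A_0)` with the Yoneda product. -/
abbrev ExtAlg : Type u := YonedaAlg (degreeZero 𝒜).toModuleCat

/-- The grading of `Γ`, with `Γ_i = Ext^i_A(A_0, A_0)`. -/
abbrev extGr : ℕ → Submodule k (ExtAlg 𝒜) := yonedaGr k (degreeZero 𝒜).toModuleCat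

/-- The contravariant functor `E = Ext^*_A(-, A_0)` from graded `A`-modules to graded
`Γ`-modules. -/
def extDual : (GrMod 𝒜)ᵒᵖ ⥤ GrMod (extGr 𝒜) :=
  yonedaFunctor 𝒜 (degreeZero 𝒜).toModuleCat

/-- The functor `E` between the categories of Koszul modules, once it is known to preserve Koszul
modules. -/
def koszulDual (h : ∀ M : GrMod 𝒜, M.IsKoszul → ((extDual 𝒜).obj (op M)).IsKoszul) :
    (KoszulMod 𝒜)ᵒᵖ ⥤ KoszulMod (extGr 𝒜) :=
  (koszul (extGr 𝒜)).lift ((koszul 𝒜).ι.op ⋙ extDual 𝒜) fun M => h M.unop.obj M.unop.property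

end Graded

end GrKoszul

end

open GrKoszul

/-! Write `rad N` for `A_{≥1} N` and `E` for `Ext^*_A(-, A_0)`. For a Koszul module `M` the radical
is `M_{≥1}`, and the kernel of a cover `P → M` lies in `rad P`, because it is generated in degree 1.
All Koszulity proofs are coinductive: a class of locally finite modules generated in degree 0 and
closed under some choice of syzygies consists of Koszul modules (`isKoszul_of_forall_syzygy`).

The pivot is that `M_{≥1}`, shifted, is again Koszul (`IsKoszul.radShift`). If `Ω` is the kernel of
`P → M`, then `0 → Ω → P_{≥1} → M_{≥1} → 0` is exact. The module `P_{≥1}` is Koszul after the shift,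
since `P` is a summand of some `A^r` and `A_{≥1}` is the first syzygy of `A_0`. It remains to see
that the cokernel of a degree-preserving injection `K → L` of Koszul modules is Koszul
(`IsKoszul.of_shortExact`). Here self-injectivity is used: `K / rad K` is a summand of some `A_0^n`,
so `K / rad K → L / rad L` splits, the map of covers splits too, and the syzygies form a sequence of
the same kind.

A map of positive degree between Koszul modules induces zero on `Ext^*(-, A_0)`
(`mk₀_comp_eq_zero_of_isDeg`). Applied to `rad M → M`, this breaks the long exact sequence into `0 →
E(rad M) → E(M / rad M) → E(M) → 0`, whose first map raises degrees by one. Since `E(A_0) = Γ`, the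
middle term is projective over `Γ` and generated in degree 0. The argument repeats with `rad M`, so
`E(M)` is Koszul (`IsLin.isKoszul_yonedaGrMod`).

The same sequences compute the double dual. An element `x` of `N` gives a map `A → N`, hence `E(N) →
E(A)`, and this identifies `N / rad N` with `Hom_Γ(E(N), E(A))`. Dimension shifting along the
sequences for `N, rad N, rad (rad N), …` identifies the `i`-th layer of the radical filtration with
`Ext^i_Γ(E(N), E(A))` (`biduality_eq_zero_iff`, `biduality_surjective`). For Koszul `M` this layer
is `M_i`, and `E(A) ≅ Γ_0`. The Yoneda action corresponds to the module action (`biduality_smul`),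
so `M = A` yields the isomorphism of algebras and general `M` the isomorphism of modules.

Finally `Γ` satisfies the same hypotheses (`IsSelfInjectiveKoszul.extGr`): `Γ_0 ≅ E(A)` is Koszul,
and `Γ_0 ≅ A_0^op` is self-injective because self-injectivity of a finite-dimensional algebra is
left-right symmetric (`injective_mulOpposite`). With double dual isomorphisms for both `A` and `Γ`,
the equivalence of categories is formal. -/

noncomputable section

namespace GrKoszul

namespace GrMod

/-! ### Homogeneous components of elements and of linear maps. -/

section Projections

variable {k : Type v} [Field k] {A : Type u} [Ring A] [Algebra k A] {𝒜 : ℕ → Submodule k A}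

/-- The decomposition of a graded module into its homogeneous components. -/
def dec (M : GrMod 𝒜) : M.carrier ≃ₗ[k] ⨁ n, M.gr n :=
  (LinearEquiv.ofBijective (DirectSum.coeLinearMap M.gr) M.isInternal).symm

/-- The projection of a graded module to its component of degree `n`. -/
def proj (M : GrMod 𝒜) (n : ℤ) : M.carrier →ₗ[k] M.carrier :=
  (M.gr n).subtype ∘ₗ DirectSum.component k ℤ (fun n => M.gr n) n ∘ₗ M.dec.toLinearMap

theorem dec_of_mem (M : GrMod 𝒜) {n : ℤ} {m : M.carrier} (hm : m ∈ M.gr n) :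
    M.dec m = DirectSum.lof k ℤ (fun n => M.gr n) n ⟨m, hm⟩ := by
  rw [dec, LinearEquiv.symm_apply_eq]
  exact (DirectSum.coeLinearMap_lof M.gr n ⟨m, hm⟩).symm

theorem proj_mem (M : GrMod 𝒜) (n : ℤ) (m : M.carrier) : M.proj n m ∈ M.gr n :=
  Subtype.property _

theorem proj_of_mem (M : GrMod 𝒜) {n : ℤ} {m : M.carrier} (hm : m ∈ M.gr n) :
    M.proj n m = m := by
  simp [proj, M.dec_of_mem hm, DirectSum.component.lof_self]

theorem proj_of_mem_ne (M : GrMod 𝒜) {n l : ℤ} {m : M.carrier} (hm : m ∈ M.gr n) (h : n ≠ l) :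
    M.proj l m = 0 := by
  simp only [proj, LinearMap.comp_apply, LinearEquiv.coe_coe, M.dec_of_mem hm,
    Submodule.subtype_apply, ZeroMemClass.coe_eq_zero]
  exact DirectSum.of_eq_of_ne _ _ _ (Ne.symm h)

@[elab_as_elim]
theorem homogeneous_induction (M : GrMod 𝒜) {p : M.carrier → Prop} (m : M.carrier) (h0 : p 0)
    (h1 : ∀ n, ∀ m ∈ M.gr n, p m) (h2 : ∀ x y, p x → p y → p (x + y)) : p m := by
  rw [← M.dec.symm_apply_apply m]
  induction M.dec m using DirectSum.induction_on with
  | zero => rwa [map_zero]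
  | of n x =>
    refine h1 n _ ?_
    rw [show M.dec.symm (DirectSum.of _ n x) = (x : M.carrier) from
      DirectSum.coeLinearMap_lof M.gr n x]
    exact x.2
  | add x y hx hy => rw [map_add]; exact h2 _ _ hx hy

theorem ext_proj (M : GrMod 𝒜) {x y : M.carrier} (h : ∀ n, M.proj n x = M.proj n y) : x = y := by
  apply M.dec.injective
  refine DFinsupp.ext fun n => Subtype.ext (h n)

theorem mem_gr_iff (M : GrMod 𝒜) {n : ℤ} {m : M.carrier} : m ∈ M.gr n ↔ M.proj n m = m :=
  ⟨M.proj_of_mem, fun h => h ▸ M.proj_mem n m⟩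

theorem proj_proj (M : GrMod 𝒜) (n l : ℤ) (m : M.carrier) :
    M.proj l (M.proj n m) = if n = l then M.proj n m else 0 := by
  split_ifs with h
  · subst h; exact M.proj_of_mem (M.proj_mem _ _)
  · exact M.proj_of_mem_ne (M.proj_mem _ _) h

theorem eq_zero_of_mem_ne (M : GrMod 𝒜) {n l : ℤ} {m : M.carrier} (hm : m ∈ M.gr n)
    (hm' : m ∈ M.gr l) (h : n ≠ l) : m = 0 := by
  rw [← M.proj_of_mem hm', M.proj_of_mem_ne hm h]

theorem mem_iSup_gr (M : GrMod 𝒜) (m : M.carrier) (p : AddSubmonoid M.carrier)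
    (h : ∀ n, M.proj n m ∈ p) : m ∈ p := by
  classical
  have : m = ∑ n ∈ (M.dec m).support, (M.dec m n : M.carrier) := by
    conv_lhs => rw [← M.dec.symm_apply_apply m, ← DirectSum.sum_support_of (M.dec m), map_sum]
    exact Finset.sum_congr rfl fun n _ => DirectSum.coeLinearMap_lof M.gr n _
  rw [this]
  exact sum_mem fun n _ => h n

/-- A criterion for a family of submodules to be an internal direct sum, in terms of
projections. -/
theorem isInternal_of_proj {X : Type*} [AddCommGroup X] [Module k X] (gr : ℤ → Submodule k X)
    (π : ℤ → X →ₗ[k] X) (h1 : ∀ n, ∀ x ∈ gr n, π n x = x)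
    (h2 : ∀ n l, n ≠ l → ∀ x ∈ gr n, π l x = 0) (h3 : ∀ x, x ∈ ⨆ n, gr n) :
    DirectSum.IsInternal gr := by
  rw [DirectSum.isInternal_submodule_iff_iSupIndep_and_iSup_eq_top]
  refine ⟨fun n => ?_, top_unique fun x _ => h3 x⟩
  rw [Submodule.disjoint_def]
  intro x hx hx'
  rw [← h1 n x hx]
  have : ⨆ j, ⨆ (_ : j ≠ n), gr j ≤ LinearMap.ker (π n) :=
    iSup₂_le fun j hj y hy => h2 j n hj y hy
  exact this hx'

theorem proj_smul (M : GrMod 𝒜) {i : ℕ} {a : A} (ha : a ∈ 𝒜 i) {n l : ℤ} (h : i + n = l)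
    (m : M.carrier) : M.proj l (a • m) = a • M.proj n m := by
  subst h
  induction m using M.homogeneous_induction with
  | h0 => simp
  | h2 x y hx hy => rw [smul_add, map_add, map_add, hx, hy, smul_add]
  | h1 j m hm =>
    by_cases hj : j = n
    · subst hj
      rw [M.proj_of_mem (M.smul_mem ha hm), M.proj_of_mem hm]
    · rw [M.proj_of_mem_ne hm hj, smul_zero, M.proj_of_mem_ne (M.smul_mem ha hm) (by omega)]

/-- A linear map between graded modules which raises degrees by `s`. -/
def IsDeg (M N : GrMod 𝒜) (s : ℤ) (f : M.carrier →ₗ[A] N.carrier) : Prop :=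
  ∀ n l, n + s = l → ∀ m ∈ M.gr n, f m ∈ N.gr l

theorem IsDeg.proj_apply {M N : GrMod 𝒜} {s : ℤ} {f : M.carrier →ₗ[A] N.carrier}
    (hf : IsDeg M N s f) {n l : ℤ} (h : n + s = l) (m : M.carrier) :
    N.proj l (f m) = f (M.proj n m) := by
  induction m using M.homogeneous_induction with
  | h0 => simp
  | h2 x y hx hy => rw [map_add, map_add, map_add, map_add, hx, hy]
  | h1 j m hm =>
    by_cases hj : j = n
    · subst hj
      rw [M.proj_of_mem hm, N.proj_of_mem (hf _ _ h _ hm)]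
    · rw [M.proj_of_mem_ne hm hj, map_zero, N.proj_of_mem_ne (hf _ _ rfl _ hm) (by omega)]

theorem IsDeg.comp {M N L : GrMod 𝒜} {s t r : ℤ} {g : N.carrier →ₗ[A] L.carrier}
    {f : M.carrier →ₗ[A] N.carrier} (hg : IsDeg N L t g) (hf : IsDeg M N s f) (h : s + t = r) :
    IsDeg M L r (g ∘ₗ f) :=
  fun n l e m hm => hg (n + s) l (by omega) _ (hf n _ rfl m hm)

/-- The component of degree `s` of a linear map, as a linear map over `k`. -/
def degPartAux (M N : GrMod 𝒜) (s : ℤ) (f : M.carrier →ₗ[A] N.carrier) :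
    M.carrier →ₗ[k] N.carrier :=
  DirectSum.toModule k ℤ N.carrier
    (fun n => N.proj (n + s) ∘ₗ f.restrictScalars k ∘ₗ (M.gr n).subtype) ∘ₗ M.dec.toLinearMap

theorem degPartAux_apply (M N : GrMod 𝒜) (s : ℤ) (f : M.carrier →ₗ[A] N.carrier) {n : ℤ}
    {m : M.carrier} (hm : m ∈ M.gr n) : degPartAux M N s f m = N.proj (n + s) (f m) := by
  simp [degPartAux, M.dec_of_mem hm, DirectSum.toModule_lof]

theorem ext_homogeneous {M : GrMod 𝒜} {Y : Type*} [AddCommGroup Y] [Module A Y]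
    {f g : M.carrier →ₗ[A] Y} (h : ∀ n, ∀ m ∈ M.gr n, f m = g m) : f = g := by
  ext m
  induction m using M.homogeneous_induction with
  | h0 => simp
  | h2 x y hx hy => rw [map_add, map_add, hx, hy]
  | h1 j m hm => exact h j m hm

variable [GradedAlgebra 𝒜]

/-- The component of degree `s` of a linear map between graded modules. -/
def degPart (M N : GrMod 𝒜) (s : ℤ) (f : M.carrier →ₗ[A] N.carrier) :
    M.carrier →ₗ[A] N.carrier where
  toFun := degPartAux M N s f
  map_add' := map_add _
  map_smul' a m := by
    rw [RingHom.id_apply]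
    induction a using DirectSum.Decomposition.inductionOn 𝒜 with
    | zero => simp
    | add a b ha hb => rw [add_smul, map_add, add_smul, ha, hb]
    | @homogeneous i a =>
      obtain ⟨a, ha⟩ := a
      change degPartAux M N s f (a • m) = a • _
      induction m using M.homogeneous_induction with
      | h0 => simp
      | h2 x y hx hy => rw [smul_add, map_add, map_add, hx, hy, smul_add]
      | h1 j m hm =>
        rw [degPartAux_apply M N s f hm, degPartAux_apply M N s f (M.smul_mem ha hm), map_smul,
          N.proj_smul ha (n := j + s) (by omega)]

theorem degPart_apply (M N : GrMod 𝒜) (s : ℤ) (f : M.carrier →ₗ[A] N.carrier) {n l : ℤ}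
    {m : M.carrier} (hm : m ∈ M.gr n) (h : n + s = l) :
    degPart M N s f m = N.proj l (f m) := by
  subst h; exact degPartAux_apply M N s f hm

theorem isDeg_degPart (M N : GrMod 𝒜) (s : ℤ) (f : M.carrier →ₗ[A] N.carrier) :
    IsDeg M N s (degPart M N s f) := fun n l h m hm => by
  rw [degPart_apply M N s f hm h]
  exact N.proj_mem _ _

/-- Lifting a homogeneous map from a projective module along a surjective homogeneous map. -/
theorem exists_lift {P M N : GrMod 𝒜} [Module.Projective A P.carrier] {s t r : ℤ}
    {f : M.carrier →ₗ[A] N.carrier} (hf : IsDeg M N s f) (hs : Function.Surjective f)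
    {g : P.carrier →ₗ[A] N.carrier} (hg : IsDeg P N t g) (h : r + s = t) :
    ∃ l : P.carrier →ₗ[A] M.carrier, IsDeg P M r l ∧ f ∘ₗ l = g := by
  -- An ungraded lift exists by projectivity; since `f` and `g` are homogeneous, its component of
  -- degree `r` is still a lift.
  obtain ⟨l, hl⟩ := Module.projective_lifting_property f g hs
  refine ⟨degPart P M r l, isDeg_degPart _ _ _ _, ext_homogeneous fun n m hm => ?_⟩
  rw [LinearMap.comp_apply, degPart_apply _ _ _ _ hm rfl,
    ← hf.proj_apply (l := n + t) (by omega), ← LinearMap.comp_apply, hl,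
    N.proj_of_mem (hg _ _ rfl m hm)]

end Projections

/-! ### Shifts, homogeneous submodules and finite powers. -/

section Constructions

variable {k : Type v} [Field k] {A : Type u} [Ring A] [Algebra k A] {𝒜 : ℕ → Submodule k A}

/-- The shift of a graded module: `(M.shift s)_n = M_{n+s}`. -/
@[reducible]
def shift (M : GrMod 𝒜) (s : ℤ) : GrMod 𝒜 where
  carrier := M.carrier
  gr n := M.gr (n + s)
  isInternal := by
    refine isInternal_of_proj _ (fun n => M.proj (n + s)) (fun n x hx => M.proj_of_mem hx)
      (fun n l h x hx => M.proj_of_mem_ne hx (by omega)) fun x => ?_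
    refine M.mem_iSup_gr x (⨆ n, M.gr (n + s)).toAddSubmonoid fun n => ?_
    refine Submodule.mem_iSup_of_mem (n - s) ?_
    rw [sub_add_cancel]
    exact M.proj_mem n x
  smul_mem {i j a m} ha hm := by
    rw [add_assoc]; exact M.smul_mem ha hm

/-- A homogeneous submodule. -/
def IsHomog (M : GrMod 𝒜) (U : Submodule A M.carrier) : Prop :=
  ∀ n, ∀ m ∈ U, M.proj n m ∈ U

/-- A homogeneous submodule as a graded module. -/
@[reducible]
def sub (M : GrMod 𝒜) (U : Submodule A M.carrier) (hU : M.IsHomog U) : GrMod 𝒜 where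
  carrier := U
  gr n := (M.gr n).comap (U.subtype.restrictScalars k)
  isInternal := by
    let π : ℤ → U →ₗ[k] U := fun n =>
      (M.proj n ∘ₗ U.subtype.restrictScalars k).codRestrict (U.restrictScalars k)
        fun m => hU n m m.2
    refine isInternal_of_proj _ π (fun n x hx => Subtype.ext (M.proj_of_mem hx))
      (fun n l h x hx => Subtype.ext (M.proj_of_mem_ne hx h)) fun x => ?_
    obtain ⟨x, hx⟩ := x
    have := M.mem_iSup_gr x
      ((⨆ n, (M.gr n).comap (U.subtype.restrictScalars k)).map
        (U.subtype.restrictScalars k)).toAddSubmonoid fun n => by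
        refine ⟨⟨M.proj n x, hU n x hx⟩, Submodule.mem_iSup_of_mem n ?_, rfl⟩
        exact M.proj_mem n x
    obtain ⟨y, hy, hyx⟩ := this
    rwa [show (⟨x, hx⟩ : U) = y from Subtype.ext hyx.symm]
  smul_mem ha hm := M.smul_mem ha hm

/-- A finite power of a graded module. -/
@[reducible]
def pow (M : GrMod 𝒜) (r : ℕ) : GrMod 𝒜 where
  carrier := Fin r → M.carrier
  gr n := Submodule.pi Set.univ fun _ => M.gr n
  isInternal := by
    refine isInternal_of_proj _ (fun n => LinearMap.pi fun j => M.proj n ∘ₗ LinearMap.proj j)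
      (fun n x hx => funext fun j => M.proj_of_mem (hx j trivial))
      (fun n l h x hx => funext fun j => M.proj_of_mem_ne (hx j trivial) h) fun x => ?_
    classical
    rw [← Finset.univ_sum_single x]
    refine sum_mem fun j _ => ?_
    refine M.mem_iSup_gr (x j)
      ((⨆ n, Submodule.pi Set.univ fun _ => M.gr n).comap
        (LinearMap.single k (fun _ : Fin r => M.carrier) j)).toAddSubmonoid fun n => ?_
    refine Submodule.mem_iSup_of_mem n fun l _ => ?_
    by_cases h : l = j
    · subst h
      simpa using M.proj_mem n (x l)
    · simp [h]
  smul_mem ha hm := fun j h => M.smul_mem ha (hm j h)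

end Constructions

end GrMod

/-! ### The radical, defined without reference to a grading on the module. -/

/-- The submodule `A_{≥ 1} N` of an (ungraded) module. -/
def rad {k : Type v} [Field k] {A : Type u} [Ring A] [Algebra k A] (𝒜 : ℕ → Submodule k A)
    (N : Type*) [AddCommGroup N] [Module A N] : Submodule A N :=
  Submodule.span A {y | ∃ i, 0 < i ∧ ∃ a ∈ 𝒜 i, ∃ n : N, a • n = y}

section Rad

variable {k : Type v} [Field k] {A : Type u} [Ring A] [Algebra k A] {𝒜 : ℕ → Submodule k A}
  {N N' : Type*} [AddCommGroup N] [Module A N] [AddCommGroup N'] [Module A N']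

theorem smul_mem_rad {i : ℕ} (hi : 0 < i) {a : A} (ha : a ∈ 𝒜 i) (n : N) : a • n ∈ rad 𝒜 N :=
  Submodule.subset_span ⟨i, hi, a, ha, n, rfl⟩

theorem rad_le {U : Submodule A N} (h : ∀ i, 0 < i → ∀ a ∈ 𝒜 i, ∀ n, a • n ∈ U) :
    rad 𝒜 N ≤ U := by
  refine Submodule.span_le.2 ?_
  rintro _ ⟨i, hi, a, ha, n, rfl⟩
  exact h i hi a ha n

theorem map_mem_rad (f : N →ₗ[A] N') {x : N} (hx : x ∈ rad 𝒜 N) : f x ∈ rad 𝒜 N' := by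
  refine (rad_le (U := (rad 𝒜 N').comap f) fun i hi a ha n => ?_) hx
  rw [Submodule.mem_comap, map_smul]
  exact smul_mem_rad hi ha _

theorem exists_mem_rad_of_surjective {f : N →ₗ[A] N'} (hf : Function.Surjective f) {y : N'}
    (hy : y ∈ rad 𝒜 N') : ∃ x ∈ rad 𝒜 N, f x = y := by
  refine (rad_le (U := (rad 𝒜 N).map f) fun i hi a ha n => ?_) hy
  obtain ⟨m, rfl⟩ := hf n
  exact ⟨a • m, smul_mem_rad hi ha _, map_smul _ _ _⟩

end Rad

namespace GrMod

/-! ### Generation in one degree, local finiteness, and the radical as the part of positive degree.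
-/

section Basic

variable {k : Type v} [Field k] {A : Type u} [Ring A] [Algebra k A] {𝒜 : ℕ → Submodule k A}

theorem GeneratedIn.ext {M : GrMod 𝒜} {s : ℤ} (hM : M.GeneratedIn s) {Y : Type*} [AddCommGroup Y]
    [Module A Y] {f g : M.carrier →ₗ[A] Y} (h : ∀ m ∈ M.gr s, f m = g m) : f = g :=
  LinearMap.ext_on hM h

theorem GeneratedIn.surjective {M N : GrMod 𝒜} {s : ℤ} (hN : N.GeneratedIn s)
    {f : M.carrier →ₗ[A] N.carrier} (h : ∀ n ∈ N.gr s, ∃ m, f m = n) :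
    Function.Surjective f := by
  rw [← LinearMap.range_eq_top]
  exact top_unique (hN ▸ Submodule.span_le.2 h)

theorem GeneratedIn.of_surjective {M N : GrMod 𝒜} {s t r : ℤ} (hM : M.GeneratedIn s)
    {f : M.carrier →ₗ[A] N.carrier} (hf : IsDeg M N t f) (hs : Function.Surjective f)
    (h : s + t = r) : N.GeneratedIn r := by
  refine top_unique ?_
  rw [← LinearMap.range_eq_top.2 hs, ← Submodule.map_top, ← hM, Submodule.map_span_le]
  exact fun m hm => Submodule.subset_span (hf _ _ h m hm)

theorem GeneratedIn.shift {M : GrMod 𝒜} {s t r : ℤ} (hM : M.GeneratedIn s) (h : r + t = s) :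
    (M.shift t).GeneratedIn r := by
  subst h; exact hM

theorem LocallyFinite.shift {M : GrMod 𝒜} (hM : M.LocallyFinite) (s : ℤ) :
    (M.shift s).LocallyFinite := fun n => hM (n + s)

theorem LocallyFinite.of_injective {M N : GrMod 𝒜} (hN : N.LocallyFinite) {s : ℤ}
    {f : M.carrier →ₗ[A] N.carrier} (hf : IsDeg M N s f) (hi : Function.Injective f) :
    M.LocallyFinite := fun n => by
  have := hN (n + s)
  exact Module.Finite.of_injective
    ((f.restrictScalars k).restrict (p := M.gr n) (q := N.gr (n + s)) (hf n _ rfl))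
    fun x y h => Subtype.ext (hi (congrArg Subtype.val h))

theorem IsDeg.exists_preimage {M N : GrMod 𝒜} {s : ℤ} {f : M.carrier →ₗ[A] N.carrier}
    (hf : IsDeg M N s f) (hs : Function.Surjective f) {n l : ℤ} (h : n + s = l) {y : N.carrier}
    (hy : y ∈ N.gr l) : ∃ x ∈ M.gr n, f x = y := by
  obtain ⟨x, rfl⟩ := hs y
  exact ⟨M.proj n x, M.proj_mem _ _, by rw [← hf.proj_apply h, N.proj_of_mem hy]⟩

theorem LocallyFinite.of_surjective {M N : GrMod 𝒜} (hM : M.LocallyFinite) {s : ℤ}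
    {f : M.carrier →ₗ[A] N.carrier} (hf : IsDeg M N s f) (hs : Function.Surjective f) :
    N.LocallyFinite := fun n => by
  have := hM (n - s)
  refine Module.Finite.of_surjective
    ((f.restrictScalars k).restrict (p := M.gr (n - s)) (q := N.gr n) (hf _ _ (by omega)))
    fun y => ?_
  obtain ⟨x, hx, hxy⟩ := hf.exists_preimage hs (n := n - s) (by omega) y.2
  exact ⟨⟨x, hx⟩, Subtype.ext hxy⟩

theorem IsDeg.of_comp {M N L : GrMod 𝒜} {s t r : ℤ} {g : N.carrier →ₗ[A] L.carrier}
    {f : M.carrier →ₗ[A] N.carrier} (hg : IsDeg N L t g) (hi : Function.Injective g)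
    (h : IsDeg M L r (g ∘ₗ f)) (e : s + t = r) : IsDeg M N s f := fun n l hl m hm => by
  have h1 := h n (n + r) rfl m hm
  rw [N.mem_gr_iff]
  apply hi
  rw [← hg.proj_apply (l := n + r) (by omega)]
  exact L.proj_of_mem h1

theorem IsDeg.isHomog_ker {M N : GrMod 𝒜} {s : ℤ} {f : M.carrier →ₗ[A] N.carrier}
    (hf : IsDeg M N s f) : M.IsHomog (LinearMap.ker f) := fun n m hm => by
  rw [LinearMap.mem_ker] at hm ⊢
  rw [← hf.proj_apply rfl, hm, map_zero]

theorem IsDeg.isHomog_range {M N : GrMod 𝒜} {s : ℤ} {f : M.carrier →ₗ[A] N.carrier}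
    (hf : IsDeg M N s f) : N.IsHomog (LinearMap.range f) := by
  rintro n _ ⟨m, rfl⟩
  exact ⟨M.proj (n - s) m, (hf.proj_apply (by omega) m).symm⟩

theorem isDeg_subtype (M : GrMod 𝒜) (U : Submodule A M.carrier) (hU : M.IsHomog U) (s : ℤ) :
    IsDeg ((M.sub U hU).shift s) M s U.subtype := fun _ _ h _ hm => h ▸ hm

theorem isDeg_id (M : GrMod 𝒜) : IsDeg M M 0 LinearMap.id := fun _ _ h _ hm => by
  rwa [← h, add_zero]

theorem IsDeg.sub {M N : GrMod 𝒜} {s : ℤ} {f g : M.carrier →ₗ[A] N.carrier}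
    (hf : IsDeg M N s f) (hg : IsDeg M N s g) : IsDeg M N s (f - g) :=
  fun n l h m hm => sub_mem (hf n l h m hm) (hg n l h m hm)

variable [GradedAlgebra 𝒜]

/-- The submodule of elements of degrees `≥ s`. -/
def ge (M : GrMod 𝒜) (s : ℤ) : Submodule A M.carrier where
  carrier := {m | ∀ n < s, M.proj n m = 0}
  zero_mem' n _ := map_zero _
  add_mem' hx hy n hn := by rw [map_add, hx n hn, hy n hn, add_zero]
  smul_mem' a m hm n hn := by
    induction a using DirectSum.Decomposition.inductionOn 𝒜 with
    | zero => simp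
    | add a b ha hb => rw [add_smul, map_add, ha, hb, add_zero]
    | @homogeneous i a =>
      rw [M.proj_smul a.2 (n := n - i) (by omega), hm _ (by omega), smul_zero]

theorem mem_ge_of_mem (M : GrMod 𝒜) {s n : ℤ} (h : s ≤ n) {m : M.carrier} (hm : m ∈ M.gr n) :
    m ∈ M.ge s := fun l hl => M.proj_of_mem_ne hm (by omega)

theorem isHomog_ge (M : GrMod 𝒜) (s : ℤ) : M.IsHomog (M.ge s) := fun n m hm l hl => by
  rw [M.proj_proj]
  split_ifs with h
  · exact hm n (by omega)
  · rfl

theorem GeneratedIn.ge_eq_top {M : GrMod 𝒜} {s : ℤ} (hM : M.GeneratedIn s) : M.ge s = ⊤ :=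
  top_unique (hM ▸ Submodule.span_le.2 fun _ hm => M.mem_ge_of_mem le_rfl hm)

theorem GeneratedIn.eq_zero_of_lt {M : GrMod 𝒜} {s n : ℤ} (hM : M.GeneratedIn s) (h : n < s)
    {m : M.carrier} (hm : m ∈ M.gr n) : m = 0 := by
  have : m ∈ M.ge s := hM.ge_eq_top ▸ trivial
  rw [← M.proj_of_mem hm, this n h]

theorem rad_le_ge {M : GrMod 𝒜} (hM : M.GeneratedIn 0) : rad 𝒜 M.carrier ≤ M.ge 1 := by
  refine rad_le fun i hi a ha m n hn => ?_
  have hm : m ∈ M.ge 0 := hM.ge_eq_top ▸ trivial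
  rw [M.proj_smul ha (n := n - i) (by omega), hm _ (by omega), smul_zero]

/-- In a combination of elements of `M_0`, the coefficients of degree 0 preserve `M_0` and the
homogeneous ones of positive degree contribute to the radical. -/
theorem exists_gr_zero_add_rad {M : GrMod 𝒜} (hM : M.GeneratedIn 0) (m : M.carrier) :
    ∃ m₀ ∈ M.gr 0, ∃ r ∈ rad 𝒜 M.carrier, m = m₀ + r := by
  have : m ∈ Submodule.span A (M.gr 0 : Set M.carrier) := hM ▸ trivial
  induction this using Submodule.span_induction with
  | mem x hx => exact ⟨x, hx, 0, zero_mem _, (add_zero x).symm⟩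
  | zero => exact ⟨0, zero_mem _, 0, zero_mem _, (add_zero 0).symm⟩
  | add x y _ _ hx hy =>
    obtain ⟨x₀, hx₀, x₁, hx₁, rfl⟩ := hx
    obtain ⟨y₀, hy₀, y₁, hy₁, rfl⟩ := hy
    exact ⟨x₀ + y₀, add_mem hx₀ hy₀, x₁ + y₁, add_mem hx₁ hy₁, add_add_add_comm _ _ _ _⟩
  | smul a x _ hx =>
    obtain ⟨x₀, hx₀, x₁, hx₁, rfl⟩ := hx
    induction a using DirectSum.Decomposition.inductionOn 𝒜 with
    | zero => exact ⟨0, zero_mem _, 0, zero_mem _, by simp⟩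
    | add a b ha hb =>
      obtain ⟨y₀, hy₀, y₁, hy₁, e⟩ := ha
      obtain ⟨z₀, hz₀, z₁, hz₁, e'⟩ := hb
      exact ⟨y₀ + z₀, add_mem hy₀ hz₀, y₁ + z₁, add_mem hy₁ hz₁, by
        rw [add_smul, e, e', add_add_add_comm]⟩
    | @homogeneous i a =>
      obtain rfl | hi := Nat.eq_zero_or_pos i
      · refine ⟨(a : A) • x₀, ?_, (a : A) • x₁, Submodule.smul_mem _ _ hx₁, smul_add _ _ _⟩
        simpa using M.smul_mem a.2 hx₀
      · exact ⟨0, zero_mem _, _, smul_mem_rad hi a.2 _, (zero_add _).symm⟩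

/-- The ungraded radical can thus be read off the grading: in `m = m₀ + r` the term `m₀` is the
component of degree 0, which vanishes when `m` has only positive degrees. -/
theorem rad_eq_ge {M : GrMod 𝒜} (hM : M.GeneratedIn 0) : rad 𝒜 M.carrier = M.ge 1 := by
  refine le_antisymm (rad_le_ge hM) fun m hm => ?_
  obtain ⟨m₀, h₀, r, hr, rfl⟩ := exists_gr_zero_add_rad hM m
  have h1 := hm 0 zero_lt_one
  rw [map_add, rad_le_ge hM hr 0 zero_lt_one, add_zero, M.proj_of_mem h₀] at h1
  rwa [h1, zero_add]

theorem mem_rad_iff {M : GrMod 𝒜} (hM : M.GeneratedIn 0) {m : M.carrier} :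
    m ∈ rad 𝒜 M.carrier ↔ M.proj 0 m = 0 := by
  rw [rad_eq_ge hM]
  refine ⟨fun h => h 0 zero_lt_one, fun h n hn => ?_⟩
  obtain hn | rfl := (show n ≤ 0 by omega).lt_or_eq
  · exact hM.eq_zero_of_lt hn (M.proj_mem _ _)
  · exact h

theorem isHomog_rad {M : GrMod 𝒜} (hM : M.GeneratedIn 0) : M.IsHomog (rad 𝒜 M.carrier) := by
  rw [rad_eq_ge hM]; exact M.isHomog_ge 1

/-- A homogeneous map of degree zero between modules generated in degree zero, with projective
target, is bijective if it is so in degree zero. -/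
theorem bijective_of_gr_zero {P Q : GrMod 𝒜} [Module.Projective A Q.carrier]
    (hP : P.GeneratedIn 0) (hQ : Q.GeneratedIn 0) {f : P.carrier →ₗ[A] Q.carrier}
    (hf : IsDeg P Q 0 f) (hi : ∀ x ∈ P.gr 0, f x = 0 → x = 0)
    (hs : ∀ y ∈ Q.gr 0, ∃ x ∈ P.gr 0, f x = y) : Function.Bijective f := by
  have hsurj : Function.Surjective f :=
    hQ.surjective fun y hy => (hs y hy).imp fun _ h => h.2
  refine ⟨?_, hsurj⟩
  -- Projectivity of `Q` splits `f` by a homogeneous `g`. Injectivity of `f` in degree 0 forces `g ∘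
  -- f = id` there, hence everywhere by generation.
  obtain ⟨g, hg, hfg⟩ := exists_lift hf hsurj (isDeg_id Q) (r := 0) rfl
  have : g ∘ₗ f = LinearMap.id := by
    refine hP.ext fun x hx => ?_
    have h0 : g (f x) ∈ P.gr 0 := hg 0 0 rfl _ (hf 0 0 rfl x hx)
    refine sub_eq_zero.1 (hi _ (sub_mem h0 hx) ?_)
    rw [map_sub, sub_eq_zero]
    exact LinearMap.congr_fun hfg (f x)
  exact Function.LeftInverse.injective (LinearMap.congr_fun this)

end Basic

/-! ### Koszul modules through covers and syzygies. -/

section Koszul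

variable {k : Type v} [Field k] {A : Type u} [Ring A] [Algebra k A] {𝒜 : ℕ → Submodule k A}

/-- A homogeneous surjection of degree zero from a locally finite projective graded module
generated in degree zero. -/
structure IsCover (P M : GrMod 𝒜) (ε : P.carrier →ₗ[A] M.carrier) : Prop where
  locallyFinite : P.LocallyFinite
  projective : Module.Projective A P.carrier
  generatedIn : P.GeneratedIn 0
  isDeg : IsDeg P M 0 ε
  surjective : Function.Surjective ε

/-- `N` is, up to a shift, the kernel of a cover of `M`. -/
def IsSyzygy (M N : GrMod 𝒜) : Prop :=
  ∃ (P : GrMod 𝒜) (ε : P.carrier →ₗ[A] M.carrier) (ι : N.carrier →ₗ[A] P.carrier),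
    IsCover P M ε ∧ IsDeg N P 1 ι ∧ Function.Injective ι ∧ Function.Exact ι ε

/-- Coinduction principle for Koszul modules. -/
theorem isKoszul_of_forall_syzygy (C : GrMod 𝒜 → Prop)
    (hlf : ∀ M, C M → M.LocallyFinite) (hgen : ∀ M, C M → M.GeneratedIn 0)
    (hsyz : ∀ M, C M → ∃ N, C N ∧ IsSyzygy M N) {M : GrMod 𝒜} (hM : C M) : M.IsKoszul := by
  choose N hN hs using hsyz
  choose P ε ι hc hd hi he using hs
  -- `S i` is the `i`-th iterated syzygy, each regraded to start in degree 0. Shifting its cover by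
  -- `-i` undoes the regradings, and the differentials are cover followed by inclusion.
  let S : ℕ → {M // C M} := fun i => Nat.rec ⟨M, hM⟩ (fun _ T => ⟨N T.1 T.2, hN T.1 T.2⟩) i
  refine ⟨hlf M hM, hgen M hM, fun i => (P (S i).1 (S i).2).shift (-i),
    fun i => ⟨ι (S i).1 (S i).2 ∘ₗ ε (S (i + 1)).1 (S (i + 1)).2, fun n m hm => ?_⟩,
    ⟨ε M hM, fun n m hm => ?_⟩, fun i => (hc _ _).locallyFinite.shift _,
    fun i => (hc (S i).1 (S i).2).projective, fun i => (hc _ _).generatedIn.shift (by omega),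
    (hc M hM).surjective, ?_, fun i => ?_⟩
  · refine hd (S i).1 (S i).2 (n + -(i + 1 : ℕ)) _ (by push_cast; omega) _ ?_
    exact (hc (S (i + 1)).1 (S (i + 1)).2).isDeg _ _ (add_zero _) m hm
  · refine (hc M hM).isDeg _ _ ?_ m hm
    simp
  · exact (hc (S 1).1 (S 1).2).surjective.comp_exact_iff_exact.2 (he M hM)
  · change Function.Exact (ι (S (i + 1)).1 (S (i + 1)).2 ∘ ε (S (i + 2)).1 (S (i + 2)).2)
      (ι (S i).1 (S i).2 ∘ ε (S (i + 1)).1 (S (i + 1)).2)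
    intro x
    rw [(hc (S (i + 2)).1 (S (i + 2)).2).surjective.range_comp]
    exact ((hi (S i).1 (S i).2).eq_iff' (LinearMap.map_zero _)).trans
      (he (S (i + 1)).1 (S (i + 1)).2 x)

/-- The destructor matching the coinduction principle: deleting `P 0` and shifting the remaining
resolution by one resolves the kernel of `P 0 → M` linearly. -/
theorem IsKoszul.exists_cover {M : GrMod 𝒜} (hM : M.IsKoszul) :
    ∃ (P : GrMod 𝒜) (ε : P.carrier →ₗ[A] M.carrier) (h : IsCover P M ε),
      ((P.sub (LinearMap.ker ε) h.isDeg.isHomog_ker).shift 1).IsKoszul := by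
  obtain ⟨P, d, ε, hlf, hproj, hgen, hs, he, hd⟩ := hM.resolution
  have hdeg : IsDeg (P 0) M 0 (Hom.lin ε) := fun n l h m hm => by
    rw [← h, add_zero]; exact Hom.map_mem ε n m hm
  have hc : IsCover (P 0) M (Hom.lin ε) := ⟨hlf 0, hproj 0, hgen 0, hdeg, hs⟩
  refine ⟨P 0, Hom.lin ε, hc, ?_⟩
  let δ : (P 1).carrier →ₗ[A] LinearMap.ker (Hom.lin ε) :=
    (Hom.lin (d 0)).codRestrict _ fun x => he.apply_apply_eq_zero x
  have hδ : Function.Surjective δ := fun y => by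
    obtain ⟨x, hx⟩ := (he y.1).1 y.2
    exact ⟨x, Subtype.ext hx⟩
  have hdδ : IsDeg ((P 1).shift 1) (((P 0).sub _ hdeg.isHomog_ker).shift 1) 0 δ :=
    fun n l h m hm => by
      obtain rfl : n = l := by omega
      exact Hom.map_mem (d 0) _ m hm
  have hg : ((P 1).shift 1).GeneratedIn 0 := (hgen 1).shift (by simp)
  refine ⟨(hlf 0).of_injective (isDeg_subtype _ _ _ 1) Subtype.val_injective,
    hg.of_surjective hdδ hδ (add_zero 0), fun i => (P (i + 1)).shift 1,
    fun i => ⟨(Hom.lin (d (i + 1)) : (P (i + 2)).carrier →ₗ[A] (P (i + 1)).carrier),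
      fun n m hm => Hom.map_mem (d (i + 1)) _ m hm⟩,
    ⟨δ, fun n m hm => Hom.map_mem (d 0) _ m hm⟩, fun i => (hlf _).shift _, fun i => hproj _,
    fun i => (hgen (i + 1)).shift (by push_cast; rfl), hδ, fun x => ?_, fun i => hd (i + 1)⟩
  exact Iff.trans Subtype.ext_iff (hd 0 x)

theorem IsKoszul.of_isDeg_bijective {M N : GrMod 𝒜} (hM : M.IsKoszul)
    {f : M.carrier →ₗ[A] N.carrier} (hf : IsDeg M N 0 f) (hb : Function.Bijective f) :
    N.IsKoszul := by
  obtain ⟨P, d, ε, hlf, hproj, hgen, hs, he, hd⟩ := hM.resolution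
  refine ⟨hM.locallyFinite.of_surjective hf hb.2,
    hM.generatedIn.of_surjective hf hb.2 (add_zero 0), P, d,
    ⟨f ∘ₗ Hom.lin ε, fun n m hm => hf _ _ (add_zero n) _ (Hom.map_mem ε n m hm)⟩, hlf, hproj, hgen,
    hb.2.comp hs, fun x => ?_, hd⟩
  exact Iff.trans (hb.1.eq_iff' (map_zero f)) (he x)

theorem IsCover.isSyzygy {P M : GrMod 𝒜} {ε : P.carrier →ₗ[A] M.carrier}
    (h : IsCover P M ε) :
    IsSyzygy M ((P.sub (LinearMap.ker ε) h.isDeg.isHomog_ker).shift 1) :=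
  ⟨P, ε, (LinearMap.ker ε).subtype, h, isDeg_subtype _ _ _ 1, Subtype.val_injective,
    fun x => ⟨fun hx => ⟨⟨x, hx⟩, rfl⟩, fun ⟨y, hy⟩ => hy ▸ y.2⟩⟩

end Koszul

end GrMod

theorem exists_factor {A : Type*} [Ring A] {X Y Z : Type*} [AddCommGroup X] [Module A X]
    [AddCommGroup Y] [Module A Y] [AddCommGroup Z] [Module A Z] {f : X →ₗ[A] Y}
    (hf : Function.Surjective f) (g : X →ₗ[A] Z) (h : ∀ x, f x = 0 → g x = 0) :
    ∃ l : Y →ₗ[A] Z, ∀ x, l (f x) = g x := by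
  refine ⟨(LinearMap.ker f).liftQ g h ∘ₗ (f.quotKerEquivOfSurjective hf).symm.toLinearMap,
    fun x => ?_⟩
  have : (f.quotKerEquivOfSurjective hf).symm (f x) = Submodule.Quotient.mk x := by
    rw [LinearEquiv.symm_apply_eq]; rfl
  rw [LinearMap.comp_apply, LinearEquiv.coe_coe, this]
  exact Submodule.liftQ_apply _ _ _

/-- `Y` is a direct summand of a finite power of `X`. -/
def IsRetractOfPow (A : Type*) [Ring A] (X Y : Type*) [AddCommGroup X] [Module A X]
    [AddCommGroup Y] [Module A Y] : Prop :=
  ∃ (r : ℕ) (p : Fin r → Y →ₗ[A] X) (q : Fin r → X →ₗ[A] Y), ∀ y, ∑ j, q j (p j y) = y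

/-! ### The modules `A` and `A_0`, and extension of maps into `A_0`. -/

section Augmentation

variable {k : Type v} [Field k] {A : Type u} [Ring A] [Algebra k A] (𝒜 : ℕ → Submodule k A)
  [GradedAlgebra 𝒜]

theorem degreeZero_smul_def (a : A) (x : (degreeZero 𝒜).carrier) :
    (a • x : (degreeZero 𝒜).carrier) =
      (GradedRing.projZeroRingHom' 𝒜 a * (show 𝒜 0 from x) : 𝒜 0) := rfl

theorem degreeZero_smul_of_pos {i : ℕ} (hi : 0 < i) {a : A} (ha : a ∈ 𝒜 i)
    (x : (degreeZero 𝒜).carrier) : a • x = 0 := by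
  rw [degreeZero_smul_def]
  have : GradedRing.projZeroRingHom' 𝒜 a = 0 :=
    Subtype.ext (DirectSum.decompose_of_mem_ne 𝒜 ha hi.ne')
  rw [this, zero_mul]; rfl

theorem map_rad_degreeZero {N : Type*} [AddCommGroup N] [Module A N]
    (f : N →ₗ[A] (degreeZero 𝒜).carrier) {x : N} (hx : x ∈ rad 𝒜 N) : f x = 0 := by
  refine (rad_le (U := LinearMap.ker f) fun i hi a ha n => ?_) hx
  rw [LinearMap.mem_ker, map_smul, degreeZero_smul_of_pos 𝒜 hi ha]

/-- `A` as a graded module over itself. -/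
def regular : GrMod 𝒜 where
  carrier := A
  gr n := if 0 ≤ n then 𝒜 n.toNat else ⊥
  isInternal := by
    refine GrMod.isInternal_of_proj _
      (fun n => if 0 ≤ n then GradedAlgebra.proj 𝒜 n.toNat else 0) (fun n x hx => ?_)
      (fun n l h x hx => ?_) fun x => ?_
    · split_ifs at hx ⊢ with h
      · exact DirectSum.decompose_of_mem_same 𝒜 hx
      · rw [(Submodule.mem_bot k).1 hx]; rfl
    · split_ifs at hx ⊢ with h1 h2 h2
      · exact DirectSum.decompose_of_mem_ne 𝒜 hx (by omega)
      · rw [(Submodule.mem_bot k).1 hx, map_zero]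
      · rfl
      · rfl
    · induction x using DirectSum.Decomposition.inductionOn 𝒜 with
      | zero => exact zero_mem _
      | add a b ha hb => exact add_mem ha hb
      | @homogeneous i a =>
        refine Submodule.mem_iSup_of_mem (i : ℤ) ?_
        simp
  smul_mem {i j a m} ha hm := by
    by_cases hj : 0 ≤ j
    · rw [if_pos hj] at hm
      rw [if_pos (by omega), show ((i : ℤ) + j).toNat = i + j.toNat by omega]
      exact SetLike.mul_mem_graded ha hm
    · rw [if_neg hj, Submodule.mem_bot] at hm
      rw [hm, smul_zero]
      exact zero_mem _

theorem mem_regular_gr {n : ℕ} {l : ℤ} (h : (n : ℤ) = l) {a : A} :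
    a ∈ (regular 𝒜).gr l ↔ a ∈ 𝒜 n := by
  subst h
  change a ∈ (if 0 ≤ (n : ℤ) then 𝒜 (n : ℤ).toNat else ⊥) ↔ _
  rw [if_pos (by omega), Int.toNat_natCast]

theorem regular_proj_zero (a : (regular 𝒜).carrier) :
    (regular 𝒜).proj 0 a = GradedRing.proj 𝒜 0 (show A from a) := by
  change A at a
  induction a using DirectSum.Decomposition.inductionOn 𝒜 with
  | zero => rw [map_zero]; exact map_zero _
  | add a b ha hb => rw [map_add, ← ha, ← hb]; exact map_add _ _ _
  | @homogeneous i a =>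
    rw [GradedRing.proj_apply]
    have h := (mem_regular_gr 𝒜 (n := i) rfl).2 a.2
    obtain rfl | hi := eq_or_ne i 0
    · rw [DirectSum.decompose_of_mem_same 𝒜 a.2]
      exact (regular 𝒜).proj_of_mem h
    · rw [DirectSum.decompose_of_mem_ne 𝒜 a.2 hi]
      exact (regular 𝒜).proj_of_mem_ne h (by omega)

theorem regular_generatedIn : (regular 𝒜).GeneratedIn 0 := by
  refine top_unique fun (a : A) _ => ?_
  suffices h : (1 : A) ∈ (regular 𝒜).gr 0 by
    have := Submodule.smul_mem (Submodule.span A ((regular 𝒜).gr 0 : Set (regular 𝒜).carrier)) a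
      (Submodule.subset_span h)
    exact (congrArg (· ∈ Submodule.span A ((regular 𝒜).gr 0 : Set (regular 𝒜).carrier))
      (mul_one a)).mp this
  exact (mem_regular_gr 𝒜 (n := 0) rfl).2 (SetLike.one_mem_graded 𝒜)

/-- The unit of `A`, as an element of the graded module `A`. -/
def regularOne : (regular 𝒜).carrier := (1 : A)

theorem smul_regularOne (a : A) : a • regularOne 𝒜 = (show (regular 𝒜).carrier from a) :=
  mul_one a

/-- The map `A → N` sending `1` to `n`. -/
def ofElement {N : Type*} [AddCommGroup N] [Module A N] (n : N) : (regular 𝒜).carrier →ₗ[A] N :=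
  LinearMap.toSpanSingleton A N n

theorem ofElement_one {N : Type*} [AddCommGroup N] [Module A N] (n : N) :
    ofElement 𝒜 n (regularOne 𝒜) = n := one_smul A n

theorem regular_hom_ext {N : Type*} [AddCommGroup N] [Module A N]
    {f g : (regular 𝒜).carrier →ₗ[A] N} (h : f (regularOne 𝒜) = g (regularOne 𝒜)) : f = g := by
  refine LinearMap.ext fun a => ?_
  have key : ∀ c : A, f (c • regularOne 𝒜) = g (c • regularOne 𝒜) := fun c => by
    rw [map_smul, map_smul, h]
  have e := smul_regularOne 𝒜 a
  exact (congrArg f e).symm.trans ((key a).trans (congrArg g e))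

instance regular_projective : Module.Projective A (regular 𝒜).carrier :=
  inferInstanceAs (Module.Projective A A)

/-- The projection `A → A_0`. -/
def augmentation : (regular 𝒜).carrier →ₗ[A] (degreeZero 𝒜).carrier where
  toFun a := (GradedRing.projZeroRingHom' 𝒜 a : 𝒜 0)
  map_add' a b := map_add (GradedRing.projZeroRingHom' 𝒜) a b
  map_smul' a b := map_mul (GradedRing.projZeroRingHom' 𝒜) a b

theorem augmentation_surjective : Function.Surjective (augmentation 𝒜) :=
  GradedRing.projZeroRingHom'_surjective 𝒜

theorem augmentation_eq_zero_iff (a : (regular 𝒜).carrier) :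
    augmentation 𝒜 a = 0 ↔ a ∈ rad 𝒜 (regular 𝒜).carrier := by
  refine Iff.trans ?_ (GrMod.mem_rad_iff (M := regular 𝒜) (regular_generatedIn 𝒜)).symm
  rw [regular_proj_zero]
  exact (ZeroMemClass.coe_eq_zero (x := (show 𝒜 0 from augmentation 𝒜 a))).symm

/-- Extension of maps to `A_0` between modules annihilated by the elements of positive degree. -/
theorem exists_extension_degreeZero (hinj : Module.Injective (𝒜 0) (𝒜 0)) {X Y : Type u}
    [AddCommGroup X] [Module A X] [AddCommGroup Y] [Module A Y] (hY : rad 𝒜 Y = ⊥)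
    {f : X →ₗ[A] Y} (hf : Function.Injective f) (g : X →ₗ[A] (degreeZero 𝒜).carrier) :
    ∃ h : Y →ₗ[A] (degreeZero 𝒜).carrier, ∀ x, h (f x) = g x := by
  -- Restricting scalars to `A_0` makes injectivity available. The extension found is automatically
  -- `A`-linear, since positive degrees act by zero on `Y` and on `A_0`.
  let ι : 𝒜 0 →+* A := (SetLike.GradeZero.subring 𝒜).subtype
  let _ : Module (𝒜 0) X := Module.compHom X ι
  let _ : Module (𝒜 0) Y := Module.compHom Y ι
  have hι : ∀ c : 𝒜 0, GradedRing.projZeroRingHom' 𝒜 (c : A) = c :=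
    fun c => GradedRing.projZeroRingHom'_apply_coe 𝒜 c
  let f' : X →ₗ[𝒜 0] Y :=
    { toFun := f, map_add' := map_add f, map_smul' := fun c x => map_smul f (c : A) x }
  let g' : X →ₗ[𝒜 0] 𝒜 0 :=
    { toFun := g
      map_add' := map_add g
      map_smul' := fun c x => (map_smul g (c : A) x).trans <| by
        rw [degreeZero_smul_def, hι]; rfl }
  obtain ⟨h, hh⟩ := hinj.out f' hf g'
  refine ⟨⟨⟨h, map_add h⟩, fun a y => ?_⟩, hh⟩
  change h (a • y) = GradedRing.projZeroRingHom' 𝒜 a * h y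
  induction a using DirectSum.Decomposition.inductionOn 𝒜 with
  | zero => simp
  | add a b ha hb => rw [add_smul, map_add, map_add, add_mul, ha, hb]
  | @homogeneous i a =>
    obtain rfl | hi := Nat.eq_zero_or_pos i
    · rw [hι]
      exact map_smul h a y
    · have h1 : (a : A) • y = 0 := by
        rw [← Submodule.mem_bot A, ← hY]; exact smul_mem_rad hi a.2 y
      have h2 : GradedRing.projZeroRingHom' 𝒜 (a : A) = 0 :=
        Subtype.ext (DirectSum.decompose_of_mem_ne 𝒜 a.2 hi.ne')
      rw [h1, h2, map_zero, zero_mul]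

end Augmentation

section QuotientRad

variable {k : Type v} [Field k] {A : Type u} [Ring A] [Algebra k A] {𝒜 : ℕ → Submodule k A}

theorem rad_quotient_rad (N : Type*) [AddCommGroup N] [Module A N] :
    rad 𝒜 (N ⧸ rad 𝒜 N) = ⊥ := by
  refine eq_bot_iff.2 (rad_le fun i hi a ha n => ?_)
  obtain ⟨n, rfl⟩ := Submodule.Quotient.mk_surjective _ n
  rw [← Submodule.Quotient.mk_smul, Submodule.mem_bot, Submodule.Quotient.mk_eq_zero]
  exact smul_mem_rad hi ha n

end QuotientRad

namespace GrMod

/-! ### Powers and summands of Koszul modules, and the shape of `M / rad M`. -/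

section Closure

variable {k : Type v} [Field k] {A : Type u} [Ring A] [Algebra k A] {𝒜 : ℕ → Submodule k A}

theorem LocallyFinite.pow {M : GrMod 𝒜} (hM : M.LocallyFinite) (r : ℕ) :
    (M.pow r).LocallyFinite := fun n => by
  have := hM n
  let f : (M.pow r).gr n →ₗ[k] Fin r → M.gr n :=
    LinearMap.pi fun j => ((LinearMap.proj j ∘ₗ ((M.pow r).gr n).subtype).codRestrict (M.gr n)
      fun x => x.2 j trivial)
  exact Module.Finite.of_injective f fun x y h => Subtype.ext <| funext fun j =>
    congrArg Subtype.val (congrFun h j)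

theorem GeneratedIn.pow {M : GrMod 𝒜} {s : ℤ} (hM : M.GeneratedIn s) (r : ℕ) :
    (M.pow r).GeneratedIn s := by
  classical
  refine top_unique fun (x : Fin r → M.carrier) _ => ?_
  have key : ∀ j, (⊤ : Submodule A M.carrier) ≤
      (Submodule.span A ((M.pow r).gr s : Set (M.pow r).carrier)).comap
        (LinearMap.single A (fun _ : Fin r => M.carrier) j) := fun j => by
    rw [← hM, Submodule.span_le]
    refine fun m hm => Submodule.subset_span fun l _ => ?_
    by_cases h : l = j
    · subst h; simpa using hm
    · simp [h]
  rw [← Finset.univ_sum_single x]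
  exact sum_mem fun j _ => key j (Submodule.mem_top (x := x j))

theorem IsCover.pow {P M : GrMod 𝒜} {ε : P.carrier →ₗ[A] M.carrier} (h : IsCover P M ε) (r : ℕ) :
    IsCover (P.pow r) (M.pow r) (ε.compLeft (Fin r)) := by
  have := h.projective
  refine ⟨h.locallyFinite.pow r, ?_, h.generatedIn.pow r,
    fun n l hl m hm j hj => h.isDeg n l hl _ (hm j hj), h.surjective.comp_left⟩
  exact Module.Projective.of_equiv (DirectSum.linearEquivFunOnFintype A (Fin r)
    (fun _ => P.carrier))

/-- A finite power of a Koszul module is Koszul. -/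
theorem IsKoszul.pow {M : GrMod 𝒜} (hM : M.IsKoszul) (r : ℕ) : (M.pow r).IsKoszul := by
  refine isKoszul_of_forall_syzygy (fun X => ∃ Z : GrMod 𝒜, Z.IsKoszul ∧ X = Z.pow r)
    ?_ ?_ ?_ ⟨M, hM, rfl⟩
  · rintro _ ⟨Z, hZ, rfl⟩
    exact hZ.locallyFinite.pow r
  · rintro _ ⟨Z, hZ, rfl⟩
    exact hZ.generatedIn.pow r
  · rintro _ ⟨Z, hZ, rfl⟩
    obtain ⟨P, ε, hc, hN⟩ := hZ.exists_cover
    refine ⟨_, ⟨_, hN, rfl⟩, P.pow r, ε.compLeft (Fin r),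
      (LinearMap.ker ε).subtype.compLeft (Fin r), hc.pow r,
      fun n l hl m hm j hj => isDeg_subtype _ _ hc.isDeg.isHomog_ker 1 n l hl _ (hm j hj),
      Subtype.val_injective.comp_left, fun x => ⟨fun hx => ?_, ?_⟩⟩
    · exact ⟨fun j => ⟨x j, congrFun hx j⟩, rfl⟩
    · rintro ⟨y, rfl⟩
      exact funext fun j => (y j).2

variable [GradedAlgebra 𝒜]

/-- The kernel of a cover, shifted so that it may be generated in degree zero. -/
abbrev syzygy {P M : GrMod 𝒜} {ε : P.carrier →ₗ[A] M.carrier} (h : IsCover P M ε) : GrMod 𝒜 :=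
  (P.sub (LinearMap.ker ε) h.isDeg.isHomog_ker).shift 1

/-- Minimality of the cover: the syzygy, in its shifted grading, has nothing below degree 0, whereas
a kernel element in degree 0 of `P` would sit there in degree `-1`. -/
theorem IsCover.eq_zero_of_mem_gr_zero {P M : GrMod 𝒜} {ε : P.carrier →ₗ[A] M.carrier}
    (h : IsCover P M ε) (hN : (syzygy h).IsKoszul) {x : P.carrier} (hx : x ∈ P.gr 0)
    (h0 : ε x = 0) : x = 0 := by
  have : (⟨x, h0⟩ : LinearMap.ker ε) ∈ (syzygy h).gr (-1) := by
    change x ∈ P.gr (-1 + 1)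
    simpa using hx
  exact congrArg Subtype.val (hN.generatedIn.eq_zero_of_lt (by norm_num) this)

/-- Membership in the radical is vanishing of the component of degree 0, on which the cover is
injective. In particular the kernel of the cover lies in the radical, and `P` and `M` have the same
quotient by the radical. -/
theorem IsCover.mem_rad_of_mem_rad {P M : GrMod 𝒜} {ε : P.carrier →ₗ[A] M.carrier}
    (h : IsCover P M ε) (hN : (syzygy h).IsKoszul) (hM : M.GeneratedIn 0) {x : P.carrier}
    (hx : ε x ∈ rad 𝒜 M.carrier) : x ∈ rad 𝒜 P.carrier := by
  rw [mem_rad_iff hM] at hx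
  rw [mem_rad_iff h.generatedIn]
  refine h.eq_zero_of_mem_gr_zero hN (P.proj_mem _ _) ?_
  rw [← h.isDeg.proj_apply (l := 0) (add_zero 0), hx]

/-- A homogeneous direct summand of a Koszul module is Koszul. -/
theorem IsKoszul.of_retract {X Z : GrMod 𝒜} (hZ : Z.IsKoszul) {ι : X.carrier →ₗ[A] Z.carrier}
    {ρ : Z.carrier →ₗ[A] X.carrier} (hι : IsDeg X Z 0 ι) (hρ : IsDeg Z X 0 ρ)
    (h : ∀ x, ρ (ι x) = x) : X.IsKoszul := by
  refine isKoszul_of_forall_syzygy (fun X => ∃ (Z : GrMod 𝒜) (ι : X.carrier →ₗ[A] Z.carrier)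
    (ρ : Z.carrier →ₗ[A] X.carrier), Z.IsKoszul ∧ IsDeg X Z 0 ι ∧ IsDeg Z X 0 ρ ∧
      ∀ x, ρ (ι x) = x) ?_ ?_ ?_ ⟨Z, ι, ρ, hZ, hι, hρ, h⟩
  · rintro X ⟨Z, ι, ρ, hZ, hι, hρ, h⟩
    exact hZ.locallyFinite.of_surjective hρ fun x => ⟨_, h x⟩
  · rintro X ⟨Z, ι, ρ, hZ, hι, hρ, h⟩
    exact hZ.generatedIn.of_surjective hρ (fun x => ⟨_, h x⟩) (add_zero 0)
  rintro X ⟨Z, ι, ρ, hZ, hι, hρ, h⟩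
  obtain ⟨P, ε, hc, hN⟩ := hZ.exists_cover
  have := hc.projective
  -- `e` lifts the idempotent `ι ∘ ρ` of `Z` to the cover. In degree 0, `e ∘ e - e` takes values in
  -- the kernel of the cover, which is zero there, so `e` is itself idempotent.
  obtain ⟨e, he, hee⟩ := exists_lift hc.isDeg hc.surjective
    ((hι.comp hρ rfl).comp hc.isDeg (add_zero 0)) (r := 0) rfl
  replace hee : ∀ x, ε (e x) = ι (ρ (ε x)) := LinearMap.congr_fun hee
  have hid : ∀ x, e (e x) = e x := by
    refine LinearMap.congr_fun (f := e ∘ₗ e) (g := e) (hc.generatedIn.ext fun x hx => ?_)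
    have h1 := he 0 0 rfl x hx
    refine sub_eq_zero.1 (hc.eq_zero_of_mem_gr_zero hN (sub_mem (he 0 0 rfl _ h1) h1) ?_)
    rw [map_sub, LinearMap.comp_apply, hee, hee, h, sub_self]
  let Q := P.sub (LinearMap.range e) he.isHomog_range
  have hQe : ∀ x : LinearMap.range e, e x = x := by
    rintro ⟨_, x, rfl⟩
    exact hid x
  have hQ : IsCover Q X (ρ ∘ₗ ε ∘ₗ (LinearMap.range e).subtype) := by
    refine ⟨fun n => ?_, ?_, ?_, ?_, fun x => ?_⟩
    · have h := hc.locallyFinite.of_injective (M := Q.shift 0) (isDeg_subtype _ _ _ 0)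
        Subtype.val_injective n
      rwa [show (Q.shift 0).gr n = Q.gr n from congrArg Q.gr (add_zero n)] at h
    · exact Module.Projective.of_split (LinearMap.range e).subtype e.rangeRestrict
        (LinearMap.ext fun x => Subtype.ext (hQe x))
    · exact hc.generatedIn.of_surjective (N := Q) (f := e.rangeRestrict)
        (fun n l h m hm => he n l h m hm) e.surjective_rangeRestrict (add_zero 0)
    · exact fun n l h m hm => (hρ.comp hc.isDeg rfl) n l h _ hm
    · obtain ⟨p, hp⟩ := hc.surjective (ι x)
      refine ⟨⟨e p, p, rfl⟩, ?_⟩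
      change ρ (ε (e p)) = x
      rw [hee, h, hp, h]
  -- The image of `e` covers `X`, and `e` restricts to a retraction from the syzygy of `Z` onto the
  -- syzygy of `X`.
  refine ⟨_, ⟨syzygy hc, ?_⟩, hQ.isSyzygy⟩
  have hker : ∀ x : LinearMap.ker (ρ ∘ₗ ε ∘ₗ (LinearMap.range e).subtype),
      ε (x : LinearMap.range e) = 0 := fun ⟨x, hx⟩ => by
    change ρ (ε x) = 0 at hx
    rw [← hQe, hee, hx, map_zero]
  have hker' : ∀ x : LinearMap.ker ε, ρ (ε (e x)) = 0 := fun ⟨x, hx⟩ => by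
    rw [LinearMap.mem_ker] at hx
    rw [hee, hx, map_zero, map_zero, map_zero]
  refine ⟨((LinearMap.range e).subtype ∘ₗ Submodule.subtype _).codRestrict _ hker,
    (e.rangeRestrict ∘ₗ Submodule.subtype _).codRestrict _ hker', hN, fun n l h m hm => ?_,
    fun n l h m hm => ?_, fun x => ?_⟩
  · exact (isDeg_id _) (n + 1) (l + 1) (by omega) _ hm
  · exact he (n + 1) (l + 1) (by omega) _ hm
  · exact Subtype.ext (Subtype.ext (hQe x))

theorem isDeg_ofElement {M : GrMod 𝒜} {m : M.carrier} {s : ℤ} (hm : m ∈ M.gr s) :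
    IsDeg (regular 𝒜) M s (ofElement 𝒜 m) := fun n l h a ha => by
  subst h
  obtain hn | hn := lt_or_ge n 0
  · have : a = 0 := (regular_generatedIn 𝒜).eq_zero_of_lt hn ha
    rw [this, map_zero]; exact zero_mem _
  · obtain ⟨i, rfl⟩ := Int.eq_ofNat_of_zero_le hn
    exact M.smul_mem ((mem_regular_gr 𝒜 rfl).1 ha) hm

/-- A finitely generated graded projective module generated in degree zero is a homogeneous
direct summand of a finite free one. -/
theorem exists_homogeneous_dualBasis {P : GrMod 𝒜} (hlf : P.LocallyFinite)
    [Module.Projective A P.carrier] (hg : P.GeneratedIn 0) :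
    ∃ (r : ℕ) (p : Fin r → P.carrier →ₗ[A] (regular 𝒜).carrier)
      (q : Fin r → (regular 𝒜).carrier →ₗ[A] P.carrier),
      (∀ j, IsDeg P (regular 𝒜) 0 (p j)) ∧ (∀ j, IsDeg (regular 𝒜) P 0 (q j)) ∧
        ∀ x, ∑ j, q j (p j x) = x := by
  have := hlf 0
  obtain ⟨r, b, hb⟩ := Module.Finite.exists_fin (R := k) (M := P.gr 0)
  let q : Fin r → (regular 𝒜).carrier →ₗ[A] P.carrier := fun j => ofElement 𝒜 (b j : P.carrier)
  have hq : ∀ j, IsDeg (regular 𝒜) P 0 (q j) := fun j => isDeg_ofElement (b j).2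
  let f : (Fin r → (regular 𝒜).carrier) →ₗ[A] P.carrier := ∑ j, q j ∘ₗ LinearMap.proj j
  have hf : Function.Surjective f := by
    refine LinearMap.range_eq_top.1 (top_unique (hg ▸ Submodule.span_le.2 fun x hx => ?_))
    have h1 : (⊤ : Submodule k (P.gr 0)) ≤
        ((LinearMap.range f).restrictScalars k).comap (P.gr 0).subtype := by
      rw [← hb, Submodule.span_le]
      rintro _ ⟨j, rfl⟩
      classical
      refine ⟨Pi.single j (regularOne 𝒜), ?_⟩
      simp only [f, LinearMap.coe_sum, Finset.sum_apply, LinearMap.comp_apply,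
        LinearMap.proj_apply]
      rw [Finset.sum_eq_single j (fun i _ hi => by simp [hi]) (by simp)]
      rw [Pi.single_eq_same]
      exact ofElement_one 𝒜 (b j : P.carrier)
    exact h1 (Submodule.mem_top (x := ⟨x, hx⟩))
  obtain ⟨s, hs⟩ := Module.projective_lifting_property f LinearMap.id hf
  refine ⟨r, fun j => degPart P (regular 𝒜) 0 (LinearMap.proj j ∘ₗ s), q,
    fun j => isDeg_degPart _ _ _ _, hq, fun x => ?_⟩
  suffices h : ∑ j, q j ∘ₗ degPart P (regular 𝒜) 0 (LinearMap.proj j ∘ₗ s) = LinearMap.id by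
    simpa using LinearMap.congr_fun h x
  refine ext_homogeneous fun n m hm => ?_
  have h1 := LinearMap.congr_fun hs m
  simp only [f, LinearMap.coe_sum, Finset.sum_apply, LinearMap.comp_apply, LinearMap.proj_apply,
    LinearMap.id_apply] at h1 ⊢
  conv_rhs => rw [← P.proj_of_mem hm, ← h1, map_sum]
  refine Finset.sum_congr rfl fun j _ => ?_
  rw [degPart_apply P (regular 𝒜) 0 (LinearMap.proj j ∘ₗ s) hm (add_zero n)]
  exact ((hq j).proj_apply (add_zero n) (s m j)).symm

/-- For a cover `P → M` with kernel in the radical, `M / rad M = P / rad P`; this is a summand of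
`A_0^r` because `P` is a summand of `A^r`. -/
theorem IsKoszul.isRetractOfPow {M : GrMod 𝒜} (hM : M.IsKoszul) :
    IsRetractOfPow A (degreeZero 𝒜).carrier (M.carrier ⧸ rad 𝒜 M.carrier) := by
  obtain ⟨P, ε, hc, hN⟩ := hM.exists_cover
  have := hc.projective
  obtain ⟨r, p, q, -, -, hpq⟩ := exists_homogeneous_dualBasis hc.locallyFinite hc.generatedIn
  let π : P.carrier →ₗ[A] M.carrier ⧸ rad 𝒜 M.carrier := (rad 𝒜 M.carrier).mkQ ∘ₗ ε
  have hπ : Function.Surjective π := (Submodule.mkQ_surjective _).comp hc.surjective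
  have hk : ∀ x, π x = 0 → x ∈ rad 𝒜 P.carrier := fun x hx =>
    hc.mem_rad_of_mem_rad hN hM.generatedIn ((Submodule.Quotient.mk_eq_zero _).1 hx)
  choose p' hp' using fun j => exists_factor hπ (augmentation 𝒜 ∘ₗ p j)
    fun x hx => map_rad_degreeZero 𝒜 _ (hk x hx)
  choose q' hq' using fun j => exists_factor (augmentation_surjective 𝒜) (π ∘ₗ q j)
    fun x hx => (Submodule.Quotient.mk_eq_zero _).2
      (map_mem_rad (ε ∘ₗ q j) ((augmentation_eq_zero_iff 𝒜 x).1 hx))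
  refine ⟨r, p', q', fun y => ?_⟩
  obtain ⟨x, rfl⟩ := hπ y
  conv_rhs => rw [← hpq x, map_sum]
  refine Finset.sum_congr rfl fun j _ => ?_
  rw [hp', LinearMap.comp_apply, hq', LinearMap.comp_apply]

end Closure

end GrMod

namespace GrMod

/-! ### Cokernels of injections between Koszul modules; self-injectivity of `A_0` enters here. -/

section ShortExact

variable {k : Type v} [Field k] {A : Type u} [Ring A] [Algebra k A] {𝒜 : ℕ → Submodule k A}

theorem IsDeg.symm {M N : GrMod 𝒜} {s t : ℤ} {e : M.carrier ≃ₗ[A] N.carrier}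
    (he : IsDeg M N s e.toLinearMap) (h : s + t = 0) : IsDeg N M t e.symm.toLinearMap := by
  refine IsDeg.of_comp he e.injective (r := 0) ?_ (by omega)
  have : e.toLinearMap ∘ₗ e.symm.toLinearMap = LinearMap.id :=
    LinearMap.ext e.apply_symm_apply
  rw [this]
  exact isDeg_id N

/-- Restriction of a homogeneous map to homogeneous submodules. -/
theorem IsDeg.restrict {M N : GrMod 𝒜} {s a b c : ℤ} {f : M.carrier →ₗ[A] N.carrier}
    (hf : IsDeg M N s f) {U : Submodule A M.carrier} (hU : M.IsHomog U)
    {V : Submodule A N.carrier} (hV : N.IsHomog V) (h : ∀ x ∈ U, f x ∈ V) (e : a + s = b + c) :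
    IsDeg ((M.sub U hU).shift a) ((N.sub V hV).shift b) c (f.restrict h) :=
  fun n l hl m hm => hf (n + a) (l + b) (by omega) _ hm

variable [GradedAlgebra 𝒜]

/-- Given Koszul modules `K ⊆ L`, the map between their covers has a retraction. -/
theorem exists_retraction_cover (hinj : Module.Injective (𝒜 0) (𝒜 0)) {K L P Q : GrMod 𝒜}
    (hK : K.IsKoszul) (hL : L.GeneratedIn 0)
    {f : K.carrier →ₗ[A] L.carrier} (hf : IsDeg K L 0 f) (hfi : Function.Injective f)
    {εK : P.carrier →ₗ[A] K.carrier} (hP : IsCover P K εK) (hPK : (syzygy hP).IsKoszul)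
    {εL : Q.carrier →ₗ[A] L.carrier} (hQ : IsCover Q L εL)
    {i : P.carrier →ₗ[A] Q.carrier} (hi : IsDeg P Q 0 i) (hεi : ∀ x, εL (i x) = f (εK x)) :
    ∃ r : Q.carrier →ₗ[A] P.carrier, IsDeg Q P 0 r ∧ ∀ x, r (i x) = x := by
  have := hQ.projective
  obtain ⟨n, p, q, hpq⟩ := hK.isRetractOfPow
  let πK := (rad 𝒜 K.carrier).mkQ
  let πL := (rad 𝒜 L.carrier).mkQ
  obtain ⟨fb, hfb⟩ := exists_factor (f := πK) (Submodule.mkQ_surjective _) (πL ∘ₗ f) fun x hx =>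
    (Submodule.Quotient.mk_eq_zero _).2
      (map_mem_rad f ((Submodule.Quotient.mk_eq_zero _).1 hx))
  -- Both radicals are detected in degree 0, where `f` is injective.
  have hfbi : Function.Injective fb := by
    rw [injective_iff_map_eq_zero]
    intro y hy
    obtain ⟨x, rfl⟩ := Submodule.mkQ_surjective _ y
    have h1 : πL (f x) = 0 := (hfb x).symm.trans hy
    rw [Submodule.mkQ_apply, Submodule.Quotient.mk_eq_zero, mem_rad_iff hL,
      hf.proj_apply (zero_add 0)] at h1
    rw [Submodule.mkQ_apply, Submodule.Quotient.mk_eq_zero, mem_rad_iff hK.generatedIn]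
    exact hfi (h1.trans (map_zero f).symm)
  -- `K / rad K` is a summand of `A_0^n`, so extending its coordinate maps along `fb` splits `fb`.
  choose p' hp' using fun j => exists_extension_degreeZero 𝒜 hinj (rad_quotient_rad L.carrier)
    hfbi (p j)
  let rb : L.carrier ⧸ rad 𝒜 L.carrier →ₗ[A] K.carrier ⧸ rad 𝒜 K.carrier := ∑ j, q j ∘ₗ p' j
  have hrb : ∀ y, rb (fb y) = y := fun y => by
    simp only [rb, LinearMap.coe_sum, Finset.sum_apply, LinearMap.comp_apply, hp', hpq]
  obtain ⟨s, hs⟩ := Module.projective_lifting_property (πK ∘ₗ εK) (rb ∘ₗ πL ∘ₗ εL)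
    ((Submodule.mkQ_surjective _).comp hP.surjective)
  -- The lift `s` of the splitting is a retraction of `i` only modulo the radical of `P`. On
  -- generators of degree 0 the component of degree 0 removes this error.
  refine ⟨degPart Q P 0 s, isDeg_degPart _ _ _ _, ?_⟩
  refine LinearMap.congr_fun (f := degPart Q P 0 s ∘ₗ i) (g := LinearMap.id)
    (hP.generatedIn.ext fun x hx => ?_)
  have h1 : πK (εK (s (i x))) = rb (πL (εL (i x))) := LinearMap.congr_fun hs (i x)
  have h2 : πL (f (εK x)) = fb (πK (εK x)) := (hfb _).symm
  rw [hεi, h2, hrb, ← sub_eq_zero, ← map_sub, ← map_sub, Submodule.mkQ_apply,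
    Submodule.Quotient.mk_eq_zero] at h1
  have h3 := (mem_rad_iff hP.generatedIn).1 (hP.mem_rad_of_mem_rad hPK hK.generatedIn h1)
  rw [map_sub, P.proj_of_mem hx, sub_eq_zero] at h3
  rw [LinearMap.comp_apply, degPart_apply Q P 0 s (hi 0 0 rfl x hx) (add_zero 0), h3, LinearMap.id_apply]

/-- The cokernel of an injective homogeneous map of degree zero between Koszul modules is
Koszul. -/
theorem IsKoszul.of_shortExact (hinj : Module.Injective (𝒜 0) (𝒜 0)) {K L M : GrMod 𝒜}
    (hK : K.IsKoszul) (hL : L.IsKoszul) {f : K.carrier →ₗ[A] L.carrier}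
    {g : L.carrier →ₗ[A] M.carrier} (hf : IsDeg K L 0 f) (hg : IsDeg L M 0 g)
    (hfi : Function.Injective f) (hfg : Function.Exact f g) (hgs : Function.Surjective g) :
    M.IsKoszul := by
  refine isKoszul_of_forall_syzygy (fun M => ∃ (K L : GrMod 𝒜) (f : K.carrier →ₗ[A] L.carrier)
    (g : L.carrier →ₗ[A] M.carrier), K.IsKoszul ∧ L.IsKoszul ∧ IsDeg K L 0 f ∧ IsDeg L M 0 g ∧
      Function.Injective f ∧ Function.Exact f g ∧ Function.Surjective g) ?_ ?_ ?_
      ⟨K, L, f, g, hK, hL, hf, hg, hfi, hfg, hgs⟩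
  · rintro M ⟨K, L, f, g, hK, hL, hf, hg, hfi, hfg, hgs⟩
    exact hL.locallyFinite.of_surjective hg hgs
  · rintro M ⟨K, L, f, g, hK, hL, hf, hg, hfi, hfg, hgs⟩
    exact hL.generatedIn.of_surjective hg hgs (add_zero 0)
  rintro M ⟨K, L, f, g, hK, hL, hf, hg, hfi, hfg, hgs⟩
  obtain ⟨P, εK, hP, hPK⟩ := hK.exists_cover
  obtain ⟨Q, εL, hQ, hQL⟩ := hL.exists_cover
  have := hP.projective
  have := hQ.projective
  obtain ⟨i, hi, hεi⟩ := exists_lift hQ.isDeg hQ.surjective (hf.comp hP.isDeg (add_zero 0))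
    (r := 0) rfl
  replace hεi : ∀ x, εL (i x) = f (εK x) := LinearMap.congr_fun hεi
  obtain ⟨r, hr, hri⟩ := exists_retraction_cover hinj hK hL.generatedIn hf hfi hP hPK hQ hi hεi
  have hgf : ∀ x, g (f x) = 0 := hfg.apply_apply_eq_zero
  -- The kernel of `r` is a complement of `i(P)` in `Q`, and it covers `M = L / K`.
  let ρ : Q.carrier →ₗ[A] LinearMap.ker r :=
    (LinearMap.id - i ∘ₗ r).codRestrict _ fun x => by simp [hri]
  have hρd : IsDeg Q (Q.sub (LinearMap.ker r) hr.isHomog_ker) 0 ρ :=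
    (isDeg_id Q).sub (hi.comp hr (add_zero 0))
  have hρ : ∀ x : LinearMap.ker r, ρ x = x := fun ⟨x, hx⟩ => Subtype.ext <| by
    rw [LinearMap.mem_ker] at hx
    simp [ρ, hx]
  have hc : IsCover (Q.sub (LinearMap.ker r) hr.isHomog_ker) M
      (g ∘ₗ εL ∘ₗ (LinearMap.ker r).subtype) := by
    refine ⟨hQ.locallyFinite.of_surjective hρd fun x => ⟨_, hρ x⟩,
      Module.Projective.of_split (LinearMap.ker r).subtype ρ (LinearMap.ext hρ),
      hQ.generatedIn.of_surjective hρd (fun x => ⟨_, hρ x⟩) (add_zero 0),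
      fun n l h m hm => hg.comp hQ.isDeg rfl n l h _ hm, fun m => ?_⟩
    obtain ⟨y, rfl⟩ := hgs m
    obtain ⟨x, rfl⟩ := hQ.surjective y
    refine ⟨ρ x, ?_⟩
    change g (εL (x - i (r x))) = _
    rw [map_sub, map_sub, hεi, hgf, sub_zero]
  have hρk : ∀ x : LinearMap.ker εL, (g ∘ₗ εL ∘ₗ (LinearMap.ker r).subtype) (ρ x) = 0 := by
    rintro ⟨x, hx⟩
    rw [LinearMap.mem_ker] at hx
    change g (εL (x - i (r x))) = _
    rw [map_sub, map_sub, hεi, hgf, hx, map_zero, sub_zero]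
  have hik : ∀ x ∈ LinearMap.ker εK, i x ∈ LinearMap.ker εL := fun x hx => by
    rw [LinearMap.mem_ker] at hx ⊢
    rw [hεi, hx, map_zero]
  -- As in the snake lemma, the syzygy of `M` is the cokernel of the induced injection from the
  -- syzygy of `K` to that of `L`, so the coinductive class is closed under syzygies.
  refine ⟨_, ⟨_, _, i.restrict hik,
    (ρ ∘ₗ (LinearMap.ker εL).subtype).codRestrict _ hρk, hPK, hQL, hi.restrict _ _ hik (by omega),
    fun n l h m hm => hρd (n + 1) (l + 1) (by omega) _ hm, fun x y h => ?_, fun y => ⟨fun h => ?_,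
    ?_⟩, fun z => ?_⟩, hc.isSyzygy⟩
  · have h1 : i x = i y := congrArg Subtype.val h
    exact Subtype.ext (by rw [← hri x, h1, hri])
  · have h1 : (y : Q.carrier) - i (r y) = 0 := congrArg (fun z => z.1.1) h
    rw [sub_eq_zero] at h1
    refine ⟨⟨r y, ?_⟩, Subtype.ext h1.symm⟩
    rw [LinearMap.mem_ker]
    refine hfi ?_
    rw [← hεi, ← h1, map_zero]
    exact y.2
  · rintro ⟨x, rfl⟩
    refine Subtype.ext (Subtype.ext ?_)
    change i x - i (r (i x)) = 0
    rw [hri, sub_self]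
  · obtain ⟨⟨z, hz⟩, hz'⟩ := z
    have h1 : g (εL z) = 0 := hz'
    obtain ⟨κ, hκ⟩ := (hfg _).1 h1
    obtain ⟨x, rfl⟩ := hP.surjective κ
    refine ⟨⟨z - i x, ?_⟩, Subtype.ext (Subtype.ext ?_)⟩
    · rw [LinearMap.mem_ker, map_sub, hεi, hκ, sub_self]
    · change z - i x - i (r (z - i x)) = z
      rw [LinearMap.mem_ker] at hz
      rw [map_sub, hz, hri, zero_sub, map_neg]
      abel

end ShortExact

/-! ### The radical of a Koszul module is Koszul after a shift. -/

section Radical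

variable {k : Type v} [Field k] {A : Type u} [Ring A] [Algebra k A] {𝒜 : ℕ → Submodule k A}
  [GradedAlgebra 𝒜]

/-- `A_{≥ 1} M`, shifted so that it may be generated in degree zero. -/
abbrev radShift {M : GrMod 𝒜} (hM : M.GeneratedIn 0) : GrMod 𝒜 :=
  (M.sub (rad 𝒜 M.carrier) (isHomog_rad hM)).shift 1

theorem isKoszul_radShift_regular (hA : (degreeZero 𝒜).IsKoszul) :
    (radShift (regular_generatedIn 𝒜)).IsKoszul := by
  obtain ⟨P, ε, hc, hN⟩ := hA.exists_cover
  have := hc.projective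
  have htop : (degreeZero 𝒜).gr 0 = ⊤ :=
    if_pos (c := (0 : ℤ) = 0) (t := (⊤ : Submodule k (degreeZero 𝒜).carrier)) (e := ⊥) rfl
  -- The given cover of `A_0` is `A` up to isomorphism: `1 ↦ x` is compatible with the maps to
  -- `A_0`, neither of which has a kernel in degree 0. Hence the Koszul syzygy of `A_0` is `A_{≥1}`.
  obtain ⟨x, hx, hx1⟩ := hc.isDeg.exists_preimage hc.surjective (add_zero 0)
    (htop ▸ Submodule.mem_top (x := augmentation 𝒜 (regularOne 𝒜)))
  have hf := isDeg_ofElement (M := P) hx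
  have hεf : ∀ a, ε (ofElement 𝒜 x a) = augmentation 𝒜 a :=
    LinearMap.congr_fun (f := ε ∘ₗ ofElement 𝒜 x) (regular_hom_ext 𝒜 (by
      rw [LinearMap.comp_apply, ofElement_one, hx1]))
  have hb : Function.Bijective (ofElement 𝒜 x) := by
    refine bijective_of_gr_zero (regular_generatedIn 𝒜) hc.generatedIn hf (fun a ha h => ?_)
      fun y hy => ?_
    · have h1 : augmentation 𝒜 a = 0 := by rw [← hεf, h, map_zero]
      rw [augmentation_eq_zero_iff, mem_rad_iff (regular_generatedIn 𝒜),
        (regular 𝒜).proj_of_mem ha] at h1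
      exact h1
    · obtain ⟨a, ha⟩ := augmentation_surjective 𝒜 (ε y)
      have h0 := (regular 𝒜).proj_mem 0 a
      refine ⟨_, h0, sub_eq_zero.1 (hc.eq_zero_of_mem_gr_zero hN
        (sub_mem (hf 0 0 rfl _ h0) hy) ?_)⟩
      rw [map_sub, hεf, ← ha, ← map_sub, augmentation_eq_zero_iff,
        mem_rad_iff (regular_generatedIn 𝒜), map_sub, (regular 𝒜).proj_of_mem h0, sub_self]
  let e := LinearEquiv.ofBijective (ofElement 𝒜 x) hb
  have he : IsDeg (regular 𝒜) P 0 e.toLinearMap := hf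
  have h1 : ∀ a ∈ rad 𝒜 (regular 𝒜).carrier, e.toLinearMap a ∈ LinearMap.ker ε := fun a ha =>
    (hεf a).trans ((augmentation_eq_zero_iff 𝒜 a).2 ha)
  have h2 : ∀ y ∈ LinearMap.ker ε, e.symm.toLinearMap y ∈ rad 𝒜 (regular 𝒜).carrier :=
    fun y hy => by
      rw [← augmentation_eq_zero_iff, ← hεf]
      exact (congrArg ε (e.apply_symm_apply y)).trans hy
  exact hN.of_retract (he.restrict _ _ h1 (by omega)) ((he.symm (add_zero 0)).restrict _ _ h2
    (by omega)) fun a => Subtype.ext (e.symm_apply_apply a.1)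

/-- The radical is functorial, so writing `P` as a homogeneous retract of `A^r` makes `rad P` one of
`(rad A)^r`. -/
theorem IsCover.isKoszul_radShift (hA : (degreeZero 𝒜).IsKoszul) {P M : GrMod 𝒜}
    {ε : P.carrier →ₗ[A] M.carrier} (hc : IsCover P M ε) :
    (radShift hc.generatedIn).IsKoszul := by
  have := hc.projective
  obtain ⟨r, p, q, hp, hq, hpq⟩ := exists_homogeneous_dualBasis hc.locallyFinite hc.generatedIn
  let R := rad 𝒜 (regular 𝒜).carrier
  refine ((isKoszul_radShift_regular hA).pow r).of_retract
    (X := radShift hc.generatedIn)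
    (ι := LinearMap.pi fun j => (p j).restrict fun x hx => map_mem_rad (p j) hx)
    (ρ := ∑ j, ((q j).restrict (q := rad 𝒜 P.carrier) fun x hx => map_mem_rad (q j) hx) ∘ₗ
      LinearMap.proj j)
    (fun n l h m hm j _ => hp j (n + 1) (l + 1) (by omega) _ hm) ?_ fun x => ?_
  · intro n l h m hm
    rw [LinearMap.sum_apply]
    exact sum_mem fun j _ => hq j (n + 1) (l + 1) (by omega) _ (hm j trivial)
  · refine Subtype.ext (Eq.trans ?_ (hpq x))
    rw [LinearMap.sum_apply]
    exact AddSubmonoidClass.coe_finsetSum _ _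

/-- If `M` is Koszul, then so is `A_{≥ 1} M`, up to a shift. -/
theorem IsKoszul.radShift (hinj : Module.Injective (𝒜 0) (𝒜 0))
    (hA : (degreeZero 𝒜).IsKoszul) {M : GrMod 𝒜} (hM : M.IsKoszul) :
    (radShift hM.generatedIn).IsKoszul := by
  obtain ⟨P, ε, hc, hN⟩ := hM.exists_cover
  have hk : ∀ x ∈ LinearMap.ker ε, LinearMap.id (R := A) x ∈ rad 𝒜 P.carrier := fun x hx =>
    hc.mem_rad_of_mem_rad hN hM.generatedIn (by
      rw [LinearMap.mem_ker] at hx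
      rw [LinearMap.id_apply, hx]; exact zero_mem _)
  have hr : ∀ x ∈ rad 𝒜 P.carrier, ε x ∈ rad 𝒜 M.carrier := fun x hx => map_mem_rad ε hx
  -- The sequence is `0 → ker ε → rad P → rad M → 0`, with all three terms shifted by one.
  refine hN.of_shortExact hinj (hc.isKoszul_radShift hA) (f := LinearMap.id.restrict hk)
    (g := ε.restrict hr) ((isDeg_id P).restrict _ _ hk (by omega))
    (hc.isDeg.restrict _ _ hr (by omega)) (fun x y h => ?_) (fun x => ⟨fun h => ?_, ?_⟩)
    fun y => ?_
  · have h1 := congrArg Subtype.val h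
    exact Subtype.ext h1
  · exact ⟨⟨x.1, congrArg Subtype.val h⟩, Subtype.ext rfl⟩
  · rintro ⟨y, rfl⟩
    exact Subtype.ext y.2
  · obtain ⟨x, hx, hxy⟩ := exists_mem_rad_of_surjective hc.surjective y.2
    exact ⟨⟨x, hx⟩, Subtype.ext hxy⟩

end Radical

end GrMod

/-! ### Maps of positive degree vanish on `Ext^*(-, A_0)`; finiteness of these groups. -/

section ExtVanishing

variable {k : Type v} [Field k] {A : Type u} [Ring A] [Algebra k A] {𝒜 : ℕ → Submodule k A}
  [GradedAlgebra 𝒜]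

open GrMod

theorem subsingleton_ext_of_projective {P : Type u} [AddCommGroup P] [Module A P]
    [h : Module.Projective A P] (Y : ModuleCat.{u} A) (n : ℕ) :
    Subsingleton (Ext (ModuleCat.of A P) Y (n + 1)) := by
  have := (IsProjective.iff_projective P).1 h
  exact Ext.subsingleton_of_projective (ModuleCat.of A P) Y n

/-- A homogeneous map of positive degree between Koszul modules induces zero on `Ext^*(-, A_0)`. -/
theorem mk₀_comp_eq_zero_of_isDeg (i : ℕ) {M N : GrMod 𝒜} (hM : M.IsKoszul) (hN : N.IsKoszul)
    {s : ℤ} (hs : 0 < s) {f : N.carrier →ₗ[A] M.carrier} (hf : IsDeg N M s f)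
    (x : Ext M.toModuleCat (degreeZero 𝒜).toModuleCat i) :
    (Ext.mk₀ (ModuleCat.ofHom f)).comp x (zero_add i) = 0 := by
  induction i generalizing M N s with
  | zero =>
    obtain ⟨g, rfl⟩ := Ext.mk₀_bijective _ _ |>.2 x
    rw [Ext.mk₀_comp_mk₀]
    -- The image of `f` lies in positive degrees, that is, in the radical, and every linear map to
    -- `A_0` kills the radical.
    have : ModuleCat.ofHom f ≫ g = 0 := by
      ext n
      refine map_rad_degreeZero 𝒜 g.hom ?_
      have h1 : f n ∈ LinearMap.range f := ⟨n, rfl⟩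
      refine (?_ : LinearMap.range f ≤ rad 𝒜 M.carrier) h1
      rw [LinearMap.range_eq_map, ← hN.generatedIn, Submodule.map_span_le, rad_eq_ge hM.generatedIn]
      exact fun m hm => M.mem_ge_of_mem (n := s) (by omega) (hf _ _ (by omega) m hm)
    rw [this, Ext.mk₀_zero]
  | succ i ih =>
    obtain ⟨P, ε, hc, hk⟩ := hM.exists_cover
    obtain ⟨P', ε', hc', hk'⟩ := hN.exists_cover
    have := hc.projective
    have := hc'.projective
    -- A lift of `f` to the covers of the same degree `s` restricts to the syzygies with degree `s`;
    -- naturality of the extension class reduces `i + 1` to `i`.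
    obtain ⟨F, hF, hFf⟩ := exists_lift hc.isDeg hc.surjective (hf.comp hc'.isDeg (zero_add s))
      (r := s) (add_zero s)
    have hFk : ∀ x ∈ LinearMap.ker ε', F x ∈ LinearMap.ker ε := fun x hx => by
      rw [LinearMap.mem_ker] at hx ⊢
      exact (LinearMap.congr_fun hFf x).trans (by rw [LinearMap.comp_apply, hx, map_zero])
    have hS := LinearMap.shortExact_shortComplexKer hc.surjective
    have hS' := LinearMap.shortExact_shortComplexKer hc'.surjective
    let φ : ε'.shortComplexKer ⟶ ε.shortComplexKer :=
      { τ₁ := ModuleCat.ofHom (F.restrict hFk)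
        τ₂ := ModuleCat.ofHom F
        τ₃ := ModuleCat.ofHom f
        comm₁₂ := rfl
        comm₂₃ := ModuleCat.hom_ext hFf }
    have := subsingleton_ext_of_projective (P := P.carrier) (degreeZero 𝒜).toModuleCat i
    obtain ⟨x', hx'⟩ := Ext.contravariant_sequence_exact₃ hS (degreeZero 𝒜).toModuleCat x
      (Subsingleton.elim _ _) (add_comm 1 i)
    rw [← hx', ← Ext.comp_assoc _ _ _ (zero_add 1) (add_comm 1 i) (by omega),
      ← ShortComplex.ShortExact.extClass_naturality hS' hS φ,
      Ext.comp_assoc _ _ _ (add_zero 1) (zero_add i) (by omega)]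
    have h0 := ih (M := syzygy hc) (N := syzygy hc') hk hk' hs
      (hF.restrict hc'.isDeg.isHomog_ker hc.isDeg.isHomog_ker hFk rfl) x'
    exact (congrArg (fun y => hS'.extClass.comp y (add_comm 1 i)) h0).trans
      (Ext.comp_zero _ _ _ _ _)

theorem addEquiv₀_smul_apply {X Y : ModuleCat.{u} A} (c : k) (x : Ext X Y 0) (m : X) :
    (Ext.addEquiv₀ (c • x)).hom m = algebraMap k A c • (Ext.addEquiv₀ x).hom m := by
  obtain ⟨f, rfl⟩ := (Ext.mk₀_bijective _ _).2 x
  rw [← Ext.mk₀_smul]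
  have h : ∀ g : X ⟶ Y, Ext.addEquiv₀ (Ext.mk₀ g) = g := fun g => Ext.addEquiv₀.apply_symm_apply g
  rw [h, h]
  rfl

/-- A map from `M` to `A_0` is determined on the finite-dimensional space `M_0`, and higher Ext
groups are quotients of lower ones of the syzygy. -/
theorem finite_ext_degreeZero (hfin : Module.Finite k (𝒜 0)) (i : ℕ) {M : GrMod 𝒜}
    (hM : M.IsKoszul) : Module.Finite k (Ext M.toModuleCat (degreeZero 𝒜).toModuleCat i) := by
  induction i generalizing M with
  | zero =>
    have := hM.locallyFinite 0
    have : Module.Finite k (degreeZero 𝒜).carrier := hfin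
    let φ : Ext M.toModuleCat (degreeZero 𝒜).toModuleCat 0 →ₗ[k]
        (M.gr 0 →ₗ[k] (degreeZero 𝒜).carrier) :=
      { toFun := fun x => (Ext.addEquiv₀ x).hom.restrictScalars k ∘ₗ (M.gr 0).subtype
        map_add' := fun x y => by
          rw [map_add]; rfl
        map_smul' := fun c x => LinearMap.ext fun m => (addEquiv₀_smul_apply c x m).trans
          (algebraMap_smul A c ((Ext.addEquiv₀ x).hom m : (degreeZero 𝒜).carrier)) }
    refine Module.Finite.of_injective φ fun x y h => Ext.addEquiv₀.injective ?_
    exact ModuleCat.hom_ext (hM.generatedIn.ext fun m hm => LinearMap.congr_fun h ⟨m, hm⟩)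
  | succ i ih =>
    obtain ⟨P, ε, hc, hk⟩ := hM.exists_cover
    have := hc.projective
    have hS := LinearMap.shortExact_shortComplexKer hc.surjective
    have := subsingleton_ext_of_projective (P := P.carrier) (degreeZero 𝒜).toModuleCat i
    have h0 : Module.Finite k (Ext ε.shortComplexKer.X₁ (degreeZero 𝒜).toModuleCat i) :=
      ih (M := syzygy hc) hk
    let φ : Ext ε.shortComplexKer.X₁ (degreeZero 𝒜).toModuleCat i →ₗ[k]
        Ext M.toModuleCat (degreeZero 𝒜).toModuleCat (i + 1) :=
      { toFun := fun x => hS.extClass.comp x (add_comm 1 i)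
        map_add' := fun x y => Ext.comp_add _ _ _ _
        map_smul' := fun c x => Ext.comp_smul _ _ _ _ }
    exact Module.Finite.of_surjective φ fun x =>
      Ext.contravariant_sequence_exact₃ hS (degreeZero 𝒜).toModuleCat x
        (Subsingleton.elim _ _) (add_comm 1 i)

end ExtVanishing

/-! ### Modules underlying Koszul modules; the grading is forgotten since neither Ext nor the
radical depends on it. -/

section Linear

variable {k : Type v} [Field k] {A : Type u} [Ring A] [Algebra k A] (𝒜 : ℕ → Submodule k A)

open GrMod

/-- The submodule `A_{≥ 1} N` as an object of the category of modules. -/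
abbrev radObj (N : ModuleCat.{u} A) : ModuleCat.{u} A := ModuleCat.of A (rad 𝒜 N)

/-- The quotient `N / A_{≥ 1} N` as an object of the category of modules. -/
abbrev topObj (N : ModuleCat.{u} A) : ModuleCat.{u} A := ModuleCat.of A (N ⧸ rad 𝒜 N)

/-- A module which underlies a Koszul module. -/
def IsLin (N : ModuleCat.{u} A) : Prop :=
  ∃ M : GrMod 𝒜, M.IsKoszul ∧ Nonempty (M.carrier ≃ₗ[A] N)

variable {𝒜}

theorem GrMod.IsKoszul.isLin {M : GrMod 𝒜} (hM : M.IsKoszul) : IsLin 𝒜 M.toModuleCat :=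
  ⟨M, hM, ⟨LinearEquiv.refl A _⟩⟩

theorem map_rad_equiv {N N' : Type*} [AddCommGroup N] [Module A N] [AddCommGroup N']
    [Module A N'] (e : N ≃ₗ[A] N') : (rad 𝒜 N).map e.toLinearMap = rad 𝒜 N' := by
  ext y
  constructor
  · rintro ⟨x, hx, rfl⟩
    exact map_mem_rad e.toLinearMap hx
  · intro hy
    exact exists_mem_rad_of_surjective (f := e.toLinearMap) e.surjective hy

/-- The isomorphism between radicals induced by an isomorphism. -/
def radEquiv {N N' : Type*} [AddCommGroup N] [Module A N] [AddCommGroup N']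
    [Module A N'] (e : N ≃ₗ[A] N') : rad 𝒜 N ≃ₗ[A] rad 𝒜 N' :=
  e.submoduleMap (rad 𝒜 N) ≪≫ₗ LinearEquiv.ofEq _ _ (map_rad_equiv e)

variable [GradedAlgebra 𝒜]

namespace IsLin

theorem rad (hinj : Module.Injective (𝒜 0) (𝒜 0)) (hA : (degreeZero 𝒜).IsKoszul)
    {N : ModuleCat.{u} A} (hN : IsLin 𝒜 N) : IsLin 𝒜 (radObj 𝒜 N) := by
  obtain ⟨M, hM, ⟨e⟩⟩ := hN
  exact ⟨radShift hM.generatedIn, IsKoszul.radShift hinj hA hM, ⟨radEquiv e⟩⟩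

theorem isRetractOfPow {N : ModuleCat.{u} A} (hN : IsLin 𝒜 N) :
    IsRetractOfPow A (degreeZero 𝒜).carrier (topObj 𝒜 N) := by
  obtain ⟨M, hM, ⟨e⟩⟩ := hN
  obtain ⟨r, p, q, hpq⟩ := hM.isRetractOfPow
  let e' := Submodule.Quotient.equiv _ _ e (map_rad_equiv (𝒜 := 𝒜) e)
  refine ⟨r, fun j => p j ∘ₗ e'.symm.toLinearMap, fun j => e'.toLinearMap ∘ₗ q j, fun y => ?_⟩
  refine Eq.trans ?_ (e'.apply_symm_apply y)
  rw [← hpq (e'.symm y), map_sum]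
  refine Finset.sum_congr rfl fun j _ => ?_
  rfl

/-- With the shifted grading on the radical, which is again Koszul, its inclusion is a map of degree
1. -/
theorem mk₀_radSubtype_comp (hinj : Module.Injective (𝒜 0) (𝒜 0))
    (hA : (degreeZero 𝒜).IsKoszul) {N : ModuleCat.{u} A} (hN : IsLin 𝒜 N) {i : ℕ}
    (x : Ext N (degreeZero 𝒜).toModuleCat i) :
    (Ext.mk₀ (ModuleCat.ofHom (GrKoszul.rad 𝒜 N).subtype)).comp x (zero_add i) = 0 := by
  obtain ⟨M, hM, ⟨e⟩⟩ := hN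
  have h1 := mk₀_comp_eq_zero_of_isDeg i hM (IsKoszul.radShift hinj hA hM) one_pos
    (isDeg_subtype _ _ (isHomog_rad hM.generatedIn) 1)
    ((Ext.mk₀ (ModuleCat.ofHom e.toLinearMap)).comp x (zero_add i))
  rw [Ext.mk₀_comp_mk₀_assoc] at h1
  have h2 : ModuleCat.ofHom (radEquiv (𝒜 := 𝒜) e).symm.toLinearMap ≫
      ModuleCat.ofHom (GrKoszul.rad 𝒜 M.carrier).subtype ≫ ModuleCat.ofHom e.toLinearMap =
      ModuleCat.ofHom (GrKoszul.rad 𝒜 N).subtype := by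
    ext y
    exact congrArg Subtype.val ((radEquiv (𝒜 := 𝒜) e).apply_symm_apply y)
  rw [← h2, ← Ext.mk₀_comp_mk₀_assoc]
  exact (congrArg (fun z => Ext.comp _ z (zero_add i)) h1).trans (Ext.comp_zero _ _ _ _ _)

theorem finite_ext (hfin : Module.Finite k (𝒜 0)) {N : ModuleCat.{u} A} (hN : IsLin 𝒜 N) (i : ℕ) :
    Module.Finite k (Ext N (degreeZero 𝒜).toModuleCat i) := by
  obtain ⟨M, hM, ⟨e⟩⟩ := hN
  have := finite_ext_degreeZero hfin i hM
  let φ : Ext M.toModuleCat (degreeZero 𝒜).toModuleCat i →ₗ[k]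
      Ext N (degreeZero 𝒜).toModuleCat i :=
    { toFun := fun x => (Ext.mk₀ (ModuleCat.ofHom e.symm.toLinearMap)).comp x (zero_add i)
      map_add' := fun x y => Ext.comp_add _ _ _ _
      map_smul' := fun c x => Ext.comp_smul _ _ _ _ }
  refine Module.Finite.of_surjective φ fun x =>
    ⟨(Ext.mk₀ (ModuleCat.ofHom e.toLinearMap)).comp x (zero_add i), ?_⟩
  change (Ext.mk₀ _).comp ((Ext.mk₀ _).comp x (zero_add i)) (zero_add i) = x
  rw [Ext.mk₀_comp_mk₀_assoc]
  have : ModuleCat.ofHom e.symm.toLinearMap ≫ ModuleCat.ofHom e.toLinearMap = 𝟙 N := by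
    ext y; exact e.apply_symm_apply y
  exact (congrArg (fun z => (Ext.mk₀ z).comp x (zero_add i)) this).trans (Ext.mk₀_id_comp x)

end IsLin

theorem isKoszul_regular (hlf : ∀ i, Module.Finite k (𝒜 i)) : (regular 𝒜).IsKoszul := by
  -- `Z` is a zero module, serving as the syzygy both of `A` and of itself.
  let Z : GrMod 𝒜 := (regular 𝒜).pow 0
  have hlf' : (regular 𝒜).LocallyFinite := fun n => by
    obtain hn | hn := lt_or_ge n 0
    · have : (regular 𝒜).gr n = ⊥ :=
        if_neg (c := 0 ≤ n) (t := 𝒜 n.toNat) (e := (⊥ : Submodule k A)) (by omega)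
      rw [this]; infer_instance
    · have : (regular 𝒜).gr n = 𝒜 n.toNat :=
        if_pos (c := 0 ≤ n) (t := 𝒜 n.toNat) (e := (⊥ : Submodule k A)) hn
      rw [this]; exact hlf _
  have hsub : Subsingleton Z.carrier := inferInstanceAs (Subsingleton (Fin 0 → _))
  have hc : ∀ M : GrMod 𝒜, M.LocallyFinite → Module.Projective A M.carrier → M.GeneratedIn 0 →
      IsSyzygy M Z := fun M h1 h2 h3 => by
    refine ⟨M, LinearMap.id, 0, ⟨h1, h2, h3, isDeg_id M, Function.surjective_id⟩,
      fun _ _ _ _ _ => zero_mem _, Function.injective_of_subsingleton _, fun x => ?_⟩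
    exact ⟨fun h => ⟨0, h.symm⟩, fun ⟨_, h⟩ => h.symm⟩
  have hZ := hlf'.pow 0
  have hZ' := (regular_generatedIn 𝒜).pow 0
  refine isKoszul_of_forall_syzygy (fun M => M = regular 𝒜 ∨ M = Z) ?_ ?_ ?_ (Or.inl rfl)
  · rintro _ (rfl | rfl)
    exacts [hlf', hZ]
  · rintro _ (rfl | rfl)
    exacts [regular_generatedIn 𝒜, hZ']
  · rintro _ (rfl | rfl)
    · exact ⟨Z, Or.inr rfl, hc _ hlf' inferInstance (regular_generatedIn 𝒜)⟩
    · exact ⟨Z, Or.inr rfl, hc _ hZ inferInstance hZ'⟩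

end Linear

/-! ### Components of `Ext^*(M, X)` and the connecting homomorphism over the Yoneda algebra. -/

section YonedaComponents

variable {A : Type u} [Ring A] (X : ModuleCat.{u} A)

/-- The component of degree `i` of an element of `Ext^*(M, X)`. -/
def YonedaMod.coeff {X M : ModuleCat.{u} A} (i : ℕ) : YonedaMod X M →+ Ext M X i :=
  DFinsupp.evalAddMonoidHom (β := fun i : ℕ => Ext M X i) i

namespace YonedaMod

variable {X}

theorem coeff_of_same {M : ModuleCat.{u} A} (i : ℕ) (x : Ext M X i) :
    coeff i (of X M i x) = x :=
  DirectSum.of_eq_same (β := fun i : ℕ => Ext M X i) i x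

theorem coeff_of_ne {M : ModuleCat.{u} A} {i j : ℕ} (h : i ≠ j) (x : Ext M X i) :
    coeff j (of X M i x) = 0 :=
  DirectSum.of_eq_of_ne (β := fun i : ℕ => Ext M X i) i j x h.symm

theorem ext_coeff {M : ModuleCat.{u} A} {x y : YonedaMod X M} (h : ∀ i, coeff i x = coeff i y) :
    x = y := DFinsupp.ext h

theorem of_injective (M : ModuleCat.{u} A) (i : ℕ) : Function.Injective (of X M i) :=
  DirectSum.of_injective (β := fun i : ℕ => Ext M X i) i

theorem mem_of_forall_coeff {M : ModuleCat.{u} A} (x : YonedaMod X M)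
    (p : AddSubmonoid (YonedaMod X M)) (h : ∀ i, of X M i (coeff i x) ∈ p) : x ∈ p := by
  classical
  have : x = ∑ i ∈ DFinsupp.support (show ⨁ i : ℕ, Ext M X i from x), of X M i (coeff i x) :=
    (DirectSum.sum_support_of (show ⨁ i : ℕ, Ext M X i from x)).symm
  rw [this]
  exact sum_mem fun i _ => h i

end YonedaMod

theorem coeff_yonedaModMap {M N : ModuleCat.{u} A} (f : M ⟶ N) (x : YonedaMod X N) (i : ℕ) :
    YonedaMod.coeff i (yonedaModMap X f x) =
      (Ext.mk₀ f).comp (YonedaMod.coeff i x) (zero_add i) := yonedaModMap_apply X f x i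

theorem yonedaModMap_of {M N : ModuleCat.{u} A} (f : M ⟶ N) (i : ℕ) (x : Ext N X i) :
    yonedaModMap X f (YonedaMod.of X N i x) =
      YonedaMod.of X M i ((Ext.mk₀ f).comp x (zero_add i)) := yonedaModMapAdd_of X f i x

theorem yonedaModMap_sum {M N : ModuleCat.{u} A} {r : ℕ} (f : Fin r → (M ⟶ N)) :
    yonedaModMap X (∑ j, f j) = ∑ j, yonedaModMap X (f j) := by
  refine LinearMap.ext fun x => YonedaMod.ext_coeff fun i => ?_
  rw [coeff_yonedaModMap, Ext.mk₀_sum, Ext.sum_comp, LinearMap.sum_apply, map_sum]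
  simp only [coeff_yonedaModMap]

/-- The regular module over the Yoneda algebra is `Ext^*(X, X)`. -/
def yonedaSelf : YonedaAlg X ≃ₗ[YonedaAlg X] YonedaMod X X where
  toFun x := x
  invFun x := x
  left_inv _ := rfl
  right_inv _ := rfl
  map_add' _ _ := rfl
  map_smul' a b := by
    induction a using YonedaAlg.induction with
    | h0 => rw [zero_smul]; exact (zero_smul (YonedaAlg X) (b : YonedaMod X X)).symm
    | h2 x y hx hy =>
      rw [RingHom.id_apply] at hx hy ⊢
      refine (add_smul x y b).trans (Eq.trans ?_ (add_smul x y (b : YonedaMod X X)).symm)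
      exact congrArg₂ (fun p q : YonedaMod X X => p + q) hx hy
    | h1 i x =>
      induction b using YonedaAlg.induction with
      | h0 => rw [smul_zero]; exact (smul_zero (YonedaAlg.of X i x) (A := YonedaMod X X)).symm
      | h2 y z hy hz =>
        refine (smul_add (YonedaAlg.of X i x) y z).trans (Eq.trans ?_
          (smul_add (YonedaAlg.of X i x) (y : YonedaMod X X) z).symm)
        exact congrArg₂ (fun p q : YonedaMod X X => p + q) hy hz
      | h1 j y =>
        exact (YonedaAlg.of_mul_of X x y).trans (YonedaMod.of_smul_of X X x y).symm

theorem yonedaSelf_of (i : ℕ) (x : Ext X X i) :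
    yonedaSelf X (YonedaAlg.of X i x) = YonedaMod.of X X i x := rfl

/-- The class of the identity in `Ext^*(X, X)`. -/
abbrev yonedaOne : YonedaMod X X := YonedaMod.of X X 0 (Ext.mk₀ (𝟙 X))

theorem smul_yonedaOne (a : YonedaAlg X) : a • yonedaOne X = yonedaSelf X a := by
  have h : yonedaSelf X 1 = yonedaOne X := rfl
  rw [← h, ← map_smul, smul_eq_mul, mul_one]

section Connecting

variable {S : ShortComplex (ModuleCat.{u} A)} (hS : S.ShortExact)

/-- Auxiliary additive version of the following definition. -/
def yonedaDeltaAdd : YonedaMod X S.X₁ →+ YonedaMod X S.X₃ :=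
  DirectSum.toAddMonoid (β := fun i : ℕ => Ext S.X₁ X i) fun i =>
    (YonedaMod.of X S.X₃ (i + 1)).comp (hS.extClass.precomp X (add_comm 1 i))

theorem yonedaDeltaAdd_of (i : ℕ) (x : Ext S.X₁ X i) :
    yonedaDeltaAdd X hS (YonedaMod.of X S.X₁ i x) =
      YonedaMod.of X S.X₃ (i + 1) (hS.extClass.comp x (add_comm 1 i)) :=
  DirectSum.toAddMonoid_of _ _ _

/-- The connecting homomorphism `Ext^*(S.X₁, X) → Ext^{*+1}(S.X₃, X)`, linear over the Yoneda
algebra. -/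
def yonedaDelta : YonedaMod X S.X₁ →ₗ[YonedaAlg X] YonedaMod X S.X₃ where
  toFun := yonedaDeltaAdd X hS
  map_add' := map_add _
  map_smul' a m := by
    rw [RingHom.id_apply]
    induction a using YonedaAlg.induction with
    | h0 => rw [zero_smul, zero_smul, map_zero]
    | h2 a b ha hb => rw [add_smul, add_smul, map_add, ha, hb]
    | h1 i a =>
      induction m using YonedaMod.induction with
      | h0 => rw [smul_zero, map_zero, smul_zero]
      | h2 m n hm hn => rw [smul_add, map_add, map_add, hm, hn, smul_add]
      | h1 j m =>
        rw [YonedaMod.of_smul_of, yonedaDeltaAdd_of, yonedaDeltaAdd_of, YonedaMod.of_smul_of,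
          ← Ext.comp_assoc hS.extClass m a (add_comm 1 j) (add_comm j i) (by omega)]
        rfl

theorem yonedaDelta_of (i : ℕ) (x : Ext S.X₁ X i) :
    yonedaDelta X hS (YonedaMod.of X S.X₁ i x) =
      YonedaMod.of X S.X₃ (i + 1) (hS.extClass.comp x (add_comm 1 i)) :=
  yonedaDeltaAdd_of X hS i x

theorem coeff_yonedaDelta_succ (x : YonedaMod X S.X₁) (i : ℕ) :
    YonedaMod.coeff (i + 1) (yonedaDelta X hS x) =
      hS.extClass.comp (YonedaMod.coeff i x) (add_comm 1 i) := by
  induction x using YonedaMod.induction with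
  | h0 => rw [map_zero, map_zero, map_zero, Ext.comp_zero]
  | h2 x y hx hy => rw [map_add, map_add, map_add, hx, hy, Ext.comp_add]
  | h1 j x =>
    rw [yonedaDelta_of]
    obtain rfl | h := eq_or_ne j i
    · rw [YonedaMod.coeff_of_same, YonedaMod.coeff_of_same]
    · rw [YonedaMod.coeff_of_ne h, YonedaMod.coeff_of_ne (by omega), Ext.comp_zero]

variable (h0 : ∀ (i : ℕ) (x : Ext S.X₂ X i), (Ext.mk₀ S.f).comp x (zero_add i) = 0)

-- When restriction to `S.X₁` vanishes on Ext, the long exact sequence breaks up: the connecting map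
-- becomes injective and restriction along `S.g` surjective.
include h0 in
theorem yonedaDelta_injective : Function.Injective (yonedaDelta X hS) := by
  rw [injective_iff_map_eq_zero]
  refine fun x hx => YonedaMod.ext_coeff fun i => ?_
  have h1 := coeff_yonedaDelta_succ X hS x i
  rw [hx, map_zero] at h1
  obtain ⟨y, hy⟩ := Ext.contravariant_sequence_exact₁ hS X _ _ h1.symm
  rw [← hy, h0, map_zero]

include hS h0 in
theorem yonedaModMap_surjective : Function.Surjective (yonedaModMap X S.g) := fun x => by
  induction x using YonedaMod.induction with
  | h0 => exact ⟨0, map_zero _⟩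
  | h2 x y hx hy =>
    obtain ⟨x, rfl⟩ := hx
    obtain ⟨y, rfl⟩ := hy
    exact ⟨x + y, map_add _ _ _⟩
  | h1 i x =>
    obtain ⟨y, hy⟩ := Ext.contravariant_sequence_exact₂ hS X x (h0 i x)
    exact ⟨YonedaMod.of X _ i y, by rw [yonedaModMap_of, hy]⟩

theorem yonedaDelta_exact : Function.Exact (yonedaDelta X hS) (yonedaModMap X S.g) := by
  intro y
  constructor
  · intro hy
    have hy' : ∀ i, (Ext.mk₀ S.g).comp (YonedaMod.coeff i y) (zero_add i) = 0 := fun i => by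
      rw [← coeff_yonedaModMap, hy, map_zero]
    refine YonedaMod.mem_of_forall_coeff y
      (LinearMap.range (yonedaDelta X hS)).toAddSubmonoid fun i => ?_
    cases i with
    -- The connecting map has no component in degree 0, so exactness there amounts to injectivity of
    -- precomposition with the epimorphism `S.g`.
    | zero =>
      have := hS.epi_g
      have h1 : YonedaMod.coeff 0 y = 0 := Ext.precomp_mk₀_injective_of_epi X S.g
        ((hy' 0).trans (Ext.comp_zero (Ext.mk₀ S.g) X 0 0 (zero_add 0)).symm)
      rw [h1, map_zero]
      exact zero_mem _
    | succ i =>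
      obtain ⟨x, hx⟩ := Ext.contravariant_sequence_exact₃ hS X _ (hy' (i + 1)) (add_comm 1 i)
      exact ⟨YonedaMod.of X _ i x, by rw [yonedaDelta_of, hx]⟩
  · rintro ⟨x, rfl⟩
    induction x using YonedaMod.induction with
    | h0 => rw [map_zero, map_zero]
    | h2 x y hx hy => rw [map_add, map_add, hx, hy, add_zero]
    | h1 i x =>
      rw [yonedaDelta_of, yonedaModMap_of, hS.comp_extClass_assoc, map_zero]

theorem yonedaDelta_naturality {S' : ShortComplex (ModuleCat.{u} A)} (hS' : S'.ShortExact)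
    (φ : S' ⟶ S) (x : YonedaMod X S.X₁) :
    yonedaDelta X hS' (yonedaModMap X φ.τ₁ x) = yonedaModMap X φ.τ₃ (yonedaDelta X hS x) := by
  induction x using YonedaMod.induction with
  | h0 => simp only [map_zero]
  | h2 x y hx hy => simp only [map_add, hx, hy]
  | h1 i x =>
    rw [yonedaModMap_of, yonedaDelta_of, yonedaDelta_of, yonedaModMap_of,
      ← Ext.comp_assoc _ _ _ (zero_add 1) (add_comm 1 i) (by omega),
      ← ShortComplex.ShortExact.extClass_naturality hS' hS φ,
      Ext.comp_assoc _ _ _ (add_zero 1) (zero_add i) (by omega)]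

end Connecting

end YonedaComponents

/-! ### `Ext^*(N, X)` as a graded module; summands of powers of `X` give projectives. -/

section YonedaGraded

variable {k : Type v} [Field k] {A : Type u} [Ring A] [Algebra k A] (X : ModuleCat.{u} A)

open GrMod

variable (k) in
/-- `Ext^*(N, X)` as a graded module over the Yoneda algebra of `X`. -/
def yonedaGrMod (N : ModuleCat.{u} A) : GrMod (yonedaGr k X) where
  carrier := YonedaMod X N
  gr := yonedaModGr k X N
  isInternal := yonedaModGr_isInternal X N
  smul_mem := fun ha hm => yonedaModGr_smul_mem X N ha hm

theorem of_mem_yonedaModGr {N : ModuleCat.{u} A} {i : ℕ} {n : ℤ} (h : (i : ℤ) = n)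
    (x : Ext N X i) : YonedaMod.of X N i x ∈ yonedaModGr k X N n :=
  h ▸ of_mem_pieces (k := k) (X := fun i : ℕ => Ext N X i) (fun i : ℕ => (i : ℤ)) i x

theorem mem_yonedaModGr_iff {N : ModuleCat.{u} A} {n : ℤ} {x : YonedaMod X N} :
    x ∈ yonedaModGr k X N n ↔ ∀ i : ℕ, (i : ℤ) ≠ n → YonedaMod.coeff i x = 0 := Iff.rfl

theorem exists_of_mem_yonedaModGr {N : ModuleCat.{u} A} {i : ℕ} {x : YonedaMod X N}
    (hx : x ∈ yonedaModGr k X N i) : ∃ y, YonedaMod.of X N i y = x := by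
  refine ⟨YonedaMod.coeff i x, YonedaMod.ext_coeff fun j => ?_⟩
  obtain rfl | h := eq_or_ne i j
  · rw [YonedaMod.coeff_of_same]
  · rw [YonedaMod.coeff_of_ne h, (mem_yonedaModGr_iff X).1 hx j (by omega)]

theorem isDeg_yonedaModMap {N N' : ModuleCat.{u} A} (f : N ⟶ N') :
    IsDeg (yonedaGrMod k X N') (yonedaGrMod k X N) 0 (yonedaModMap X f) := fun n l h m hm => by
  obtain rfl : n = l := by omega
  exact yonedaModMap_mem X f n m hm

theorem isDeg_yonedaDelta {S : ShortComplex (ModuleCat.{u} A)} (hS : S.ShortExact) :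
    IsDeg (yonedaGrMod k X S.X₁) (yonedaGrMod k X S.X₃) 1 (yonedaDelta X hS) :=
  fun n l h m hm => by
    change yonedaDelta X hS m ∈ yonedaModGr k X S.X₃ l
    refine pieces_induction (p := fun m => yonedaDelta X hS m ∈ yonedaModGr k X S.X₃ l)
      Nat.cast_injective ?_ (fun i x hi => ?_) hm
    · exact (map_zero (yonedaDelta X hS)).symm ▸ zero_mem _
    · change yonedaDelta X hS (YonedaMod.of X S.X₁ i x) ∈ _
      rw [yonedaDelta_of]
      exact of_mem_yonedaModGr X (by push_cast; omega) _

theorem yonedaGrMod_locallyFinite {N : ModuleCat.{u} A}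
    (h : ∀ i, Module.Finite k (Ext N X i)) : (yonedaGrMod k X N).LocallyFinite := fun n => by
  change Module.Finite k (yonedaModGr k X N n)
  obtain hn | hn := lt_or_ge n 0
  · have : yonedaModGr k X N n = ⊥ := eq_bot_iff.2 fun x hx =>
      YonedaMod.ext_coeff fun i => ((mem_yonedaModGr_iff X).1 hx i (by omega)).trans
        (map_zero _).symm
    rw [this]; infer_instance
  · obtain ⟨i, rfl⟩ := Int.eq_ofNat_of_zero_le hn
    have := h i
    let φ : Ext N X i →ₗ[k] yonedaModGr k X N i :=
      { toFun := fun x => ⟨YonedaMod.of X N i x, of_mem_yonedaModGr X rfl x⟩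
        map_add' := fun x y => Subtype.ext (map_add _ _ _)
        map_smul' := fun c x => Subtype.ext (YonedaMod.smul_of X N c x).symm }
    exact Module.Finite.of_surjective φ fun x =>
      (exists_of_mem_yonedaModGr X x.2).imp fun y hy => Subtype.ext hy

theorem yonedaGrMod_self_generatedIn : (yonedaGrMod k X X).GeneratedIn 0 := by
  refine top_unique fun (x : YonedaMod X X) _ => ?_
  have h := smul_yonedaOne X ((yonedaSelf X).symm x)
  rw [LinearEquiv.apply_symm_apply] at h
  rw [← h]
  exact Submodule.smul_mem _ _ (Submodule.subset_span (of_mem_yonedaModGr X rfl _))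

instance yonedaMod_self_projective : Module.Projective (YonedaAlg X) (YonedaMod X X) :=
  Module.Projective.of_equiv (yonedaSelf X)

/-- An additive functor preserves summands of powers. As `Ext^*(X, X)` is free of rank one, this is
the source of the projective modules in the resolution of `E(M)`. -/
theorem sum_yonedaModMap_of_retract {Y : ModuleCat.{u} A} {r : ℕ} {p : Fin r → Y →ₗ[A] X}
    {q : Fin r → X →ₗ[A] Y} (h : ∀ y, ∑ j, q j (p j y) = y) (y : YonedaMod X Y) :
    ∑ j, yonedaModMap X (ModuleCat.ofHom (p j)) (yonedaModMap X (ModuleCat.ofHom (q j)) y) =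
      y := by
  have h1 : ∑ j, ModuleCat.ofHom (p j) ≫ ModuleCat.ofHom (q j) = 𝟙 Y := by
    ext y
    rw [ModuleCat.hom_sum, LinearMap.sum_apply]
    exact h y
  have h2 := yonedaModMap_sum X fun j => ModuleCat.ofHom (p j) ≫ ModuleCat.ofHom (q j)
  rw [h1, yonedaModMap_id] at h2
  have h3 := LinearMap.congr_fun h2 y
  rw [LinearMap.sum_apply] at h3
  refine Eq.trans (Finset.sum_congr rfl fun j _ => ?_) h3.symm
  rw [yonedaModMap_comp, LinearMap.comp_apply]

theorem yonedaGrMod_generatedIn_of_retract {Y : ModuleCat.{u} A} (h : IsRetractOfPow A X Y) :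
    (yonedaGrMod k X Y).GeneratedIn 0 := by
  obtain ⟨r, p, q, hpq⟩ := h
  refine top_unique fun (y : YonedaMod X Y) _ => ?_
  rw [← sum_yonedaModMap_of_retract X hpq y]
  refine sum_mem fun j _ => ?_
  have h1 : (⊤ : Submodule (YonedaAlg X) (YonedaMod X X)) ≤
      (Submodule.span (YonedaAlg X)
        ((yonedaGrMod k X Y).gr 0 : Set (yonedaGrMod k X Y).carrier)).comap
        (yonedaModMap X (ModuleCat.ofHom (p j))) := by
    refine (yonedaGrMod_self_generatedIn (k := k) X).ge.trans
      (Submodule.span_le.2 fun x hx => Submodule.subset_span ?_)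
    exact isDeg_yonedaModMap (k := k) X (ModuleCat.ofHom (p j)) 0 0 rfl x hx
  exact h1 (Submodule.mem_top (x := yonedaModMap X (ModuleCat.ofHom (q j)) y))

theorem yonedaMod_projective_of_retract {Y : ModuleCat.{u} A} (h : IsRetractOfPow A X Y) :
    Module.Projective (YonedaAlg X) (YonedaMod X Y) := by
  obtain ⟨r, p, q, hpq⟩ := h
  have : Module.Projective (YonedaAlg X) (Fin r → YonedaMod X X) :=
    Module.Projective.of_equiv (DirectSum.linearEquivFunOnFintype (YonedaAlg X) (Fin r)
      (fun _ => YonedaMod X X))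
  refine Module.Projective.of_split
    (LinearMap.pi fun j => yonedaModMap X (ModuleCat.ofHom (q j)))
    (∑ j, yonedaModMap X (ModuleCat.ofHom (p j)) ∘ₗ LinearMap.proj j) ?_
  refine LinearMap.ext fun y => Eq.trans ?_ (sum_yonedaModMap_of_retract X hpq y)
  rw [LinearMap.comp_apply, LinearMap.sum_apply]
  rfl

end YonedaGraded

/-! ### `E` preserves Koszul modules. -/

section PreservesKoszul

variable {k : Type v} [Field k] {A : Type u} [Ring A] [Algebra k A] {𝒜 : ℕ → Submodule k A}
  [GradedAlgebra 𝒜]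

open GrMod

/-- The short complex `A_{≥ 1} N → N → N / A_{≥ 1} N`. -/
abbrev radComplex (𝒜 : ℕ → Submodule k A) (N : ModuleCat.{u} A) : ShortComplex (ModuleCat.{u} A) :=
  ShortComplex.mk (X₁ := radObj 𝒜 N) (X₂ := N) (X₃ := topObj 𝒜 N)
    (ModuleCat.ofHom (rad 𝒜 N).subtype) (ModuleCat.ofHom (rad 𝒜 N).mkQ) (by
      ext x; exact (Submodule.Quotient.mk_eq_zero _).2 x.2)

theorem radComplex_shortExact (𝒜 : ℕ → Submodule k A) (N : ModuleCat.{u} A) :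
    (radComplex 𝒜 N).ShortExact :=
  ModuleCat.shortComplex_shortExact _
    (fun x => ⟨fun h => ⟨⟨x, (Submodule.Quotient.mk_eq_zero _).1 h⟩, rfl⟩, fun ⟨y, hy⟩ =>
      hy ▸ (Submodule.Quotient.mk_eq_zero _).2 y.2⟩)
    Subtype.val_injective (Submodule.mkQ_surjective _)

/-- The property that `Ext^*(N, A_0) → Ext^*(A_{≥ 1} N, A_0)` vanishes. -/
def IsRadAcyclic (𝒜 : ℕ → Submodule k A) [GradedAlgebra 𝒜] (N : ModuleCat.{u} A) : Prop :=
  ∀ (i : ℕ) (x : Ext (radComplex 𝒜 N).X₂ (degreeZero 𝒜).toModuleCat i),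
    (Ext.mk₀ (radComplex 𝒜 N).f).comp x (zero_add i) = 0

theorem IsLin.isRadAcyclic (hinj : Module.Injective (𝒜 0) (𝒜 0))
    (hA : (degreeZero 𝒜).IsKoszul) {N : ModuleCat.{u} A} (hN : IsLin 𝒜 N) : IsRadAcyclic 𝒜 N :=
  fun _ x => hN.mk₀_radSubtype_comp hinj hA x

/-- `E(N / rad N) → E(N)` is a cover with kernel `E(rad N)` up to shift, and `rad N` again underlies
a Koszul module, so the modules `E(N)` form a coinductive class. -/
theorem IsLin.isKoszul_yonedaGrMod (hfin : Module.Finite k (𝒜 0))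
    (hinj : Module.Injective (𝒜 0) (𝒜 0)) (hA : (degreeZero 𝒜).IsKoszul) {N : ModuleCat.{u} A}
    (hN : IsLin 𝒜 N) : (yonedaGrMod k (degreeZero 𝒜).toModuleCat N).IsKoszul := by
  let X := (degreeZero 𝒜).toModuleCat
  have hlf : ∀ N, IsLin 𝒜 N → (yonedaGrMod k X N).LocallyFinite := fun N hN =>
    yonedaGrMod_locallyFinite X (hN.finite_ext hfin)
  have hsurj : ∀ N, IsLin 𝒜 N →
      Function.Surjective (yonedaModMap X (radComplex 𝒜 N).g) := fun N hN =>
    yonedaModMap_surjective X (radComplex_shortExact 𝒜 N) (hN.isRadAcyclic hinj hA)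
  refine isKoszul_of_forall_syzygy (fun M => ∃ N, IsLin 𝒜 N ∧ M = yonedaGrMod k X N)
    ?_ ?_ ?_ ⟨N, hN, rfl⟩
  · rintro _ ⟨N, hN, rfl⟩
    exact hlf N hN
  · rintro _ ⟨N, hN, rfl⟩
    exact (yonedaGrMod_generatedIn_of_retract X hN.isRetractOfPow).of_surjective
      (isDeg_yonedaModMap X (radComplex 𝒜 N).g) (hsurj N hN) (add_zero 0)
  · rintro _ ⟨N, hN, rfl⟩
    -- `Ext^i(N / rad N, A_0)` is a quotient of `Ext^i(A_0, A_0)^r`, because `N / rad N` is a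
    -- summand of `A_0^r`.
    have htop : (yonedaGrMod k X (topObj 𝒜 N)).LocallyFinite := by
      refine yonedaGrMod_locallyFinite X fun i => ?_
      obtain ⟨r, p, q, hpq⟩ := hN.isRetractOfPow
      have := hA.isLin.finite_ext hfin i
      let φ : (Fin r → Ext X X i) →ₗ[k] Ext (topObj 𝒜 N) X i :=
        { toFun := fun x => ∑ j, (Ext.mk₀ (ModuleCat.ofHom (p j))).comp (x j) (zero_add i)
          map_add' := fun x y => by
            rw [← Finset.sum_add_distrib]
            exact Finset.sum_congr rfl fun j _ => Ext.comp_add _ _ _ _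
          map_smul' := fun c x => by
            rw [Finset.smul_sum]
            exact Finset.sum_congr rfl fun j _ => Ext.comp_smul _ _ _ _ }
      refine Module.Finite.of_surjective φ fun y =>
        ⟨fun j => (Ext.mk₀ (ModuleCat.ofHom (q j))).comp y (zero_add i), ?_⟩
      have h1 := congrArg (YonedaMod.coeff i)
        (sum_yonedaModMap_of_retract X hpq (YonedaMod.of X _ i y))
      simp only [map_sum, coeff_yonedaModMap, YonedaMod.coeff_of_same] at h1
      exact h1
    exact ⟨_, ⟨radObj 𝒜 N, hN.rad hinj hA, rfl⟩, yonedaGrMod k X (topObj 𝒜 N),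
      yonedaModMap X (radComplex 𝒜 N).g, yonedaDelta X (radComplex_shortExact 𝒜 N),
      ⟨htop, yonedaMod_projective_of_retract X hN.isRetractOfPow,
        yonedaGrMod_generatedIn_of_retract X hN.isRetractOfPow, isDeg_yonedaModMap X _,
        hsurj N hN⟩, isDeg_yonedaDelta (k := k) X (radComplex_shortExact 𝒜 N),
      yonedaDelta_injective X _ (hN.isRadAcyclic hinj hA), yonedaDelta_exact X _⟩

end PreservesKoszul

theorem coeff_yonedaDelta_zero {A : Type u} [Ring A] (X : ModuleCat.{u} A)
    {S : ShortComplex (ModuleCat.{u} A)} (hS : S.ShortExact) (x : YonedaMod X S.X₁) :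
    YonedaMod.coeff 0 (yonedaDelta X hS x) = 0 := by
  induction x using YonedaMod.induction with
  | h0 => rw [map_zero, map_zero]
  | h2 x y hx hy => rw [map_add, map_add, hx, hy, add_zero]
  | h1 j x => rw [yonedaDelta_of, YonedaMod.coeff_of_ne (Nat.succ_ne_zero j)]

/-! ### Elements of `N` as homomorphisms from `E(N)` to `E(A)`. -/

section ExtDualModules

variable {k : Type v} [Field k] {A : Type u} [Ring A] [Algebra k A] (𝒜 : ℕ → Submodule k A)
  [GradedAlgebra 𝒜]

open GrMod

/-- `Ext^*(N, A_0)` as an object of the category of modules over the Ext algebra. -/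
abbrev extDualMod (N : ModuleCat.{u} A) : ModuleCat.{u} (ExtAlg 𝒜) :=
  ModuleCat.of (ExtAlg 𝒜) (YonedaMod (degreeZero 𝒜).toModuleCat N)

/-- The map `Ext^*(N', A_0) → Ext^*(N, A_0)` induced by `f : N → N'`. -/
abbrev extDualHom {N N' : ModuleCat.{u} A} (f : N ⟶ N') : extDualMod 𝒜 N' ⟶ extDualMod 𝒜 N :=
  ModuleCat.ofHom (yonedaModMap (degreeZero 𝒜).toModuleCat f)

theorem extDualHom_comp {N N' N'' : ModuleCat.{u} A} (f : N ⟶ N') (g : N' ⟶ N'') :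
    extDualHom 𝒜 (f ≫ g) = extDualHom 𝒜 g ≫ extDualHom 𝒜 f :=
  ModuleCat.hom_ext (yonedaModMap_comp _ f g)

theorem extDualHom_add {N N' : ModuleCat.{u} A} (f g : N ⟶ N') :
    extDualHom 𝒜 (f + g) = extDualHom 𝒜 f + extDualHom 𝒜 g := by
  refine ModuleCat.hom_ext (LinearMap.ext fun x => YonedaMod.ext_coeff fun i => ?_)
  refine (coeff_yonedaModMap _ _ x i).trans (Eq.trans ?_ (map_add (YonedaMod.coeff i)
    (yonedaModMap _ f x) (yonedaModMap _ g x)).symm)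
  rw [coeff_yonedaModMap, coeff_yonedaModMap, Ext.mk₀_add, Ext.add_comp]

/-- The map `Ext^*(N, A_0) → Ext^*(A, A_0)` induced by the map `A → N` sending `1` to `x`. -/
abbrev dualElement (N : ModuleCat.{u} A) (x : N) :
    extDualMod 𝒜 N ⟶ extDualMod 𝒜 (regular 𝒜).toModuleCat :=
  extDualHom 𝒜 (ModuleCat.ofHom (ofElement 𝒜 x))

theorem dualElement_map {N N' : ModuleCat.{u} A} (f : N ⟶ N') (x : N) :
    dualElement 𝒜 N' (f.hom x) = extDualHom 𝒜 f ≫ dualElement 𝒜 N x := by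
  have h : ModuleCat.ofHom (ofElement 𝒜 (f.hom x)) = ModuleCat.ofHom (ofElement 𝒜 x) ≫ f :=
    ModuleCat.hom_ext (regular_hom_ext 𝒜 ((ofElement_one 𝒜 (f.hom x)).trans
      (congrArg f.hom (ofElement_one 𝒜 x)).symm))
  exact (congrArg (extDualHom 𝒜) h).trans (extDualHom_comp 𝒜 _ f)

theorem dualElement_add {N : ModuleCat.{u} A} (x y : N) :
    dualElement 𝒜 N (x + y) = dualElement 𝒜 N x + dualElement 𝒜 N y := by
  have h : ModuleCat.ofHom (ofElement 𝒜 (x + y)) =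
      ModuleCat.ofHom (ofElement 𝒜 x) + ModuleCat.ofHom (ofElement 𝒜 y) :=
    ModuleCat.hom_ext (regular_hom_ext 𝒜 ((ofElement_one 𝒜 (x + y)).trans
      (congrArg₂ (· + ·) (ofElement_one 𝒜 x) (ofElement_one 𝒜 y)).symm))
  exact (congrArg (extDualHom 𝒜) h).trans (extDualHom_add 𝒜 _ _)

theorem dualElement_sum {N : ModuleCat.{u} A} {r : ℕ} (x : Fin r → N) :
    dualElement 𝒜 N (∑ j, x j) = ∑ j, dualElement 𝒜 N (x j) :=
  map_sum (AddMonoidHom.mk' (dualElement 𝒜 N) (dualElement_add 𝒜)) x Finset.univ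

/-- The elements of `Ext^*(A, A_0)` are concentrated in degree `0`. -/
theorem coeff_regular_succ (i : ℕ)
    (y : YonedaMod (degreeZero 𝒜).toModuleCat (regular 𝒜).toModuleCat) :
    YonedaMod.coeff (i + 1) y = 0 := by
  have := subsingleton_ext_of_projective (P := (regular 𝒜).carrier) (degreeZero 𝒜).toModuleCat i
  exact Subsingleton.elim _ _

theorem exists_of_ofElement (y : YonedaMod (degreeZero 𝒜).toModuleCat (regular 𝒜).toModuleCat) :
    ∃ x : (degreeZero 𝒜).carrier,
      YonedaMod.of _ _ 0 (Ext.mk₀ (ModuleCat.ofHom (ofElement 𝒜 x))) = y := by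
  obtain ⟨g, hg⟩ := (Ext.mk₀_bijective _ _).2 (YonedaMod.coeff 0 y)
  refine ⟨g.hom (regularOne 𝒜), YonedaMod.ext_coeff fun i => ?_⟩
  cases i with
  | zero =>
    rw [YonedaMod.coeff_of_same, ← hg]
    congr 1
    exact ModuleCat.hom_ext (regular_hom_ext 𝒜 (ofElement_one 𝒜 _))
  | succ i => rw [coeff_regular_succ, coeff_regular_succ]

theorem dualElement_degreeZero_apply_one (x : (degreeZero 𝒜).carrier) :
    (dualElement 𝒜 (degreeZero 𝒜).toModuleCat x).hom (yonedaOne (degreeZero 𝒜).toModuleCat) =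
      YonedaMod.of _ _ 0 (Ext.mk₀ (ModuleCat.ofHom (ofElement 𝒜 x))) := by
  rw [ModuleCat.hom_ofHom, yonedaModMap_of, Ext.comp_mk₀_id]

/-- `E(A_0) = Γ` is free on the class of the identity, so maps from it to `E(A)` are elements of
`E(A) = Hom(A, A_0) = A_0`. -/
theorem dualElement_degreeZero_bijective :
    Function.Bijective (dualElement 𝒜 (degreeZero 𝒜).toModuleCat) := by
  constructor
  · intro x y h
    have h1 := congrArg
      (fun φ : extDualMod 𝒜 (degreeZero 𝒜).toModuleCat ⟶ extDualMod 𝒜 (regular 𝒜).toModuleCat =>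
        φ.hom (yonedaOne (degreeZero 𝒜).toModuleCat)) h
    have h1 := (dualElement_degreeZero_apply_one 𝒜 x).symm.trans
      (h1.trans (dualElement_degreeZero_apply_one 𝒜 y))
    have h2 := (Ext.mk₀_bijective _ _).1 (YonedaMod.of_injective _ 0 h1)
    have h3 := congrArg (fun g : (regular 𝒜).toModuleCat ⟶ (degreeZero 𝒜).toModuleCat =>
      g.hom (regularOne 𝒜)) h2
    exact (ofElement_one 𝒜 x).symm.trans (h3.trans (ofElement_one 𝒜 y))
  · intro φ
    obtain ⟨x, hx⟩ := exists_of_ofElement 𝒜 (φ.hom (yonedaOne (degreeZero 𝒜).toModuleCat))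
    refine ⟨x, ModuleCat.hom_ext (LinearMap.ext fun y => ?_)⟩
    have h1 := smul_yonedaOne (degreeZero 𝒜).toModuleCat ((yonedaSelf _).symm y)
    rw [LinearEquiv.apply_symm_apply] at h1
    rw [← h1, map_smul, map_smul, ← hx, dualElement_degreeZero_apply_one]

theorem dualElement_bijective_of_retract {N : ModuleCat.{u} A}
    (h : IsRetractOfPow A (degreeZero 𝒜).toModuleCat N) :
    Function.Bijective (dualElement 𝒜 N) := by
  obtain ⟨r, p, q, hpq⟩ := h
  constructor
  · intro x y hxy
    rw [← hpq x, ← hpq y]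
    refine Finset.sum_congr rfl fun j _ => congrArg (q j)
      ((dualElement_degreeZero_bijective 𝒜).1 ?_)
    have h1 := dualElement_map 𝒜 (ModuleCat.ofHom (p j)) x
    have h2 := dualElement_map 𝒜 (ModuleCat.ofHom (p j)) y
    rw [hxy, ← h2] at h1
    exact h1
  · intro φ
    choose x hx using fun j => (dualElement_degreeZero_bijective 𝒜).2
      (extDualHom 𝒜 (ModuleCat.ofHom (p j)) ≫ φ)
    refine ⟨∑ j, q j (x j), ?_⟩
    rw [dualElement_sum]
    have h1 : ∀ j, dualElement 𝒜 N (q j (x j)) = extDualHom 𝒜 (ModuleCat.ofHom (q j)) ≫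
        extDualHom 𝒜 (ModuleCat.ofHom (p j)) ≫ φ := fun j => by
      rw [← hx]; exact dualElement_map 𝒜 (ModuleCat.ofHom (q j)) (x j)
    rw [Finset.sum_congr rfl fun j _ => h1 j]
    refine ModuleCat.hom_ext (LinearMap.ext fun y => ?_)
    rw [ModuleCat.hom_sum, LinearMap.sum_apply]
    refine Eq.trans (map_sum φ.hom _ Finset.univ).symm ?_
    exact congrArg φ.hom (sum_yonedaModMap_of_retract (degreeZero 𝒜).toModuleCat hpq y)

end ExtDualModules

/-! ### The short exact sequence of duals and dimension shifting along it. -/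

section DualComplex

variable {k : Type v} [Field k] {A : Type u} [Ring A] [Algebra k A] (𝒜 : ℕ → Submodule k A)
  [GradedAlgebra 𝒜]

open GrMod

/-- The complex `Ext^*(A_{≥ 1} N, A_0) → Ext^*(N / A_{≥ 1} N, A_0) → Ext^*(N, A_0)` whose first
map is the connecting homomorphism. -/
abbrev dualComplex (N : ModuleCat.{u} A) : ShortComplex (ModuleCat.{u} (ExtAlg 𝒜)) :=
  ShortComplex.mk (X₁ := extDualMod 𝒜 (radObj 𝒜 N)) (X₂ := extDualMod 𝒜 (topObj 𝒜 N))
    (X₃ := extDualMod 𝒜 N)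
    (ModuleCat.ofHom (yonedaDelta (degreeZero 𝒜).toModuleCat (radComplex_shortExact 𝒜 N)))
    (extDualHom 𝒜 (radComplex 𝒜 N).g)
    (ModuleCat.hom_ext (LinearMap.ext fun x =>
      (yonedaDelta_exact (degreeZero 𝒜).toModuleCat (radComplex_shortExact 𝒜 N)).apply_apply_eq_zero
        x))

variable {𝒜}

theorem IsRadAcyclic.dualComplex_shortExact {N : ModuleCat.{u} A} (h : IsRadAcyclic 𝒜 N) :
    (dualComplex 𝒜 N).ShortExact :=
  ModuleCat.shortComplex_shortExact _
    (yonedaDelta_exact (degreeZero 𝒜).toModuleCat (radComplex_shortExact 𝒜 N))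
    (yonedaDelta_injective (degreeZero 𝒜).toModuleCat (radComplex_shortExact 𝒜 N) h)
    (yonedaModMap_surjective (degreeZero 𝒜).toModuleCat (radComplex_shortExact 𝒜 N) h)

/-- The map of complexes `A_{≥ 1} N → N → N / A_{≥ 1} N` induced by a linear map. -/
def radComplexMap (𝒜 : ℕ → Submodule k A) {N N' : ModuleCat.{u} A} (f : N ⟶ N') :
    radComplex 𝒜 N ⟶ radComplex 𝒜 N' where
  τ₁ := ModuleCat.ofHom (f.hom.restrict fun _ hx => map_mem_rad f.hom hx)
  τ₂ := f
  τ₃ := ModuleCat.ofHom ((rad 𝒜 N).mapQ (rad 𝒜 N') f.hom fun _ hx => map_mem_rad f.hom hx)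
  comm₁₂ := rfl
  comm₂₃ := rfl

/-- The map of dual complexes induced by a linear map. -/
def dualComplexMap (𝒜 : ℕ → Submodule k A) [GradedAlgebra 𝒜] {N N' : ModuleCat.{u} A}
    (f : N ⟶ N') : dualComplex 𝒜 N' ⟶ dualComplex 𝒜 N where
  τ₁ := extDualHom 𝒜 (radComplexMap 𝒜 f).τ₁
  τ₂ := extDualHom 𝒜 (radComplexMap 𝒜 f).τ₃
  τ₃ := extDualHom 𝒜 f
  comm₁₂ := ModuleCat.hom_ext (LinearMap.ext fun x =>
    yonedaDelta_naturality (degreeZero 𝒜).toModuleCat (radComplex_shortExact 𝒜 N')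
      (radComplex_shortExact 𝒜 N) (radComplexMap 𝒜 f) x)
  comm₂₃ := by
    refine (extDualHom_comp 𝒜 (radComplex 𝒜 N).g (radComplexMap 𝒜 f).τ₃).symm.trans
      (Eq.trans ?_ (extDualHom_comp 𝒜 f (radComplex 𝒜 N').g))
    rfl

/-- Pulled back to `E(N / rad N)`, a homomorphism comes from an element of `N / rad N`; any lift to
`N` works, since `E(N / rad N) → E(N)` is an epimorphism. -/
theorem IsLin.dualElement_surjective (hinj : Module.Injective (𝒜 0) (𝒜 0))
    (hA : (degreeZero 𝒜).IsKoszul) {N : ModuleCat.{u} A} (hN : IsLin 𝒜 N) :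
    Function.Surjective (dualElement 𝒜 N) := by
  intro φ
  obtain ⟨t, ht⟩ := (dualElement_bijective_of_retract 𝒜 hN.isRetractOfPow).2
    (extDualHom 𝒜 (radComplex 𝒜 N).g ≫ φ)
  obtain ⟨x, rfl⟩ := (GrKoszul.rad 𝒜 N).mkQ_surjective t
  refine ⟨x, ?_⟩
  have h1 := dualElement_map 𝒜 (radComplex 𝒜 N).g x
  have := (hN.isRadAcyclic hinj hA).dualComplex_shortExact.epi_g
  exact (cancel_epi (extDualHom 𝒜 (radComplex 𝒜 N).g)).1 (h1.symm.trans ht)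

theorem IsLin.dualElement_eq_zero_iff (hinj : Module.Injective (𝒜 0) (𝒜 0))
    (hA : (degreeZero 𝒜).IsKoszul) {N : ModuleCat.{u} A} (hN : IsLin 𝒜 N) (x : N) :
    dualElement 𝒜 N x = 0 ↔ x ∈ GrKoszul.rad 𝒜 N := by
  have h1 := dualElement_map 𝒜 (radComplex 𝒜 N).g x
  have h0 : dualElement 𝒜 (topObj 𝒜 N) 0 = 0 :=
    map_zero (AddMonoidHom.mk' (dualElement 𝒜 (topObj 𝒜 N)) (dualElement_add 𝒜))
  rw [← Submodule.Quotient.mk_eq_zero]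
  constructor
  · intro h
    rw [h, Limits.comp_zero] at h1
    exact (dualElement_bijective_of_retract 𝒜 hN.isRetractOfPow).1 (h1.trans h0.symm)
  · intro h
    have := (hN.isRadAcyclic hinj hA).dualComplex_shortExact.epi_g
    refine (cancel_epi (extDualHom 𝒜 (radComplex 𝒜 N).g)).1 ?_
    rw [Limits.comp_zero, ← h0, ← h1]
    exact congrArg (dualElement 𝒜 (topObj 𝒜 N)) h

/-- Homomorphisms from `Ext^*(N / A_{≥ 1} N, A_0)` to `Ext^*(A, A_0)` vanish on the image of the
connecting homomorphism. -/
theorem IsLin.dualComplex_f_comp {N : ModuleCat.{u} A} (hN : IsLin 𝒜 N)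
    (φ : extDualMod 𝒜 (topObj 𝒜 N) ⟶ extDualMod 𝒜 (regular 𝒜).toModuleCat) :
    (dualComplex 𝒜 N).f ≫ φ = 0 := by
  obtain ⟨t, rfl⟩ := (dualElement_bijective_of_retract 𝒜 hN.isRetractOfPow).2 φ
  refine ModuleCat.hom_ext (LinearMap.ext fun x => ?_)
  -- The connecting homomorphism lands in degrees at least 1, whereas `E(A)` lives in degree 0.
  have key : yonedaModMap (degreeZero 𝒜).toModuleCat (ModuleCat.ofHom (ofElement 𝒜 t))
      (yonedaDelta (degreeZero 𝒜).toModuleCat (radComplex_shortExact 𝒜 N) x) = 0 := by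
    refine YonedaMod.ext_coeff fun i => ?_
    cases i with
    | succ i => rw [coeff_regular_succ, coeff_regular_succ]
    | zero =>
      have h := coeff_yonedaDelta_zero _ (radComplex_shortExact 𝒜 N) x
      rw [coeff_yonedaModMap, map_zero]
      exact (congrArg (fun z => Ext.comp _ z (zero_add 0)) h).trans (Ext.comp_zero _ _ _ _ _)
  exact key

open Classical in
/-- The class in `Ext^1(Ext^*(N, A_0), Ext^*(A_{≥ 1} N, A_0))` of the dual complex, provided that
this complex is short exact. -/
def dualClass (𝒜 : ℕ → Submodule k A) [GradedAlgebra 𝒜] (N : ModuleCat.{u} A) :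
    Ext (extDualMod 𝒜 N) (extDualMod 𝒜 (radObj 𝒜 N)) 1 :=
  if h : (dualComplex 𝒜 N).ShortExact then h.extClass else 0

theorem dualClass_eq {N : ModuleCat.{u} A} (h : (dualComplex 𝒜 N).ShortExact) :
    dualClass 𝒜 N = h.extClass := dif_pos h

theorem dualClass_naturality {N N' : ModuleCat.{u} A} (h : (dualComplex 𝒜 N).ShortExact)
    (h' : (dualComplex 𝒜 N').ShortExact) (f : N ⟶ N') :
    (dualClass 𝒜 N').comp (Ext.mk₀ (extDualHom 𝒜 (radComplexMap 𝒜 f).τ₁)) (add_zero 1) =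
      (Ext.mk₀ (extDualHom 𝒜 f)).comp (dualClass 𝒜 N) (zero_add 1) := by
  rw [dualClass_eq h, dualClass_eq h']
  exact ShortComplex.ShortExact.extClass_naturality h' h (dualComplexMap 𝒜 f)

theorem IsLin.subsingleton_ext_top {N : ModuleCat.{u} A} (hN : IsLin 𝒜 N)
    (Y : ModuleCat.{u} (ExtAlg 𝒜)) (n : ℕ) :
    Subsingleton (Ext (extDualMod 𝒜 (topObj 𝒜 N)) Y (n + 1)) := by
  have := yonedaMod_projective_of_retract (degreeZero 𝒜).toModuleCat hN.isRetractOfPow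
  exact subsingleton_ext_of_projective Y n

/-- The middle term `E(N / rad N)` of the dual sequence is projective, so composition with the
connecting class is onto. -/
theorem IsLin.exists_dualClass_comp (hinj : Module.Injective (𝒜 0) (𝒜 0))
    (hA : (degreeZero 𝒜).IsKoszul) {N : ModuleCat.{u} A} (hN : IsLin 𝒜 N) {n : ℕ}
    {Y : ModuleCat.{u} (ExtAlg 𝒜)} (y : Ext (extDualMod 𝒜 N) Y (n + 1)) :
    ∃ z : Ext (extDualMod 𝒜 (radObj 𝒜 N)) Y n, (dualClass 𝒜 N).comp z (add_comm 1 n) = y := by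
  have h := (hN.isRadAcyclic hinj hA).dualComplex_shortExact
  have := hN.subsingleton_ext_top Y n
  rw [dualClass_eq h]
  exact Ext.contravariant_sequence_exact₃ h Y y (Subsingleton.elim _ _) (add_comm 1 n)

/-- The kernel of dimension shifting comes from `Ext^n` of the projective `E(N / rad N)`. This is
zero for `n > 0`; for `n = 0` its image is zero because maps to `E(A)` kill the image of the
connecting homomorphism. -/
theorem IsLin.eq_zero_of_dualClass_comp (hinj : Module.Injective (𝒜 0) (𝒜 0))
    (hA : (degreeZero 𝒜).IsKoszul) {N : ModuleCat.{u} A} (hN : IsLin 𝒜 N) {n : ℕ}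
    (z : Ext (extDualMod 𝒜 (radObj 𝒜 N)) (extDualMod 𝒜 (regular 𝒜).toModuleCat) n)
    (hz : (dualClass 𝒜 N).comp z (add_comm 1 n) = 0) : z = 0 := by
  have h := (hN.isRadAcyclic hinj hA).dualComplex_shortExact
  rw [dualClass_eq h] at hz
  obtain ⟨w, rfl⟩ := Ext.contravariant_sequence_exact₁ h _ z _ hz
  cases n with
  | zero =>
    obtain ⟨φ, rfl⟩ := (Ext.mk₀_bijective _ _).2 w
    rw [Ext.mk₀_comp_mk₀, hN.dualComplex_f_comp φ, Ext.mk₀_zero]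
  | succ n =>
    have := hN.subsingleton_ext_top (extDualMod 𝒜 (regular 𝒜).toModuleCat) n
    rw [Subsingleton.elim w 0, Ext.comp_zero]

end DualComplex

/-! ### The radical filtration and its layers as Ext groups between duals. -/

section RadPow

variable {k : Type v} [Field k] {A : Type u} [Ring A] [Algebra k A]

/-- The filtration `N ⊇ A_{≥ 1} N ⊇ A_{≥ 1} (A_{≥ 1} N) ⊇ ⋯`. -/
def radPow (𝒜 : ℕ → Submodule k A) : ℕ → (N : ModuleCat.{u} A) → Submodule A N
  | 0, _ => ⊤
  | i + 1, N => (radPow 𝒜 i (radObj 𝒜 N)).map (rad 𝒜 N).subtype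

variable {𝒜 : ℕ → Submodule k A}

theorem mem_radPow_succ {i : ℕ} {N : ModuleCat.{u} A} {x : N} :
    x ∈ radPow 𝒜 (i + 1) N ↔ ∃ h : x ∈ rad 𝒜 N, (⟨x, h⟩ : rad 𝒜 N) ∈ radPow 𝒜 i (radObj 𝒜 N) := by
  constructor
  · rintro ⟨y, hy, rfl⟩
    exact ⟨y.2, hy⟩
  · rintro ⟨h, hx⟩
    exact ⟨⟨x, h⟩, hx, rfl⟩

theorem map_mem_radPow {i : ℕ} {N N' : ModuleCat.{u} A} (f : N ⟶ N') {x : N}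
    (hx : x ∈ radPow 𝒜 i N) : f.hom x ∈ radPow 𝒜 i N' := by
  induction i generalizing N N' with
  | zero => trivial
  | succ i ih =>
    obtain ⟨h, hx⟩ := mem_radPow_succ.1 hx
    exact mem_radPow_succ.2 ⟨map_mem_rad f.hom h, ih (radComplexMap 𝒜 f).τ₁ hx⟩

variable (𝒜) [GradedAlgebra 𝒜]

open Classical in
/-- The class in `Ext^i(Ext^*(N, A_0), Ext^*(A, A_0))` associated with an element of the `i`-th
step of the radical filtration of `N`. -/
def biduality : (i : ℕ) → (N : ModuleCat.{u} A) → N →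
    Ext (extDualMod 𝒜 N) (extDualMod 𝒜 (regular 𝒜).toModuleCat) i
  | 0, N, x => Ext.mk₀ (dualElement 𝒜 N x)
  -- The value 0 outside the radical is only a filler; additivity and naturality are claimed on
  -- `radPow` alone.
  | i + 1, N, x => if h : x ∈ rad 𝒜 N then
      (dualClass 𝒜 N).comp (biduality i (radObj 𝒜 N) ⟨x, h⟩) (add_comm 1 i) else 0

theorem biduality_zero (N : ModuleCat.{u} A) (x : N) :
    biduality 𝒜 0 N x = Ext.mk₀ (dualElement 𝒜 N x) := rfl

theorem biduality_succ (i : ℕ) (N : ModuleCat.{u} A) {x : N} (h : x ∈ rad 𝒜 N) :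
    biduality 𝒜 (i + 1) N x =
      (dualClass 𝒜 N).comp (biduality 𝒜 i (radObj 𝒜 N) ⟨x, h⟩) (add_comm 1 i) := dif_pos h

theorem biduality_add {i : ℕ} {N : ModuleCat.{u} A} {x y : N} (hx : x ∈ radPow 𝒜 i N)
    (hy : y ∈ radPow 𝒜 i N) :
    biduality 𝒜 i N (x + y) = biduality 𝒜 i N x + biduality 𝒜 i N y := by
  induction i generalizing N with
  | zero => simp only [biduality_zero, dualElement_add, Ext.mk₀_add]
  | succ i ih =>
    obtain ⟨h, hx⟩ := mem_radPow_succ.1 hx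
    obtain ⟨h', hy⟩ := mem_radPow_succ.1 hy
    rw [biduality_succ 𝒜 i N h, biduality_succ 𝒜 i N h', biduality_succ 𝒜 i N (add_mem h h'),
      ← Ext.comp_add, ← ih hx hy]
    rfl

variable {𝒜} (hinj : Module.Injective (𝒜 0) (𝒜 0)) (hA : (degreeZero 𝒜).IsKoszul)
include hinj hA

theorem biduality_map {i : ℕ} {N N' : ModuleCat.{u} A} (hN : IsLin 𝒜 N) (hN' : IsLin 𝒜 N')
    (f : N ⟶ N') {x : N} (hx : x ∈ radPow 𝒜 i N) :
    biduality 𝒜 i N' (f.hom x) =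
      (Ext.mk₀ (extDualHom 𝒜 f)).comp (biduality 𝒜 i N x) (zero_add i) := by
  induction i generalizing N N' with
  | zero => rw [biduality_zero, biduality_zero, dualElement_map, Ext.mk₀_comp_mk₀]
  | succ i ih =>
    obtain ⟨h, hx⟩ := mem_radPow_succ.1 hx
    rw [biduality_succ 𝒜 i N h, biduality_succ 𝒜 i N' (map_mem_rad f.hom h)]
    have h1 := ih (hN.rad hinj hA) (hN'.rad hinj hA) (radComplexMap 𝒜 f).τ₁ hx
    have h2 := dualClass_naturality (hN.isRadAcyclic hinj hA).dualComplex_shortExact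
      (hN'.isRadAcyclic hinj hA).dualComplex_shortExact f
    rw [← Ext.comp_assoc _ _ _ (zero_add 1) (add_comm 1 i) (by omega), ← h2,
      Ext.comp_assoc _ _ _ (add_zero 1) (zero_add i) (by omega), ← h1]
    rfl

/-- For `i = 0` this is naturality: `a • x` is the image of `a` under the map `A → N` with `1 ↦ x`.
For larger `i` one connecting class is split off on the left. -/
theorem biduality_smul {i j l : ℕ} (hl : i + j = l) {N : ModuleCat.{u} A} (hN : IsLin 𝒜 N)
    (hR : IsLin 𝒜 (regular 𝒜).toModuleCat) {x : N} (hx : x ∈ radPow 𝒜 i N) {a : A}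
    (ha : (show (regular 𝒜).toModuleCat from a) ∈
      radPow 𝒜 j (regular 𝒜).toModuleCat) :
    a • x ∈ radPow 𝒜 l N ∧ biduality 𝒜 l N (a • x) = (biduality 𝒜 i N x).comp
      (biduality 𝒜 j (regular 𝒜).toModuleCat (show (regular 𝒜).carrier from a)) hl := by
  induction i generalizing N l with
  | zero =>
    obtain rfl : j = l := by omega
    exact ⟨map_mem_radPow (ModuleCat.ofHom (ofElement 𝒜 x)) ha,
      biduality_map hinj hA hR hN (ModuleCat.ofHom (ofElement 𝒜 x)) ha⟩
  | succ i ih =>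
    obtain ⟨l, rfl⟩ : ∃ m, l = m + 1 := ⟨l - 1, by omega⟩
    obtain ⟨h, hx⟩ := mem_radPow_succ.1 hx
    obtain ⟨h1, h2⟩ := ih (l := l) (by omega) (hN.rad hinj hA) hx
    refine ⟨mem_radPow_succ.2 ⟨Submodule.smul_mem _ a h, h1⟩, ?_⟩
    rw [biduality_succ 𝒜 i N h, biduality_succ 𝒜 l N (Submodule.smul_mem _ a h),
      Ext.comp_assoc _ _ _ (add_comm 1 i) (show i + j = l by omega) (by omega), ← h2]
    rfl

/-- In degree 0 the kernel of `N → Hom(E(N), E(A))` is the radical, and dimension shifting into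
`E(A)` is injective. -/
theorem biduality_eq_zero_iff {i : ℕ} {N : ModuleCat.{u} A} (hN : IsLin 𝒜 N) {x : N}
    (hx : x ∈ radPow 𝒜 i N) : biduality 𝒜 i N x = 0 ↔ x ∈ radPow 𝒜 (i + 1) N := by
  induction i generalizing N with
  | zero =>
    rw [biduality_zero, ← Ext.mk₀_zero, (Ext.mk₀_bijective _ _).1.eq_iff,
      hN.dualElement_eq_zero_iff hinj hA]
    exact ⟨fun h => mem_radPow_succ.2 ⟨h, trivial⟩, fun h => (mem_radPow_succ.1 h).1⟩
  | succ i ih =>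
    obtain ⟨h, hx⟩ := mem_radPow_succ.1 hx
    rw [biduality_succ 𝒜 i N h, mem_radPow_succ, exists_prop_of_true h,
      ← ih (hN.rad hinj hA) hx]
    refine ⟨hN.eq_zero_of_dualClass_comp hinj hA _, fun h0 => ?_⟩
    rw [h0, Ext.comp_zero]

theorem biduality_surjective {i : ℕ} {N : ModuleCat.{u} A} (hN : IsLin 𝒜 N)
    (y : Ext (extDualMod 𝒜 N) (extDualMod 𝒜 (regular 𝒜).toModuleCat) i) :
    ∃ x ∈ radPow 𝒜 i N, biduality 𝒜 i N x = y := by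
  induction i generalizing N with
  | zero =>
    obtain ⟨φ, rfl⟩ := (Ext.mk₀_bijective _ _).2 y
    obtain ⟨x, rfl⟩ := hN.dualElement_surjective hinj hA φ
    exact ⟨x, trivial, rfl⟩
  | succ i ih =>
    obtain ⟨z, rfl⟩ := hN.exists_dualClass_comp hinj hA y
    obtain ⟨x, hx, rfl⟩ := ih (hN.rad hinj hA) z
    exact ⟨x, mem_radPow_succ.2 ⟨x.2, hx⟩, biduality_succ 𝒜 i N x.2⟩

end RadPow

/-! ### Self-injectivity of a finite-dimensional algebra passes to its opposite. -/

section SelfInjective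

variable (k : Type v) [Field k] {R : Type u} [Ring R] [Algebra k R] [Module.Finite k R]

include k in
/-- Over a finite-dimensional algebra, the ring modulo the annihilator of a simple module `T`
embeds into a finite power of `T`. -/
theorem exists_ker_eq_annihilator {T : Type u} [AddCommGroup T] [Module R T] [IsSimpleModule R T] :
    ∃ (n : ℕ) (φ : R →ₗ[R] Fin n → T), LinearMap.ker φ = Module.annihilator R T := by
  obtain ⟨n, b, hb⟩ := Module.Finite.exists_fin (R := k) (M := R)
  have := IsSimpleModule.nontrivial R T
  obtain ⟨t, ht⟩ := exists_ne (0 : T)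
  -- The `b j` span `R` over `k` and `t` generates `T`, so an element killing every `b j • t` kills
  -- `T`.
  refine ⟨n, LinearMap.pi fun j => LinearMap.toSpanSingleton R T (b j • t), ?_⟩
  ext r
  rw [LinearMap.mem_ker, Module.mem_annihilator]
  constructor
  · intro h m
    obtain ⟨s, rfl⟩ := (isSimpleModule_iff_toSpanSingleton_surjective.1 ‹_›).2 t ht m
    have hs : s ∈ Submodule.span k (Set.range b) := hb ▸ trivial
    change r • s • t = 0
    induction hs using Submodule.span_induction with
    | mem x hx =>
      obtain ⟨j, rfl⟩ := hx
      exact congrFun h j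
    | zero => rw [zero_smul, smul_zero]
    | add x y _ _ hx hy => rw [add_smul, smul_add, hx, hy, add_zero]
    | smul c x _ hx =>
      rw [Algebra.smul_def c x, smul_smul, ← mul_assoc, ← Algebra.commutes, mul_assoc, mul_smul,
        mul_smul, hx, smul_zero]
  · exact fun h => funext fun j => h _

include k in
/-- Simple modules over a finite-dimensional algebra are determined by their annihilators. -/
theorem nonempty_equiv_of_annihilator_le {T T' : Type u} [AddCommGroup T] [Module R T]
    [IsSimpleModule R T] [AddCommGroup T'] [Module R T'] [IsSimpleModule R T']
    (h : Module.annihilator R T ≤ Module.annihilator R T') : Nonempty (T ≃ₗ[R] T') := by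
  obtain ⟨n, φ, hφ⟩ := exists_ker_eq_annihilator k (R := R) (T := T)
  have := IsSimpleModule.nontrivial R T'
  obtain ⟨t, ht⟩ := exists_ne (0 : T')
  -- `T'` is a quotient of `R / ann T`, which embeds in the semisimple module `T^n`. So `T'` splits
  -- off, and a nonzero coordinate `T' → T` is an isomorphism by Schur's lemma.
  obtain ⟨g, hg⟩ := exists_factor (f := φ.rangeRestrict) (LinearMap.surjective_rangeRestrict φ)
    (LinearMap.toSpanSingleton R T' t) fun x hx => by
      refine Module.mem_annihilator.1 (h ?_) t
      rw [← hφ]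
      exact congrArg Subtype.val hx
  have hgs : Function.Surjective g := fun y => by
    obtain ⟨s, rfl⟩ := (isSimpleModule_iff_toSpanSingleton_surjective.1 ‹_›).2 t ht y
    exact ⟨_, hg s⟩
  obtain ⟨σ, hσ⟩ := IsSemisimpleModule.lifting_property g hgs LinearMap.id
  have hne : ∃ j, LinearMap.proj j ∘ₗ (LinearMap.range φ).subtype ∘ₗ σ ≠ 0 := by
    by_contra! hcon
    have h1 : σ t = 0 := Subtype.ext (funext fun j => LinearMap.congr_fun (hcon j) t)
    have h2 := LinearMap.congr_fun hσ t
    rw [LinearMap.comp_apply, h1, map_zero] at h2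
    exact ht h2.symm
  obtain ⟨j, hj⟩ := hne
  exact ⟨(LinearEquiv.ofBijective _ (LinearMap.bijective_of_ne_zero hj)).symm⟩

-- If the sum were proper, a maximal left ideal `K` would contain both annihilators. Being two-sided
-- they annihilate `R / K`, so `T` and `T'` would both be isomorphic to `R / K`.
include k in
theorem annihilator_sup_eq_top {T T' : Type u} [AddCommGroup T] [Module R T]
    [IsSimpleModule R T] [AddCommGroup T'] [Module R T'] [IsSimpleModule R T']
    (h : Module.annihilator R T ≠ Module.annihilator R T') :
    Module.annihilator R T ⊔ Module.annihilator R T' = ⊤ := by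
  by_contra hne
  obtain ⟨K, hK, hle⟩ := Ideal.exists_le_maximal _ hne
  have : IsSimpleModule R (R ⧸ K) := isSimpleModule_iff_quot_maximal.2 ⟨K, hK, ⟨LinearEquiv.refl R _⟩⟩
  have key : ∀ D : Ideal R, D.IsTwoSided → D ≤ K → D ≤ Module.annihilator R (R ⧸ K) := by
    intro D hD hDK d hd
    rw [Module.mem_annihilator]
    intro m
    obtain ⟨r, rfl⟩ := K.mkQ_surjective m
    rw [← map_smul]
    exact (Submodule.Quotient.mk_eq_zero K).2 (hDK (hD.mul_mem_of_left r hd))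
  obtain ⟨e⟩ := nonempty_equiv_of_annihilator_le k (key _ inferInstance (le_sup_left.trans hle))
  obtain ⟨e'⟩ := nonempty_equiv_of_annihilator_le k (key _ inferInstance (le_sup_right.trans hle))
  exact h (e.trans e'.symm).annihilator_eq

variable (R) in
/-- The annihilators of the simple modules. -/
def primitiveIdeals : Set (Ideal R) :=
  {D | ∃ K : Ideal R, K.IsMaximal ∧ D = Module.annihilator R (R ⧸ K)}

theorem annihilator_mem_primitiveIdeals {R : Type u} [Ring R] (T : Type u) [AddCommGroup T]
    [Module R T] [h : IsSimpleModule R T] : Module.annihilator R T ∈ primitiveIdeals R := by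
  obtain ⟨K, hK, ⟨e⟩⟩ := isSimpleModule_iff_quot_maximal.1 h
  exact ⟨K, hK, e.annihilator_eq⟩

theorem exists_simple_of_mem_primitiveIdeals {R : Type u} [Ring R] {D : Ideal R}
    (h : D ∈ primitiveIdeals R) : ∃ K : Ideal R, IsSimpleModule R (R ⧸ K) ∧
      D = Module.annihilator R (R ⧸ K) := by
  obtain ⟨K, hK, rfl⟩ := h
  exact ⟨K, isSimpleModule_iff_quot_maximal.2 ⟨K, hK, ⟨LinearEquiv.refl R _⟩⟩, rfl⟩

theorem isTwoSided_of_mem_primitiveIdeals {R : Type u} [Ring R] {D : Ideal R}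
    (h : D ∈ primitiveIdeals R) : D.IsTwoSided := by
  obtain ⟨K, hK, rfl⟩ := h
  infer_instance

include k in
theorem sup_eq_top_of_mem_primitiveIdeals {D D' : Ideal R} (hD : D ∈ primitiveIdeals R)
    (hD' : D' ∈ primitiveIdeals R) (h : D ≠ D') : D ⊔ D' = ⊤ := by
  obtain ⟨K, hK, rfl⟩ := exists_simple_of_mem_primitiveIdeals hD
  obtain ⟨K', hK', rfl⟩ := exists_simple_of_mem_primitiveIdeals hD'
  exact annihilator_sup_eq_top k h

theorem one_notMem_of_mem_primitiveIdeals {R : Type u} [Ring R] {D : Ideal R}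
    (hD : D ∈ primitiveIdeals R) : (1 : R) ∉ D := by
  obtain ⟨K, hK, rfl⟩ := exists_simple_of_mem_primitiveIdeals hD
  have := IsSimpleModule.nontrivial R (R ⧸ K)
  obtain ⟨t, ht⟩ := exists_ne (0 : R ⧸ K)
  exact fun h => ht (by rw [← one_smul R t]; exact Module.mem_annihilator.1 h t)

-- Distinct primitive ideals are comaximal, so infinitely many of them would give a strictly
-- decreasing chain of finite intersections in an artinian ring.
include k in
theorem finite_primitiveIdeals : Finite (primitiveIdeals R) := by
  by_contra hinf
  rw [not_finite_iff_infinite] at hinf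
  let f := Infinite.natEmbedding (primitiveIdeals R)
  let I : ℕ → Ideal R := fun n => Nat.rec ⊤ (fun m J => J ⊓ (f m : Ideal R)) n
  have hIs : ∀ n, I (n + 1) = I n ⊓ (f n : Ideal R) := fun n => rfl
  have h2 : ∀ n, (I n).IsTwoSided := fun n => by
    induction n with
    | zero => exact ⟨fun _ _ => trivial⟩
    | succ n ih =>
      have := isTwoSided_of_mem_primitiveIdeals (f n).2
      rw [hIs]
      exact ⟨fun b h => ⟨ih.mul_mem_of_left b h.1, this.mul_mem_of_left b h.2⟩⟩
  -- From `a + d = 1` and `b + e = 1` with `a ∈ I n`, `b ∈ f n` and `d, e ∈ f m` one gets `1 = ab +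
  -- (db + e)`.
  have hco : ∀ n m, n ≤ m → I n ⊔ (f m : Ideal R) = ⊤ := fun n => by
    induction n with
    | zero => exact fun m _ => top_sup_eq _
    | succ n ih =>
      intro m hm
      obtain ⟨a, ha, d, hd, h1⟩ := Submodule.mem_sup.1
        ((ih m (by omega)).ge (Submodule.mem_top (x := (1 : R))))
      have hne : (f n : Ideal R) ≠ f m := fun h => by
        have := f.injective (Subtype.ext h); omega
      obtain ⟨b, hb, e, he, h3⟩ := Submodule.mem_sup.1
        ((sup_eq_top_of_mem_primitiveIdeals k (f n).2 (f m).2 hne).ge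
          (Submodule.mem_top (x := (1 : R))))
      rw [Ideal.eq_top_iff_one]
      have := isTwoSided_of_mem_primitiveIdeals (f m).2
      have h4 : (1 : R) = a * b + (d * b + e) := by
        rw [← add_assoc, ← add_mul, h1, one_mul, h3]
      rw [h4, hIs]
      refine Submodule.add_mem_sup ⟨(h2 n).mul_mem_of_left b ha, Ideal.mul_mem_left _ a hb⟩
        (add_mem (this.mul_mem_of_left b hd) he)
  have : IsArtinianRing R := IsArtinianRing.of_finite k R
  obtain ⟨n, hn⟩ := IsArtinian.monotone_stabilizes (R := R) (M := R)
    ⟨fun n => OrderDual.toDual (I n), monotone_nat_of_le_succ fun n => by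
      change I (n + 1) ≤ I n
      rw [hIs]; exact inf_le_left⟩
  have h3 : I n = I (n + 1) := hn (n + 1) (Nat.le_succ n)
  have h4 : I n ≤ (f n : Ideal R) := by rw [h3, hIs]; exact inf_le_right
  have h5 := hco n n le_rfl
  rw [sup_eq_right.2 h4] at h5
  exact one_notMem_of_mem_primitiveIdeals (f n).2 (h5 ▸ trivial)

variable {k} (hinj : Module.Injective R R)
include hinj

-- Otherwise, with `x j` generating `D`, the map `y ↦ (y * x j)` embeds `R` in `R^n`. A retraction
-- of it, given by self-injectivity, writes `1` as a sum of elements `x j * r` of `D`.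
include k in
theorem exists_ne_zero_mul_eq_zero {D : Ideal R} (hD : D.IsTwoSided) (h1 : (1 : R) ∉ D) :
    ∃ y : R, y ≠ 0 ∧ ∀ d ∈ D, y * d = 0 := by
  by_contra! hcon
  obtain ⟨n, x, hx⟩ := Submodule.fg_iff_exists_fin_generating_family.1
    (IsNoetherian.noetherian (D.restrictScalars k))
  have hxD : ∀ j, x j ∈ D := fun j => by
    have : x j ∈ D.restrictScalars k := hx ▸ Submodule.subset_span ⟨j, rfl⟩
    exact this
  let f : R →ₗ[R] (Fin n → R) := LinearMap.pi fun j => LinearMap.toSpanSingleton R R (x j)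
  have hf : Function.Injective f := by
    rw [injective_iff_map_eq_zero]
    intro y hy
    by_contra hne
    obtain ⟨d, hd, hyd⟩ := hcon y hne
    refine hyd ?_
    have hd' : d ∈ Submodule.span k (Set.range x) := hx ▸ hd
    clear hyd hd
    induction hd' using Submodule.span_induction with
    | mem d hd =>
      obtain ⟨j, rfl⟩ := hd
      exact congrFun hy j
    | zero => exact mul_zero y
    | add a b _ _ ha hb => rw [mul_add, ha, hb, add_zero]
    | smul c a _ ha => rw [mul_smul_comm, ha, smul_zero]
  obtain ⟨h, hh⟩ := hinj.out f hf LinearMap.id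
  have h2 := hh 1
  rw [LinearMap.id_apply, LinearMap.pi_apply_eq_sum_univ h] at h2
  refine h1 ?_
  rw [← h2]
  refine sum_mem fun j _ => hD.mul_mem_of_left _ ?_
  change (1 : R) * x j ∈ D
  rw [one_mul]; exact hxD j

include k in
/-- Over a self-injective finite-dimensional algebra, every simple module is isomorphic to a left
ideal. -/
theorem exists_simple_embedding (T : Type u) [AddCommGroup T] [Module R T] [IsSimpleModule R T] :
    ∃ f : T →ₗ[R] R, Function.Injective f := by
  have : IsArtinianRing R := IsArtinianRing.of_finite k R
  have hS : ∀ D : primitiveIdeals R, ∃ S : Submodule R R, IsSimpleModule R S ∧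
      ∀ x ∈ S, ∀ d ∈ (D : Ideal R), x * d = 0 := by
    rintro ⟨D, hD⟩
    have hD2 := isTwoSided_of_mem_primitiveIdeals hD
    obtain ⟨y, hy, hyD⟩ := exists_ne_zero_mul_eq_zero (k := k) hinj hD2
      (one_notMem_of_mem_primitiveIdeals hD)
    obtain h | ⟨S, hS, hle⟩ := IsAtomic.eq_bot_or_exists_atom_le (Submodule.span R {y})
    · exact absurd (Submodule.span_singleton_eq_bot.1 h) hy
    · refine ⟨S, isSimpleModule_iff_isAtom.2 hS, fun x hx d hd => ?_⟩
      obtain ⟨r, rfl⟩ := Submodule.mem_span_singleton.1 (hle hx)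
      rw [smul_eq_mul, mul_assoc, hyD d hd, mul_zero]
  choose S hS hSD using hS
  -- `S D` is a simple left ideal with `S D * D = 0`. The map `τ` is injective on a finite set,
  -- hence surjective (the Nakayama permutation), so every simple module is isomorphic to some `S
  -- D`.
  let τ : primitiveIdeals R → primitiveIdeals R := fun D =>
    ⟨Module.annihilator R (S D), annihilator_mem_primitiveIdeals (S D)⟩
  have hτ : Function.Injective τ := by
    intro D D' h
    by_contra hne
    obtain ⟨e⟩ := nonempty_equiv_of_annihilator_le k (R := R) (congrArg Subtype.val h).le
    have hsup := sup_eq_top_of_mem_primitiveIdeals k D.2 D'.2 fun h => hne (Subtype.ext h)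
    obtain ⟨a, ha, b, hb, hab⟩ := Submodule.mem_sup.1 (hsup.ge (Submodule.mem_top (x := (1 : R))))
    -- By injectivity an isomorphism `S D ≅ S D'` is right multiplication by `g 1`. Its values are
    -- then killed on the right by both `D` and `D'`, hence by `D + D' = R`.
    obtain ⟨g, hg⟩ := hinj.out (S D).subtype (Submodule.subtype_injective _)
      ((S D').subtype ∘ₗ e.toLinearMap)
    have hgx : ∀ x : R, g x = x * g 1 := fun x => by
      rw [← smul_eq_mul, ← map_smul, smul_eq_mul, mul_one]
    have hD2 := isTwoSided_of_mem_primitiveIdeals D.2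
    have := IsSimpleModule.nontrivial R (S D)
    obtain ⟨x, hx⟩ := exists_ne (0 : S D)
    have h1 : ((e x : S D') : R) = (x : R) * g 1 := (hg x).symm.trans (hgx x)
    have h2 : ((e x : S D') : R) = 0 := by
      have hr : ∀ c ∈ (D : Ideal R), (x : R) * (g 1 * c) = 0 := fun c hc =>
        hSD D x x.2 _ (Ideal.mul_mem_left _ _ hc)
      rw [← mul_one ((e x : S D') : R), ← hab, mul_add, hSD D' _ (e x).2 b hb, add_zero, h1,
        mul_assoc, hr a ha]
    exact hx (e.injective (Subtype.ext (h2.trans (by rw [map_zero]; rfl))))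
  have := finite_primitiveIdeals k (R := R)
  obtain ⟨D, hD⟩ := Finite.injective_iff_surjective.1 hτ
    ⟨Module.annihilator R T, annihilator_mem_primitiveIdeals T⟩
  have h1 : Module.annihilator R T = Module.annihilator R (S D) := (congrArg Subtype.val hD).symm
  obtain ⟨e⟩ := nonempty_equiv_of_annihilator_le k (R := R) h1.le
  exact ⟨(S D).subtype ∘ₗ e.toLinearMap, (Submodule.subtype_injective _).comp e.injective⟩

include k in
/-- A self-injective finite-dimensional algebra is a cogenerator. -/
theorem exists_separating_map {M : Type u} [AddCommGroup M] [Module R M] (L : Submodule R M)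
    {y : M} (hy : y ∉ L) : ∃ h : M →ₗ[R] R, (∀ x ∈ L, h x = 0) ∧ h y ≠ 0 := by
  let f := LinearMap.toSpanSingleton R (M ⧸ L) (L.mkQ y)
  have hf : LinearMap.ker f ≠ ⊤ := fun h => by
    have h1 : f 1 = 0 := by
      rw [← LinearMap.mem_ker, h]; trivial
    exact hy ((Submodule.Quotient.mk_eq_zero L).1 ((one_smul R _).symm.trans h1))
  obtain ⟨K, hK, hle⟩ := Ideal.exists_le_maximal _ hf
  have : IsSimpleModule R (R ⧸ K) := isSimpleModule_iff_quot_maximal.2 ⟨K, hK, ⟨LinearEquiv.refl R _⟩⟩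
  obtain ⟨j, hj⟩ := exists_simple_embedding (k := k) hinj (R ⧸ K)
  -- The cyclic submodule generated by the class of `y` has a simple quotient `R / K`; its embedding
  -- into `R` extends to all of `M / L`.
  obtain ⟨h, hh⟩ := hinj.out ((LinearMap.ker f).liftQ f le_rfl)
    (LinearMap.ker_eq_bot.1 (Submodule.ker_liftQ_eq_bot' _ f rfl)) (j ∘ₗ Submodule.factor hle)
  refine ⟨h ∘ₗ L.mkQ, fun x hx => ?_, fun h0 => ?_⟩
  · have : L.mkQ x = 0 := (Submodule.Quotient.mk_eq_zero L).2 hx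
    rw [LinearMap.comp_apply, this, map_zero]
  · have h1 := hh (Submodule.Quotient.mk 1)
    have h2 : (LinearMap.ker f).liftQ f le_rfl (Submodule.Quotient.mk 1) = L.mkQ y :=
      (Submodule.liftQ_apply _ f 1).trans (LinearMap.toSpanSingleton_apply_one R _ _)
    rw [h2] at h1
    have h3 : j (K.mkQ 1) = 0 := h1.symm.trans h0
    exact hK.ne_top ((Ideal.eq_top_iff_one K).2 ((Submodule.Quotient.mk_eq_zero K).1
      (hj (h3.trans (map_zero j).symm))))

include k in
/-- Self-injectivity of a finite-dimensional algebra is left-right symmetric. -/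
theorem injective_mulOpposite : Module.Injective Rᵐᵒᵖ Rᵐᵒᵖ := by
  refine Module.Baer.injective fun I g => ?_
  obtain ⟨n, x, hx⟩ := Submodule.fg_iff_exists_fin_generating_family.1
    (IsNoetherian.noetherian (I.restrictScalars k))
  have hxI : ∀ j, x j ∈ I := fun j => by
    have : x j ∈ I.restrictScalars k := hx ▸ Submodule.subset_span ⟨j, rfl⟩
    exact this
  -- By Baer's criterion `g` must be multiplication by some `c`, that is, the vector `(g (x j))`
  -- must lie in the left submodule of `R^n` generated by `(x j)`. Otherwise a functional separates
  -- them: its coefficients satisfy `∑ x j * c j = 0` but `∑ g (x j) * c j ≠ 0` in `R`, which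
  -- contradicts the linearity of `g`.
  have key : (fun j => (g ⟨x j, hxI j⟩).unop) ∈
      Submodule.span R {fun j => (x j).unop} := by
    by_contra hcon
    obtain ⟨h, h0, h1⟩ := exists_separating_map (k := k) hinj _ hcon
    have h2 := h0 _ (Submodule.mem_span_singleton_self _)
    rw [LinearMap.pi_apply_eq_sum_univ h] at h1 h2
    let c : Fin n → R := fun j => h fun i => if j = i then 1 else 0
    have h3 : ∑ j, MulOpposite.op (c j) • (⟨x j, hxI j⟩ : I) = 0 := by
      refine Subtype.ext (MulOpposite.unop_injective ?_)
      rw [AddSubmonoidClass.coe_finsetSum, Finset.unop_sum]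
      exact h2
    have h4 := congrArg g h3
    rw [map_sum, map_zero] at h4
    simp only [map_smul] at h4
    have h5 := congrArg MulOpposite.unop h4
    rw [Finset.unop_sum] at h5
    exact h1 h5
  obtain ⟨c, hc⟩ := Submodule.mem_span_singleton.1 key
  refine ⟨LinearMap.toSpanSingleton _ _ (MulOpposite.op c), fun y hy => ?_⟩
  have hy' : y ∈ Submodule.span k (Set.range x) := hx ▸ hy
  have hgen : ∀ y ∈ Submodule.span k (Set.range x), ∀ hy : y ∈ I,
      y * MulOpposite.op c = g ⟨y, hy⟩ := by
    intro y hy'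
    induction hy' using Submodule.span_induction with
    | mem y hy =>
      obtain ⟨j, rfl⟩ := hy
      intro _
      exact MulOpposite.unop_injective (congrFun hc j)
    | zero =>
      intro h
      rw [zero_mul]
      exact (map_zero g).symm
    | add a b ha hb iha ihb =>
      intro h
      have ha' : a ∈ I := by rw [hx] at ha; exact ha
      have hb' : b ∈ I := by rw [hx] at hb; exact hb
      rw [add_mul, iha ha', ihb hb', ← map_add]; rfl
    | smul r a ha iha =>
      intro h
      have ha' : a ∈ I := by rw [hx] at ha; exact ha
      rw [smul_mul_assoc, iha ha', ← algebraMap_smul Rᵐᵒᵖ r (g ⟨a, ha'⟩), ← map_smul]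
      congr 1
      exact Subtype.ext (algebraMap_smul Rᵐᵒᵖ r a)
  exact hgen y hy' hy

end SelfInjective

/-! ### The Ext algebra satisfies the hypotheses imposed on `A`. -/

section ExtAlgebra

variable {k : Type v} [Field k] {A : Type u} [Ring A] [Algebra k A] (𝒜 : ℕ → Submodule k A)
  [GradedAlgebra 𝒜]

open GrMod

theorem mem_yonedaGr_iff (X : ModuleCat.{u} A) {n : ℕ} {x : YonedaAlg X} :
    x ∈ yonedaGr k X n ↔ yonedaSelf X x ∈ yonedaModGr k X X n :=
  ⟨fun h i hi => h i fun h' => hi (congrArg Nat.cast h'),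
    fun h i hi => h i fun h' => hi (Int.ofNat_inj.1 h')⟩

theorem of_mem_yonedaGr (X : ModuleCat.{u} A) {n : ℕ} (x : Ext X X n) :
    YonedaAlg.of X n x ∈ yonedaGr k X n :=
  of_mem_pieces (k := k) (X := fun i : ℕ => Ext X X i) id n x

theorem yonedaGr_finite (X : ModuleCat.{u} A) (i : ℕ) [Module.Finite k (Ext X X i)] :
    Module.Finite k (yonedaGr k X i) := by
  let φ : Ext X X i →ₗ[k] yonedaGr k X i :=
    { toFun := fun x => ⟨YonedaAlg.of X i x, of_mem_yonedaGr X x⟩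
      map_add' := fun x y => Subtype.ext (map_add _ _ _)
      map_smul' := fun c x => Subtype.ext (YonedaAlg.smul_of X c x).symm }
  exact Module.Finite.of_surjective φ fun x =>
    (exists_of_mem_yonedaModGr X ((mem_yonedaGr_iff X).1 x.2)).imp fun y hy => Subtype.ext hy

/-- Right multiplication by an element of `A_0`. -/
def degreeZeroMulRight (c : 𝒜 0) : (degreeZero 𝒜).carrier →ₗ[A] (degreeZero 𝒜).carrier where
  toFun m := (show 𝒜 0 from m) * c
  map_add' a b := add_mul (show 𝒜 0 from a) b c
  map_smul' a b := mul_assoc (GradedRing.projZeroRingHom' 𝒜 a) (show 𝒜 0 from b) c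

theorem degreeZero_smul_one (m : (degreeZero 𝒜).carrier) :
    ((show 𝒜 0 from m : 𝒜 0) : A) • (show (degreeZero 𝒜).carrier from (1 : 𝒜 0)) = m := by
  rw [degreeZero_smul_def, GradedRing.projZeroRingHom'_apply_coe]
  exact mul_one (show 𝒜 0 from m)

/-- Right multiplication by an element of `A_0`, as an element of the Ext algebra. -/
def mulRightClass (c : 𝒜 0) : ExtAlg 𝒜 :=
  YonedaAlg.of (degreeZero 𝒜).toModuleCat 0
    (Ext.mk₀ (X := (degreeZero 𝒜).toModuleCat) (Y := (degreeZero 𝒜).toModuleCat)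
      (ModuleCat.ofHom (degreeZeroMulRight 𝒜 c)))

theorem mulRightClass_mul (a b : 𝒜 0) :
    mulRightClass 𝒜 (a * b) = mulRightClass 𝒜 b * mulRightClass 𝒜 a := by
  have h : ModuleCat.ofHom (degreeZeroMulRight 𝒜 (a * b)) =
      ModuleCat.ofHom (degreeZeroMulRight 𝒜 a) ≫ ModuleCat.ofHom (degreeZeroMulRight 𝒜 b) :=
    ModuleCat.hom_ext (LinearMap.ext fun m => (mul_assoc (show 𝒜 0 from m) a b).symm)
  rw [mulRightClass, mulRightClass, mulRightClass, YonedaAlg.of_mul_of, Ext.mk₀_comp_mk₀, h]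

theorem mulRightClass_add (a b : 𝒜 0) :
    mulRightClass 𝒜 (a + b) = mulRightClass 𝒜 a + mulRightClass 𝒜 b := by
  have h : ModuleCat.ofHom (degreeZeroMulRight 𝒜 (a + b)) =
      ModuleCat.ofHom (degreeZeroMulRight 𝒜 a) + ModuleCat.ofHom (degreeZeroMulRight 𝒜 b) :=
    ModuleCat.hom_ext (LinearMap.ext fun m => mul_add (show 𝒜 0 from m) a b)
  rw [mulRightClass, mulRightClass, mulRightClass, h, Ext.mk₀_add, map_add]

theorem mulRightClass_one : mulRightClass 𝒜 1 = 1 := by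
  have h : ModuleCat.ofHom (degreeZeroMulRight 𝒜 1) = 𝟙 (degreeZero 𝒜).toModuleCat :=
    ModuleCat.hom_ext (LinearMap.ext fun m => mul_one (show 𝒜 0 from m))
  rw [mulRightClass, h]
  rfl

theorem mulRightClass_injective : Function.Injective (mulRightClass 𝒜) := fun a b h => by
  have h1 := (Ext.mk₀_bijective _ _).1
    (YonedaMod.of_injective (X := (degreeZero 𝒜).toModuleCat) (degreeZero 𝒜).toModuleCat 0 h)
  have h2 := LinearMap.congr_fun (congrArg ModuleCat.Hom.hom h1)
    (show (degreeZero 𝒜).carrier from (1 : 𝒜 0))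
  exact (one_mul a).symm.trans (h2.trans (one_mul b))

/-- An `A`-linear endomorphism of `A_0` is right multiplication by its value at 1. -/
theorem exists_mulRightClass_eq {x : ExtAlg 𝒜} (hx : x ∈ extGr 𝒜 0) :
    ∃ c, mulRightClass 𝒜 c = x := by
  obtain ⟨y, hy⟩ := exists_of_mem_yonedaModGr (k := k) (i := 0) (degreeZero 𝒜).toModuleCat
    ((mem_yonedaGr_iff _).1 hx)
  obtain ⟨f, rfl⟩ := (Ext.mk₀_bijective _ _).2 y
  let one : (degreeZero 𝒜).carrier := (1 : 𝒜 0)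
  refine ⟨(show 𝒜 0 from f.hom one), Eq.trans ?_ hy⟩
  have h : ModuleCat.ofHom (degreeZeroMulRight 𝒜 (show 𝒜 0 from f.hom one)) = f := by
    refine ModuleCat.hom_ext (LinearMap.ext fun m => ?_)
    have h1 := degreeZero_smul_one 𝒜 m
    have h2 : f.hom m = ((show 𝒜 0 from m : 𝒜 0) : A) • f.hom one := by
      rw [← map_smul]; exact congrArg f.hom h1.symm
    refine Eq.trans ?_ h2.symm
    rw [degreeZero_smul_def, GradedRing.projZeroRingHom'_apply_coe]
    rfl
  rw [mulRightClass, h]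
  rfl

/-- The opposite of `A_0` is the degree zero part of the Ext algebra. -/
def degreeZeroToExt : (𝒜 0)ᵐᵒᵖ →+* extGr 𝒜 0 where
  toFun c := ⟨mulRightClass 𝒜 c.unop, of_mem_yonedaGr _ _⟩
  map_one' := Subtype.ext (mulRightClass_one 𝒜)
  map_mul' a b := Subtype.ext (mulRightClass_mul 𝒜 b.unop a.unop)
  map_zero' := Subtype.ext (map_zero (AddMonoidHom.mk' _ (mulRightClass_add 𝒜)))
  map_add' a b := Subtype.ext (mulRightClass_add 𝒜 a.unop b.unop)

theorem degreeZeroToExt_bijective : Function.Bijective (degreeZeroToExt 𝒜) :=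
  ⟨fun _ _ h => MulOpposite.unop_injective (mulRightClass_injective 𝒜 (congrArg Subtype.val h)),
    fun x => (exists_mulRightClass_eq 𝒜 x.2).elim fun c hc => ⟨MulOpposite.op c, Subtype.ext hc⟩⟩

/-- Right multiplications compose in reverse order, so `Γ_0 ≅ A_0^op`, to which self-injectivity
transfers. -/
theorem injective_extGr_zero [Module.Finite k (𝒜 0)] (hinj : Module.Injective (𝒜 0) (𝒜 0)) :
    Module.Injective (extGr 𝒜 0) (extGr 𝒜 0) := by
  have := injective_mulOpposite (k := k) hinj
  let e := RingEquiv.ofBijective (degreeZeroToExt 𝒜) (degreeZeroToExt_bijective 𝒜)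
  exact Module.Injective.of_ringEquiv e e.toSemilinearEquiv

theorem extGr_proj_zero (x : ExtAlg 𝒜) :
    GradedRing.proj (extGr 𝒜) 0 x =
      YonedaAlg.of _ 0 (YonedaMod.coeff 0 (yonedaSelf (degreeZero 𝒜).toModuleCat x)) := by
  induction x using YonedaAlg.induction with
  | h0 => rw [map_zero, map_zero, map_zero, map_zero]
  | h2 x y hx hy => rw [map_add, map_add, map_add, map_add, hx, hy]
  | h1 i x =>
    rw [GradedRing.proj_apply, yonedaSelf_of]
    obtain rfl | hi := eq_or_ne i 0
    · rw [DirectSum.decompose_of_mem_same _ (of_mem_yonedaGr _ x), YonedaMod.coeff_of_same]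
    · rw [DirectSum.decompose_of_mem_ne _ (of_mem_yonedaGr _ x) hi, YonedaMod.coeff_of_ne hi,
        map_zero]

theorem ker_augmentation_extGr (x : (regular (extGr 𝒜)).carrier) :
    augmentation (extGr 𝒜) x = 0 ↔
      YonedaMod.coeff 0 (yonedaSelf (degreeZero 𝒜).toModuleCat x) = 0 := by
  have h1 : augmentation (extGr 𝒜) x = 0 ↔ GradedRing.proj (extGr 𝒜) 0 (show ExtAlg 𝒜 from x) = 0 :=
    (ZeroMemClass.coe_eq_zero (x := (show extGr 𝒜 0 from augmentation (extGr 𝒜) x))).symm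
  rw [h1, extGr_proj_zero]
  exact ⟨fun h => YonedaMod.of_injective (X := (degreeZero 𝒜).toModuleCat) _ 0
    (h.trans (map_zero _).symm), fun h => (congrArg _ h).trans (map_zero _)⟩

/-- The map from the Ext algebra to `Ext^*(A, A_0)` induced by the projection `A → A_0`. -/
def extToRegular : (regular (extGr 𝒜)).carrier →ₗ[ExtAlg 𝒜]
    YonedaMod (degreeZero 𝒜).toModuleCat (regular 𝒜).toModuleCat :=
  yonedaModMap (degreeZero 𝒜).toModuleCat
      (M := (regular 𝒜).toModuleCat) (N := (degreeZero 𝒜).toModuleCat)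
      (ModuleCat.ofHom (augmentation 𝒜)) ∘ₗ
    (yonedaSelf (degreeZero 𝒜).toModuleCat).toLinearMap

/-- `E(A)` is `Hom(A, A_0)` in degree 0, and every map `A → A_0` factors through the projection `A →
A_0`. -/
theorem extToRegular_surjective : Function.Surjective (extToRegular 𝒜) := fun y => by
  obtain ⟨x, rfl⟩ := exists_of_ofElement 𝒜 y
  obtain ⟨g, hg⟩ := exists_factor (augmentation_surjective 𝒜) (ofElement 𝒜 x) fun a ha =>
    map_rad_degreeZero 𝒜 _ ((augmentation_eq_zero_iff 𝒜 a).1 ha)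
  refine ⟨YonedaAlg.of _ 0 (Ext.mk₀ (ModuleCat.ofHom g)), ?_⟩
  refine (yonedaModMap_of _ _ _ _).trans (congrArg (YonedaMod.of _ _ 0) ?_)
  rw [Ext.mk₀_comp_mk₀]
  exact congrArg Ext.mk₀ (ModuleCat.hom_ext (LinearMap.ext hg))

/-- Positive degrees die because `A` is projective; in degree 0 precomposition with the epimorphism
`A → A_0` is injective. Hence `E(A) ≅ Γ_0`. -/
theorem ker_extToRegular :
    LinearMap.ker (extToRegular 𝒜) = LinearMap.ker (augmentation (extGr 𝒜)) := by
  refine Submodule.ext fun x => ?_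
  rw [LinearMap.mem_ker, LinearMap.mem_ker, ker_augmentation_extGr]
  let y := yonedaSelf (degreeZero 𝒜).toModuleCat x
  have hc : ∀ i, YonedaMod.coeff i (extToRegular 𝒜 x) =
      (Ext.mk₀ (ModuleCat.ofHom (augmentation 𝒜))).comp (YonedaMod.coeff i y) (zero_add i) :=
    fun i => coeff_yonedaModMap _ _ y i
  constructor
  · intro h
    have : Epi (ModuleCat.ofHom (augmentation 𝒜)) :=
      (ModuleCat.epi_iff_surjective _).2 (augmentation_surjective 𝒜)
    have h1 := hc 0
    rw [h, map_zero] at h1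
    exact Ext.precomp_mk₀_injective_of_epi _ (ModuleCat.ofHom (augmentation 𝒜))
      (h1.symm.trans (Ext.comp_zero _ _ _ _ (zero_add 0)).symm)
  · intro h
    refine YonedaMod.ext_coeff fun i => ?_
    cases i with
    | zero =>
      rw [hc]
      exact (congrArg (fun z => Ext.comp _ z (zero_add 0)) h).trans
        ((Ext.comp_zero _ _ _ _ _).trans (map_zero _).symm)
    | succ i => rw [coeff_regular_succ, coeff_regular_succ]

/-- `Ext^*(A, A_0)` is the degree zero part of the Ext algebra. -/
def extRegularEquiv : YonedaMod (degreeZero 𝒜).toModuleCat (regular 𝒜).toModuleCat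
    ≃ₗ[ExtAlg 𝒜] (degreeZero (extGr 𝒜)).carrier :=
  ((extToRegular 𝒜).quotKerEquivOfSurjective (extToRegular_surjective 𝒜)).symm ≪≫ₗ
    Submodule.quotEquivOfEq _ _ (ker_extToRegular 𝒜) ≪≫ₗ
    (augmentation (extGr 𝒜)).quotKerEquivOfSurjective (augmentation_surjective (extGr 𝒜))

theorem isDeg_extRegularEquiv :
    IsDeg (yonedaGrMod k (degreeZero 𝒜).toModuleCat (regular 𝒜).toModuleCat)
      (degreeZero (extGr 𝒜)) 0 (extRegularEquiv 𝒜).toLinearMap := by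
  intro n l h m hm
  obtain rfl : n = l := by omega
  change _ ∈ (if n = 0 then (⊤ : Submodule k (degreeZero (extGr 𝒜)).carrier) else ⊥)
  split_ifs with hn
  · trivial
  · have : m = (0 : YonedaMod (degreeZero 𝒜).toModuleCat (regular 𝒜).toModuleCat) := by
      refine YonedaMod.ext_coeff fun i => ?_
      cases i with
      | zero => exact (hm 0 fun h => hn h.symm).trans (map_zero _).symm
      | succ i => exact (coeff_regular_succ 𝒜 i m).trans (map_zero _).symm
    rw [this, Submodule.mem_bot]
    exact map_zero (extRegularEquiv 𝒜)

/-- The hypotheses of Koszul duality: `A` is a locally finite Koszul algebra with self-injective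
degree zero part. -/
structure IsSelfInjectiveKoszul : Prop where
  finite : ∀ i, Module.Finite k (𝒜 i)
  injective : Module.Injective (𝒜 0) (𝒜 0)
  koszul : (degreeZero 𝒜).IsKoszul

variable {𝒜}

/-- `Γ_0` is Koszul since it is `E(A)` and `A` is a Koszul module. Everything proved for `A`
therefore applies to `Γ`. -/
theorem IsSelfInjectiveKoszul.extGr (h : IsSelfInjectiveKoszul 𝒜) :
    IsSelfInjectiveKoszul (extGr 𝒜) where
  finite i := by
    have := h.koszul.isLin.finite_ext (h.finite 0) i
    exact yonedaGr_finite _ i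
  injective := by
    have := h.finite 0
    exact injective_extGr_zero 𝒜 h.injective
  koszul := ((isKoszul_regular h.finite).isLin.isKoszul_yonedaGrMod (h.finite 0) h.injective
    h.koszul).of_isDeg_bijective (isDeg_extRegularEquiv 𝒜) (extRegularEquiv 𝒜).bijective

end ExtAlgebra

/-! ### The degree components of a Koszul module as Ext groups over `Γ`. -/

section GradedBiduality

variable {k : Type v} [Field k] {A : Type u} [Ring A] [Algebra k A] {𝒜 : ℕ → Submodule k A}

open GrMod

/-- The additive map on a graded module with given restrictions to the homogeneous components. -/
def GrMod.liftAdd (M : GrMod 𝒜) {Y : Type*} [AddCommGroup Y] (f : ∀ n, M.gr n →+ Y) :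
    M.carrier →+ Y :=
  (DirectSum.toAddMonoid f).comp M.dec.toLinearMap.toAddMonoidHom

theorem GrMod.liftAdd_apply (M : GrMod 𝒜) {Y : Type*} [AddCommGroup Y] (f : ∀ n, M.gr n →+ Y)
    {n : ℤ} {m : M.carrier} (hm : m ∈ M.gr n) : M.liftAdd f m = f n ⟨m, hm⟩ :=
  (congrArg (DirectSum.toAddMonoid f) (M.dec_of_mem hm)).trans (DirectSum.toAddMonoid_of f n _)

variable [GradedAlgebra 𝒜]

/-- One radical step removes exactly the lowest degree, and `IsKoszul.radShift` allows the step to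
be repeated. -/
theorem mem_radPow_iff (h : IsSelfInjectiveKoszul 𝒜) {i : ℕ} {M : GrMod 𝒜} (hM : M.IsKoszul)
    {x : M.carrier} : x ∈ radPow 𝒜 i M.toModuleCat ↔ x ∈ M.ge i := by
  induction i generalizing M with
  | zero => exact ⟨fun _ => hM.generatedIn.ge_eq_top ▸ trivial, fun _ => trivial⟩
  | succ i ih =>
    rw [mem_radPow_succ]
    have hs : IsDeg (radShift hM.generatedIn) M 1 (rad 𝒜 M.carrier).subtype :=
      isDeg_subtype M _ (isHomog_rad hM.generatedIn) 1
    have key : ∀ hx : x ∈ rad 𝒜 M.carrier,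
        (⟨x, hx⟩ : rad 𝒜 M.carrier) ∈ radPow 𝒜 i (radShift hM.generatedIn).toModuleCat ↔
        x ∈ M.ge (i + 1 : ℕ) := fun hx => by
      rw [ih (IsKoszul.radShift h.injective h.koszul hM)]
      have hp : ∀ n, M.proj (n + 1) x =
          (rad 𝒜 M.carrier).subtype ((radShift hM.generatedIn).proj n ⟨x, hx⟩) :=
        fun n => hs.proj_apply rfl ⟨x, hx⟩
      constructor
      · intro h1 n hn
        have h2 := hp (n - 1)
        rw [sub_add_cancel, h1 (n - 1) (by omega), map_zero] at h2
        exact h2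
      · intro h1 n hn
        exact Subtype.ext ((hp n).symm.trans (h1 (n + 1) (by omega)))
    refine ⟨fun ⟨hx, h1⟩ => (key hx).1 h1, fun h1 => ?_⟩
    have hx : x ∈ rad 𝒜 M.carrier := by
      rw [rad_eq_ge hM.generatedIn]
      exact fun n hn => h1 n (by omega)
    exact ⟨hx, (key hx).2 h1⟩

theorem mem_radPow_of_mem (h : IsSelfInjectiveKoszul 𝒜) {i : ℕ} {M : GrMod 𝒜} (hM : M.IsKoszul)
    {x : M.carrier} (hx : x ∈ M.gr i) : x ∈ radPow 𝒜 i M.toModuleCat :=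
  (mem_radPow_iff h hM).2 (M.mem_ge_of_mem le_rfl hx)

variable (𝒜)

/-- The isomorphism between `Ext^*(A, A_0)` and the degree zero part of the Ext algebra. -/
abbrev extRegularHom :
    extDualMod 𝒜 (regular 𝒜).toModuleCat ⟶ (degreeZero (extGr 𝒜)).toModuleCat :=
  ModuleCat.ofHom (extRegularEquiv 𝒜).toLinearMap

/-- The inverse of `extRegularHom`. -/
abbrev extRegularInv :
    (degreeZero (extGr 𝒜)).toModuleCat ⟶ extDualMod 𝒜 (regular 𝒜).toModuleCat :=
  ModuleCat.ofHom (extRegularEquiv 𝒜).symm.toLinearMap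

theorem extRegularHom_inv : extRegularHom 𝒜 ≫ extRegularInv 𝒜 = 𝟙 _ :=
  ModuleCat.hom_ext (LinearMap.ext (extRegularEquiv 𝒜).symm_apply_apply)

theorem extRegularInv_hom : extRegularInv 𝒜 ≫ extRegularHom 𝒜 = 𝟙 _ :=
  ModuleCat.hom_ext (LinearMap.ext (extRegularEquiv 𝒜).apply_symm_apply)

/-- The class in `Ext^i(Ext^*(N, A_0), Γ_0)` associated with an element of the `i`-th step of the
radical filtration of `N`. -/
def bidualityClass (i : ℕ) (N : ModuleCat.{u} A) (x : N) :
    Ext (extDualMod 𝒜 N) (degreeZero (extGr 𝒜)).toModuleCat i :=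
  (biduality 𝒜 i N x).comp (Ext.mk₀ (extRegularHom 𝒜)) (add_zero i)

/-- The class in `Ext^i(Γ_0, Γ_0)` associated with an element of the `i`-th step of the
radical filtration of `A`. -/
def algebraClass (i : ℕ) (a : A) :
    Ext (degreeZero (extGr 𝒜)).toModuleCat (degreeZero (extGr 𝒜)).toModuleCat i :=
  (Ext.mk₀ (extRegularInv 𝒜)).comp (bidualityClass 𝒜 i (regular 𝒜).toModuleCat
    (show (regular 𝒜).carrier from a)) (zero_add i)

variable {𝒜} (h : IsSelfInjectiveKoszul 𝒜) {M : GrMod 𝒜} (hM : M.IsKoszul)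
include h hM

theorem bidualityClass_add {i : ℕ} {x y : M.carrier} (hx : x ∈ M.gr i) (hy : y ∈ M.gr i) :
    bidualityClass 𝒜 i M.toModuleCat (x + y) =
      bidualityClass 𝒜 i M.toModuleCat x + bidualityClass 𝒜 i M.toModuleCat y := by
  rw [bidualityClass, biduality_add 𝒜 (mem_radPow_of_mem h hM hx) (mem_radPow_of_mem h hM hy),
    Ext.add_comp]
  rfl

theorem bidualityClass_map {i : ℕ} {M' : GrMod 𝒜} (hM' : M'.IsKoszul)
    (f : M.toModuleCat ⟶ M'.toModuleCat) {x : M.carrier} (hx : x ∈ M.gr i) :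
    bidualityClass 𝒜 i M'.toModuleCat (f.hom x) =
      (Ext.mk₀ (extDualHom 𝒜 f)).comp (bidualityClass 𝒜 i M.toModuleCat x) (zero_add i) := by
  rw [bidualityClass, biduality_map h.injective h.koszul hM.isLin hM'.isLin f
    (mem_radPow_of_mem h hM hx), Ext.comp_assoc _ _ _ (zero_add i) (add_zero i) (by omega)]
  rfl

theorem bidualityClass_smul {i j : ℕ} {x : M.carrier} (hx : x ∈ M.gr j) {a : A} (ha : a ∈ 𝒜 i) :
    bidualityClass 𝒜 (i + j) M.toModuleCat (a • x) =
      (bidualityClass 𝒜 j M.toModuleCat x).comp (algebraClass 𝒜 i a) (add_comm j i) := by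
  have hR := isKoszul_regular h.finite
  rw [bidualityClass, (biduality_smul h.injective h.koszul (add_comm j i) hM.isLin hR.isLin
    (mem_radPow_of_mem h hM hx)
    (mem_radPow_of_mem h hR ((mem_regular_gr 𝒜 rfl).2 ha))).2, algebraClass, bidualityClass,
    bidualityClass, Ext.comp_assoc _ _ _ (add_zero j) (zero_add i) (by omega),
    Ext.mk₀_comp_mk₀_assoc, extRegularHom_inv, Ext.mk₀_id_comp,
    Ext.comp_assoc _ _ _ (add_comm j i) (add_zero i) (by omega)]

theorem bidualityClass_eq_zero_iff {i : ℕ} {x : M.carrier} (hx : x ∈ M.ge i) :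
    bidualityClass 𝒜 i M.toModuleCat x = 0 ↔ x ∈ M.ge (i + 1 : ℕ) := by
  rw [← mem_radPow_iff h hM, ← biduality_eq_zero_iff h.injective h.koszul hM.isLin
    ((mem_radPow_iff h hM).2 hx)]
  constructor
  · intro h0
    have h1 : ((bidualityClass 𝒜 i M.toModuleCat x).comp (Ext.mk₀ (extRegularInv 𝒜))
      (add_zero i)) = 0 := by rw [h0, Ext.zero_comp]
    rwa [bidualityClass, Ext.comp_assoc _ _ _ (add_zero i) (add_zero 0) (by omega),
      Ext.mk₀_comp_mk₀, extRegularHom_inv, Ext.comp_mk₀_id] at h1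
  · intro h0
    rw [bidualityClass, h0, Ext.zero_comp]

theorem eq_zero_of_bidualityClass_eq_zero {i : ℕ} {x : M.carrier} (hx : x ∈ M.gr i)
    (h0 : bidualityClass 𝒜 i M.toModuleCat x = 0) : x = 0 := by
  have h1 := (bidualityClass_eq_zero_iff h hM (M.mem_ge_of_mem le_rfl hx)).1 h0 i (by omega)
  rwa [M.proj_of_mem hx] at h1

theorem exists_bidualityClass_eq {i : ℕ}
    (y : Ext (extDualMod 𝒜 M.toModuleCat) (degreeZero (extGr 𝒜)).toModuleCat i) :
    ∃ x ∈ M.gr i, bidualityClass 𝒜 i M.toModuleCat x = y := by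
  obtain ⟨x, hx, hxy⟩ := biduality_surjective h.injective h.koszul hM.isLin
    (y.comp (Ext.mk₀ (extRegularInv 𝒜)) (add_zero i))
  have h1 : bidualityClass 𝒜 i M.toModuleCat x = y := by
    rw [bidualityClass, hxy, Ext.comp_assoc _ _ _ (add_zero i) (add_zero 0) (by omega),
      Ext.mk₀_comp_mk₀, extRegularInv_hom, Ext.comp_mk₀_id]
  have hx' := (mem_radPow_iff h hM).1 hx
  refine ⟨M.proj i x, M.proj_mem _ _, ?_⟩
  -- The preimage is only known to lie in `M_{≥i}`; its part in degrees above `i` has zero class and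
  -- can be discarded.
  have h2 : x - M.proj i x ∈ M.ge (i + 1 : ℕ) := fun n hn => by
    rw [map_sub, M.proj_proj]
    split_ifs with hin
    · rw [← hin, sub_self]
    · rw [hx' n (by omega), sub_zero]
  have h3 : x - M.proj i x ∈ M.ge i := fun n hn => h2 n (by omega)
  have h4 := (bidualityClass_eq_zero_iff h hM h3).2 h2
  have h5 : biduality 𝒜 i M.toModuleCat x = biduality 𝒜 i M.toModuleCat (x - M.proj i x) +
      biduality 𝒜 i M.toModuleCat (M.proj i x) := by
    rw [← biduality_add 𝒜 ((mem_radPow_iff h hM).2 h3)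
      (mem_radPow_of_mem h hM (M.proj_mem _ _)), sub_add_cancel]
  rw [← h1, bidualityClass, bidualityClass, h5, Ext.add_comp]
  exact (zero_add _).symm.trans (congrArg (· + _) h4.symm)

/-- The isomorphism between a Koszul module and its double dual, as an additive map. -/
def bidualityMap : M.carrier →+
    YonedaMod (degreeZero (extGr 𝒜)).toModuleCat (extDualMod 𝒜 M.toModuleCat) :=
  M.liftAdd fun n => if hn : 0 ≤ n then
    AddMonoidHom.mk' (fun x => YonedaMod.of _ _ n.toNat
      (bidualityClass 𝒜 n.toNat M.toModuleCat x.1)) (fun x y => by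
        have hn' : ((n.toNat : ℕ) : ℤ) = n := Int.toNat_of_nonneg hn
        rw [← map_add, ← bidualityClass_add h hM (hn'.symm ▸ x.2) (hn'.symm ▸ y.2)]
        rfl) else 0

theorem bidualityMap_of_mem {i : ℕ} {x : M.carrier} (hx : x ∈ M.gr i) :
    bidualityMap h hM x = YonedaMod.of _ _ i (bidualityClass 𝒜 i M.toModuleCat x) := by
  rw [bidualityMap, M.liftAdd_apply _ hx, dif_pos (Int.natCast_nonneg i)]
  rfl

theorem coeff_bidualityMap (i : ℕ) (x : M.carrier) :
    YonedaMod.coeff i (bidualityMap h hM x) = bidualityClass 𝒜 i M.toModuleCat (M.proj i x) := by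
  have hz : bidualityClass 𝒜 i M.toModuleCat (0 : M.carrier) = 0 :=
    (bidualityClass_eq_zero_iff h hM (zero_mem _)).2 (zero_mem _)
  induction x using M.homogeneous_induction with
  | h0 => rw [map_zero, map_zero, map_zero, hz]
  | h2 x y hx hy =>
    rw [map_add, map_add, map_add, hx, hy, bidualityClass_add h hM (M.proj_mem _ _)
      (M.proj_mem _ _)]
  | h1 n x hx =>
    obtain hn | hn := lt_or_ge n 0
    · rw [hM.generatedIn.eq_zero_of_lt hn hx, map_zero, map_zero, map_zero, hz]
    · obtain ⟨j, rfl⟩ := Int.eq_ofNat_of_zero_le hn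
      rw [bidualityMap_of_mem h hM hx]
      obtain rfl | hij := eq_or_ne j i
      · rw [YonedaMod.coeff_of_same, M.proj_of_mem hx]
      · rw [YonedaMod.coeff_of_ne hij, M.proj_of_mem_ne hx (by omega), hz]

theorem bidualityMap_bijective : Function.Bijective (bidualityMap h hM) := by
  constructor
  · rw [injective_iff_map_eq_zero]
    refine fun x hx => M.ext_proj fun n => ?_
    rw [map_zero]
    obtain hn | hn := lt_or_ge n 0
    · exact hM.generatedIn.eq_zero_of_lt hn (M.proj_mem _ _)
    · obtain ⟨i, rfl⟩ := Int.eq_ofNat_of_zero_le hn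
      refine eq_zero_of_bidualityClass_eq_zero h hM (M.proj_mem _ _) ?_
      rw [← coeff_bidualityMap h hM, hx, map_zero]
  · intro y
    induction y using YonedaMod.induction with
    | h0 => exact ⟨0, map_zero _⟩
    | h2 x y hx hy =>
      obtain ⟨x, rfl⟩ := hx
      obtain ⟨y, rfl⟩ := hy
      exact ⟨x + y, map_add _ _ _⟩
    | h1 i y =>
      obtain ⟨x, hx, rfl⟩ := exists_bidualityClass_eq h hM y
      exact ⟨x, bidualityMap_of_mem h hM hx⟩

theorem bidualityMap_mem {n : ℤ} {x : M.carrier} (hx : x ∈ M.gr n) :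
    bidualityMap h hM x ∈ yonedaModGr k (degreeZero (extGr 𝒜)).toModuleCat
      (extDualMod 𝒜 M.toModuleCat) n := by
  obtain hn | hn := lt_or_ge n 0
  · rw [hM.generatedIn.eq_zero_of_lt hn hx, map_zero]
    exact zero_mem _
  · obtain ⟨i, rfl⟩ := Int.eq_ofNat_of_zero_le hn
    rw [bidualityMap_of_mem h hM hx]
    exact of_mem_yonedaModGr _ rfl _

theorem bidualityMap_naturality {M' : GrMod 𝒜} (hM' : M'.IsKoszul) (f : M ⟶ M')
    (x : M.carrier) : bidualityMap h hM' (Hom.lin f x) =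
      yonedaModMap (degreeZero (extGr 𝒜)).toModuleCat
        (extDualHom 𝒜 (ModuleCat.ofHom (Hom.lin f))) (bidualityMap h hM x) := by
  induction x using M.homogeneous_induction with
  | h0 => simp only [map_zero]
  | h2 x y hx hy => simp only [map_add, hx, hy]
  | h1 n x hx =>
    obtain hn | hn := lt_or_ge n 0
    · rw [hM.generatedIn.eq_zero_of_lt hn hx]; simp only [map_zero]
    · obtain ⟨i, rfl⟩ := Int.eq_ofNat_of_zero_le hn
      rw [bidualityMap_of_mem h hM hx, bidualityMap_of_mem h hM' (Hom.map_mem f i x hx),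
        yonedaModMap_of, ← bidualityClass_map h hM hM' (ModuleCat.ofHom (Hom.lin f)) hx]
      rfl

end GradedBiduality

/-! ### The isomorphism between `A` and the Ext algebra of `Γ`, and its compatibility with the
actions. -/

section AlgebraIso

variable {k : Type v} [Field k] {A : Type u} [Ring A] [Algebra k A] {𝒜 : ℕ → Submodule k A}
  [GradedAlgebra 𝒜]

open GrMod

theorem coeff_smul {X N : ModuleCat.{u} A} (c : k) (x : YonedaMod X N) (i : ℕ) :
    YonedaMod.coeff i (c • x) = c • YonedaMod.coeff i x := rfl

theorem mk₀_eq_smul {Y Z : ModuleCat.{u} A} (c : k) {f g : Y ⟶ Z}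
    (h : ∀ y, g.hom y = algebraMap k A c • f.hom y) : Ext.mk₀ g = c • Ext.mk₀ f := by
  rw [← Ext.mk₀_smul]
  exact congrArg Ext.mk₀ (ModuleCat.hom_ext (LinearMap.ext h))

theorem mk₀_dualElement_algebraMap (c : k) :
    Ext.mk₀ (dualElement 𝒜 (regular 𝒜).toModuleCat
      (show (regular 𝒜).carrier from algebraMap k A c)) =
      c • Ext.mk₀ (𝟙 (extDualMod 𝒜 (regular 𝒜).toModuleCat)) := by
  have h1 : Ext.mk₀ (X := (regular 𝒜).toModuleCat) (Y := (regular 𝒜).toModuleCat)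
      (ModuleCat.ofHom (ofElement 𝒜 (show (regular 𝒜).carrier from algebraMap k A c))) =
      c • Ext.mk₀ (𝟙 (regular 𝒜).toModuleCat) :=
    mk₀_eq_smul c fun y => (Algebra.commutes c (show A from y)).symm
  refine mk₀_eq_smul c fun y => Eq.trans ?_ (algebraMap_smul (ExtAlg 𝒜) c y).symm
  refine YonedaMod.ext_coeff fun i => ?_
  rw [coeff_smul]
  refine (coeff_yonedaModMap _ _ y i).trans ?_
  refine (congrArg (fun z => Ext.comp z (YonedaMod.coeff i y) (zero_add i)) h1).trans ?_
  rw [Ext.smul_comp, Ext.mk₀_id_comp]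

theorem yonedaAlg_algebraMap (X : ModuleCat.{u} A) (c : k) :
    algebraMap k (YonedaAlg X) c = YonedaAlg.of X 0 (c • Ext.mk₀ (𝟙 X)) := rfl

/-- The isomorphism between `A` and the Ext algebra of its Ext algebra, as an additive map. -/
def algebraIsoAdd (h : IsSelfInjectiveKoszul 𝒜) : A →+ ExtAlg (extGr 𝒜) :=
  ((yonedaSelf (degreeZero (extGr 𝒜)).toModuleCat).symm.toLinearMap ∘ₗ
    yonedaModMap (degreeZero (extGr 𝒜)).toModuleCat (extRegularInv 𝒜)).toAddMonoidHom.comp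
    (bidualityMap h (isKoszul_regular h.finite))

variable (h : IsSelfInjectiveKoszul 𝒜)

theorem algebraIsoAdd_of_mem {i : ℕ} {a : A} (ha : a ∈ 𝒜 i) :
    algebraIsoAdd h a = YonedaAlg.of _ i (algebraClass 𝒜 i a) := by
  have h1 := bidualityMap_of_mem h (isKoszul_regular h.finite) ((mem_regular_gr 𝒜 rfl).2 ha)
  refine (congrArg (fun y => (yonedaSelf (degreeZero (extGr 𝒜)).toModuleCat).symm
    (yonedaModMap (degreeZero (extGr 𝒜)).toModuleCat (extRegularInv 𝒜) y)) h1).trans ?_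
  rw [yonedaModMap_of]
  rfl

theorem bidualityMap_smul {M : GrMod 𝒜} (hM : M.IsKoszul) (a : A) (x : M.carrier) :
    bidualityMap h hM (a • x) = algebraIsoAdd h a • bidualityMap h hM x := by
  induction a using DirectSum.Decomposition.inductionOn 𝒜 with
  | zero => rw [zero_smul, map_zero, map_zero, zero_smul]
  | add a b ha hb => rw [add_smul, map_add, map_add, add_smul, ha, hb]
  | @homogeneous i a =>
    induction x using M.homogeneous_induction with
    | h0 => rw [smul_zero, map_zero, smul_zero]
    | h2 x y hx hy => rw [smul_add, map_add, map_add, smul_add, hx, hy]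
    | h1 n x hx =>
      obtain hn | hn := lt_or_ge n 0
      · rw [hM.generatedIn.eq_zero_of_lt hn hx, smul_zero, map_zero, smul_zero]
      · obtain ⟨j, rfl⟩ := Int.eq_ofNat_of_zero_le hn
        have hax : (a : A) • x ∈ M.gr ((i + j : ℕ) : ℤ) := by
          rw [Nat.cast_add]; exact M.smul_mem a.2 hx
        rw [bidualityMap_of_mem h hM hx, algebraIsoAdd_of_mem h a.2, YonedaMod.of_smul_of,
          bidualityMap_of_mem h hM hax, bidualityClass_smul h hM hx a.2]

/-- This is compatibility with the action on the Koszul module `A`, carried from `E_Γ(E(A))` to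
`E_Γ(Γ_0)` by `Γ`-duality applied to `E(A) ≅ Γ_0`. -/
theorem algebraIsoAdd_mul (a b : A) :
    algebraIsoAdd h (a * b) = algebraIsoAdd h a * algebraIsoAdd h b := by
  have h1 := bidualityMap_smul h (isKoszul_regular h.finite) a
    (show (regular 𝒜).carrier from b)
  refine (congrArg (fun y => (yonedaSelf (degreeZero (extGr 𝒜)).toModuleCat).symm
    (yonedaModMap (degreeZero (extGr 𝒜)).toModuleCat (extRegularInv 𝒜) y)) h1).trans ?_
  rw [map_smul, map_smul]
  rfl

theorem algebraIsoAdd_algebraMap (c : k) :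
    algebraIsoAdd h (algebraMap k A c) = algebraMap k _ c := by
  have hc : algebraMap k A c ∈ 𝒜 0 := SetLike.algebraMap_mem_graded 𝒜 c
  rw [algebraIsoAdd_of_mem h hc, yonedaAlg_algebraMap, algebraClass, bidualityClass,
    biduality_zero, mk₀_dualElement_algebraMap, Ext.smul_comp, Ext.comp_smul,
    Ext.mk₀_comp_mk₀, Ext.mk₀_comp_mk₀, Category.id_comp, extRegularInv_hom]

theorem algebraIsoAdd_bijective : Function.Bijective (algebraIsoAdd h) := by
  have h1 : Function.Bijective
      (yonedaModMap (degreeZero (extGr 𝒜)).toModuleCat (extRegularInv 𝒜)) := by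
    have e1 : yonedaModMap (degreeZero (extGr 𝒜)).toModuleCat (extRegularInv 𝒜) ∘ₗ
        yonedaModMap (degreeZero (extGr 𝒜)).toModuleCat (extRegularHom 𝒜) = LinearMap.id := by
      rw [← yonedaModMap_comp, extRegularInv_hom, yonedaModMap_id]
    have e2 : yonedaModMap (degreeZero (extGr 𝒜)).toModuleCat (extRegularHom 𝒜) ∘ₗ
        yonedaModMap (degreeZero (extGr 𝒜)).toModuleCat (extRegularInv 𝒜) = LinearMap.id := by
      rw [← yonedaModMap_comp, extRegularHom_inv, yonedaModMap_id]
    exact Function.bijective_iff_has_inverse.2 ⟨yonedaModMap _ (extRegularHom 𝒜),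
      fun x => LinearMap.congr_fun e2 x, fun x => LinearMap.congr_fun e1 x⟩
  exact ((LinearEquiv.bijective (yonedaSelf (degreeZero (extGr 𝒜)).toModuleCat).symm).comp
    h1).comp (bidualityMap_bijective h (isKoszul_regular h.finite))

/-- The isomorphism between `A` and the Ext algebra of its Ext algebra. -/
def algebraIso : A ≃ₐ[k] ExtAlg (extGr 𝒜) :=
  AlgEquiv.ofBijective
    { toFun := algebraIsoAdd h
      map_one' := by
        have := algebraIsoAdd_algebraMap h 1
        rwa [map_one (algebraMap k A), map_one (algebraMap k (ExtAlg (extGr 𝒜)))] at this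
      map_mul' := algebraIsoAdd_mul h
      map_zero' := map_zero _
      map_add' := map_add _
      commutes' := algebraIsoAdd_algebraMap h } (algebraIsoAdd_bijective h)

theorem algebraIso_mem_iff (i : ℕ) (a : A) :
    algebraIso h a ∈ extGr (extGr 𝒜) i ↔ a ∈ 𝒜 i := by
  have h1 : ∀ b ∈ 𝒜 i, algebraIso h b ∈ extGr (extGr 𝒜) i := fun b hb => by
    change algebraIsoAdd h b ∈ _
    rw [algebraIsoAdd_of_mem h hb]
    exact of_mem_yonedaGr _ _
  refine ⟨fun ha => ?_, h1 a⟩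
  obtain ⟨y, hy⟩ := exists_of_mem_yonedaModGr (k := k) (degreeZero (extGr 𝒜)).toModuleCat
    ((mem_yonedaGr_iff _).1 ha)
  -- A homogeneous element of the target has a preimage `b` of the same degree, and `b = a` by
  -- injectivity.
  obtain ⟨b, hb, hby⟩ := exists_bidualityClass_eq h (isKoszul_regular h.finite)
    ((Ext.mk₀ (extRegularHom 𝒜)).comp y (zero_add i))
  have hb' := (mem_regular_gr 𝒜 (n := i) rfl).1 hb
  have h2 : algebraIso h b = algebraIso h a := by
    refine (algebraIsoAdd_of_mem h hb').trans (Eq.trans ?_ hy)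
    refine congrArg (YonedaMod.of (degreeZero (extGr 𝒜)).toModuleCat _ i) ?_
    refine (congrArg (fun z => (Ext.mk₀ (extRegularInv 𝒜)).comp z (zero_add i)) hby).trans ?_
    rw [Ext.mk₀_comp_mk₀_assoc, extRegularInv_hom, Ext.mk₀_id_comp]
  rw [← (algebraIso h).injective h2]
  exact hb'

end AlgebraIso

/-! ### Transport of Koszul modules along an isomorphism of graded algebras. -/

section Restrict

variable {k : Type v} [Field k] {A : Type u} [Ring A] [Algebra k A] {𝒜 : ℕ → Submodule k A}
  {B : Type u} [Ring B] [Algebra k B] {ℬ : ℕ → Submodule k B}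

open GrMod

/-- An isomorphism of graded modules from a bijective homomorphism. -/
def GrMod.isoOfBijective {M N : GrMod 𝒜} (f : M ⟶ N) (hf : Function.Bijective (Hom.lin f)) :
    M ≅ N where
  hom := f
  inv :=
    { lin := (LinearEquiv.ofBijective (Hom.lin f) hf).symm.toLinearMap
      map_mem := fun n y hy => by
        have hd : IsDeg M N 0 (Hom.lin f) := fun n l h m hm => by
          obtain rfl : n = l := by omega
          exact Hom.map_mem f n m hm
        obtain ⟨x, hx, rfl⟩ := hd.exists_preimage hf.2 (add_zero n) hy
        exact ((LinearEquiv.ofBijective (Hom.lin f) hf).symm_apply_apply x).symm ▸ hx }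
  hom_inv_id := Hom.ext (LinearMap.ext (LinearEquiv.ofBijective (Hom.lin f) hf).symm_apply_apply)
  inv_hom_id := Hom.ext (LinearMap.ext (LinearEquiv.ofBijective (Hom.lin f) hf).apply_symm_apply)

variable (φ : A ≃ₐ[k] B) (hφ : ∀ i a, φ a ∈ ℬ i ↔ a ∈ 𝒜 i)

/-- Restriction of graded modules along an isomorphism of graded algebras. -/
abbrev GrMod.restrictIso : GrMod ℬ ⥤ GrMod 𝒜 :=
  GrMod.restrict (φ : A →ₐ[k] B) fun i a => (hφ i a).2

instance : (GrMod.restrictIso φ hφ).Faithful where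
  map_injective h := Hom.ext (LinearMap.ext fun m =>
    LinearMap.congr_fun (congrArg Hom.lin h) m)

instance : (GrMod.restrictIso φ hφ).Full where
  map_surjective {M N} f :=
    ⟨{ lin :=
        { toFun := Hom.lin f
          map_add' := map_add (Hom.lin f)
          map_smul' := fun b m => by
            obtain ⟨a, rfl⟩ := φ.surjective b
            exact (Hom.lin f).map_smul' a m }
       map_mem := Hom.map_mem f }, rfl⟩

theorem GrMod.GeneratedIn.restrictIso {M : GrMod ℬ} {s : ℤ} (hM : M.GeneratedIn s) :
    ((GrMod.restrictIso φ hφ).obj M).GeneratedIn s := by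
  let N := (GrMod.restrictIso φ hφ).obj M
  have key : ∀ m ∈ Submodule.span B (M.gr s : Set M.carrier),
      (show N.carrier from m) ∈ Submodule.span A (N.gr s : Set N.carrier) := fun m hm => by
    induction hm using Submodule.span_induction with
    | mem x hx => exact Submodule.subset_span hx
    | zero => exact zero_mem (Submodule.span A (N.gr s : Set N.carrier))
    | add x y _ _ hx hy => exact add_mem hx hy
    | smul b x _ hx =>
      obtain ⟨a, rfl⟩ := φ.surjective b
      exact Submodule.smul_mem _ a hx
  exact top_unique fun m _ => key m (hM ▸ trivial)

theorem GrMod.projective_restrictIso {M : GrMod ℬ} (hM : Module.Projective B M.carrier) :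
    Module.Projective A ((GrMod.restrictIso φ hφ).obj M).carrier := by
  let N := (GrMod.restrictIso φ hφ).obj M
  obtain ⟨s, hs⟩ := hM.out
  -- A section of the free cover over `B` becomes one over `A` by applying `φ⁻¹` to the
  -- coefficients.
  let τ : (M.carrier →₀ B) →+ (N.carrier →₀ A) :=
    Finsupp.mapRange.addMonoidHom φ.symm.toAddEquiv.toAddMonoidHom
  have hτ : ∀ x, Finsupp.linearCombination A (id : N.carrier → N.carrier) (τ x) =
      Finsupp.linearCombination B (id : M.carrier → M.carrier) x := fun x => by
    induction x using Finsupp.induction_linear with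
    | zero => rw [map_zero, map_zero]; exact (map_zero _).symm
    | add x y hx hy => rw [map_add, map_add, hx, hy]; exact (map_add _ _ _).symm
    | single m b =>
      have h1 : τ (Finsupp.single m b) = Finsupp.single m (φ.symm b) :=
        Finsupp.mapRange_single (hf := map_zero _)
      rw [h1, Finsupp.linearCombination_single]
      exact (Finsupp.linearCombination_single A (φ.symm b) (v := (id : N.carrier → N.carrier)) m).trans
        (congrArg (· • m) (φ.apply_symm_apply b))
  refine ⟨⟨⟨fun x => τ (s x), fun x y => ?_⟩, fun a x => ?_⟩, fun x => ?_⟩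
  · exact (congrArg τ (map_add s x y)).trans (map_add τ _ _)
  · refine (congrArg τ (s.map_smul' (φ a) x)).trans ?_
    refine Finsupp.ext fun m => ?_
    change φ.symm (φ a * s x m) = a * φ.symm (s x m)
    rw [map_mul, φ.symm_apply_apply]
  · exact (hτ (s x)).trans (hs x)

theorem GrMod.IsKoszul.restrictIso {M : GrMod ℬ} (hM : M.IsKoszul) :
    ((GrMod.restrictIso φ hφ).obj M).IsKoszul := by
  obtain ⟨P, d, ε, hlf, hproj, hgen, hs, he, hd⟩ := hM.resolution
  exact ⟨hM.locallyFinite, hM.generatedIn.restrictIso φ hφ,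
    fun i => (GrMod.restrictIso φ hφ).obj (P i), fun i => (GrMod.restrictIso φ hφ).map (d i),
    (GrMod.restrictIso φ hφ).map ε, hlf, fun i => projective_restrictIso φ hφ (hproj i),
    fun i => (hgen i).restrictIso φ hφ, hs, he, hd⟩

end Restrict

/-! ### The equivalence of categories, from the double dual isomorphisms over `A` and over `Γ`. -/

section Duality

variable {k : Type v} [Field k] {A : Type u} [Ring A] [Algebra k A] {𝒜 : ℕ → Submodule k A}
  [GradedAlgebra 𝒜]

open GrMod

theorem IsSelfInjectiveKoszul.isKoszul_extDual (h : IsSelfInjectiveKoszul 𝒜) {M : GrMod 𝒜}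
    (hM : M.IsKoszul) : ((extDual 𝒜).obj (op M)).IsKoszul :=
  hM.isLin.isKoszul_yonedaGrMod (h.finite 0) h.injective h.koszul

/-- A Koszul module is isomorphic to its double dual. -/
def bidualityIso (h : IsSelfInjectiveKoszul 𝒜) {M : GrMod 𝒜} (hM : M.IsKoszul) :
    M ≅ (GrMod.restrictIso (algebraIso h) (algebraIso_mem_iff h)).obj
      ((extDual (extGr 𝒜)).obj (op ((extDual 𝒜).obj (op M)))) :=
  isoOfBijective
    { lin :=
        { toFun := bidualityMap h hM
          map_add' := map_add _
          map_smul' := bidualityMap_smul h hM }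
      map_mem := fun _ _ hx => bidualityMap_mem h hM hx }
    (bidualityMap_bijective h hM)

theorem bidualityIso_naturality (h : IsSelfInjectiveKoszul 𝒜) {M M' : GrMod 𝒜}
    (hM : M.IsKoszul) (hM' : M'.IsKoszul) (f : M ⟶ M') :
    f ≫ (bidualityIso h hM').hom = (bidualityIso h hM).hom ≫
      (GrMod.restrictIso (algebraIso h) (algebraIso_mem_iff h)).map
        ((extDual (extGr 𝒜)).map ((extDual 𝒜).map f.op).op) :=
  Hom.ext (LinearMap.ext fun x => bidualityMap_naturality h hM hM' f x)

/-- The duality functor on Koszul modules. -/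
abbrev IsSelfInjectiveKoszul.dual (h : IsSelfInjectiveKoszul 𝒜) :
    (KoszulMod 𝒜)ᵒᵖ ⥤ KoszulMod (GrKoszul.extGr 𝒜) :=
  koszulDual 𝒜 fun _ hM => h.isKoszul_extDual hM

/-- Restriction of Koszul modules along the isomorphism between `A` and the Ext algebra of its Ext
algebra. -/
abbrev IsSelfInjectiveKoszul.restrict (h : IsSelfInjectiveKoszul 𝒜) :
    KoszulMod (GrKoszul.extGr (GrKoszul.extGr 𝒜)) ⥤ KoszulMod 𝒜 :=
  (GrKoszul.koszul 𝒜).lift ((GrKoszul.koszul _).ι ⋙ GrMod.restrictIso (algebraIso h) (algebraIso_mem_iff h))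
    fun M => M.property.restrictIso (algebraIso h) (algebraIso_mem_iff h)

/-- The functor in the opposite direction. -/
abbrev IsSelfInjectiveKoszul.predual (h : IsSelfInjectiveKoszul 𝒜) :
    (KoszulMod (GrKoszul.extGr 𝒜))ᵒᵖ ⥤ KoszulMod 𝒜 :=
  h.extGr.dual ⋙ h.restrict

/-- Koszul modules are isomorphic to their double duals. -/
def IsSelfInjectiveKoszul.bidualIso (h : IsSelfInjectiveKoszul 𝒜) :
    𝟭 (KoszulMod 𝒜) ≅ h.dual.rightOp ⋙ h.predual :=
  NatIso.ofComponents (fun M => (GrKoszul.koszul 𝒜).isoMk (bidualityIso h M.property))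
    fun {M M'} f => ObjectProperty.hom_ext _ (bidualityIso_naturality h M.property M'.property f.hom)

instance (h : IsSelfInjectiveKoszul 𝒜) : h.restrict.Faithful where
  map_injective {M N _ _} hfg := ObjectProperty.hom_ext _
    ((GrMod.restrictIso (algebraIso h) (algebraIso_mem_iff h)).map_injective
      (congrArg (fun q : h.restrict.obj M ⟶ h.restrict.obj N => q.hom) hfg))

instance (h : IsSelfInjectiveKoszul 𝒜) : h.restrict.Full where
  map_surjective f :=
    have ⟨g, hg⟩ := (GrMod.restrictIso (algebraIso h) (algebraIso_mem_iff h)).map_surjective f.hom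
    ⟨ObjectProperty.homMk g, ObjectProperty.hom_ext _ hg⟩

/-- `E` is the first factor of a composite isomorphic to the identity. -/
theorem IsSelfInjectiveKoszul.faithful_dual (h : IsSelfInjectiveKoszul 𝒜) : h.dual.Faithful := by
  have : h.dual.rightOp.Faithful := Functor.Faithful.of_comp_iso h.bidualIso.symm
  exact inferInstanceAs h.dual.rightOp.leftOp.Faithful

/-- The second factor of that composite is faithful, by faithfulness of the dual for `Γ`, so
fullness of the composite descends to the first. -/
theorem IsSelfInjectiveKoszul.full_dual (h : IsSelfInjectiveKoszul 𝒜) : h.dual.Full := by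
  have := h.extGr.faithful_dual
  have : h.predual.Faithful := Functor.Faithful.comp h.extGr.dual h.restrict
  have : h.dual.rightOp.Full := Functor.Full.of_comp_faithful_iso h.bidualIso.symm
  exact inferInstanceAs h.dual.rightOp.leftOp.Full

theorem IsSelfInjectiveKoszul.isEquivalence_dual (h : IsSelfInjectiveKoszul 𝒜) :
    h.dual.IsEquivalence := by
  have := h.extGr.faithful_dual
  have := h.extGr.full_dual
  have : h.predual.Faithful := Functor.Faithful.comp h.extGr.dual h.restrict
  have : h.predual.Full := Functor.Full.comp h.extGr.dual h.restrict
  exact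
    { faithful := h.faithful_dual
      full := h.full_dual
      -- A preimage of `N` is its predual: the double dual isomorphism of the predual is reflected
      -- by the fully faithful functor `h.predual` to an isomorphism with `N`.
      essSurj := ⟨fun N => ⟨op (h.predual.obj (op N)), ⟨
        (h.predual.preimageIso (h.bidualIso.app (h.predual.obj (op N)))).unop⟩⟩⟩ }

end Duality

end GrKoszul

end

/-- Generalized Koszul duality: `E = Ext^*_A(-, A_0)` sends Koszul `A`-modules to Koszul
`Γ`-modules, is a contravariant equivalence between the two categories, and, for an isomorphism
`φ` of graded algebras from `A` to `Ext^*_Γ(Γ_0, Γ_0)`, one has `E_Γ E M ≅ M` as graded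
`A`-modules, naturally in `M`. -/
theorem theorem4p1 {k : Type v} [Field k] [IsAlgClosed k] {A : Type u} [Ring A] [Algebra k A]
    (𝒜 : ℕ → Submodule k A) [GradedAlgebra 𝒜]
    (hfin : ∀ i, Module.Finite k (𝒜 i))
    (hinj : IsSelfInjective (𝒜 0))
    (hA : (degreeZero 𝒜).IsKoszul) :
    ∃ hE : ∀ M : GrMod 𝒜, M.IsKoszul → ((extDual 𝒜).obj (op M)).IsKoszul,
      (koszulDual 𝒜 hE).IsEquivalence ∧
      ∃ (φ : A ≃ₐ[k] ExtAlg (extGr 𝒜))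
        (hφ : ∀ i a, φ a ∈ extGr (extGr 𝒜) i ↔ a ∈ 𝒜 i),
        Nonempty ((koszul 𝒜).ι ≅ (koszul 𝒜).ι ⋙ (extDual 𝒜).rightOp ⋙
          extDual (extGr 𝒜) ⋙
            GrMod.restrict (φ : A →ₐ[k] ExtAlg (extGr 𝒜)) (fun i a => (hφ i a).2)) := by
  have h : IsSelfInjectiveKoszul 𝒜 := ⟨hfin, hinj (𝒜 0) inferInstance, hA⟩
  refine ⟨fun M hM => h.isKoszul_extDual hM, h.isEquivalence_dual, algebraIso h,
    algebraIso_mem_iff h, ⟨?_⟩⟩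
  exact NatIso.ofComponents (fun M => bidualityIso h M.property)
    fun {M M'} f => bidualityIso_naturality h M.property M'.property f.hom
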